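/- **Setting.** A noncommutative probability space $(\mathcal A,\tau)$ is a complex unital $*$-algebra $\mathcal A$ with a unital, positive, tracial linear functional $\tau$; $L^2(\tau)$ is the Hausdorff completion of $\mathcal A$ for $\langle a,b\rangle=\tau(a^*b)$, and $\tau(\xi P):=\langle P^*,\xi\rangle$ for $\xi\in L^2(\tau)$, $P\in\mathcal A$. For self-adjoint $X\in\mathcal A$ and a unital $*$-subalgebra $B\subset\mathcal A$, the free score $J(X:B)$ is the unique element (if it exists) of the $L^2(\tau)$-closure of $\mathrm{Alg}(X,B)$ such that $$(\tau\otimes\tau)\big((\partial P)(X,Y_1,\dots,Y_m)\big)=\tau\big(J(X:B)\,P(X,Y_1,\dots,Y_m)\big)$$ for all $Y_1,\dots,Y_m\in B$ and all noncommutative polynomials $P$, where $\partial$ is the derivation with $\partial X=1\otimes1$ and $\partial Y_j=0$. Put $\Phi^*(X:B)=\|J(X:B)\|_{L^2(\tau)}^2$, with value $+\infty$ if the score does not exist. For self-adjoint $X_1,\dots,X_n\in\mathcal A$ put $$\Phi^*(X_1,\dots,X_n)=\sum_{i=1}^n\Phi^*\big(X_i:\mathrm{Alg}(X_1,\dots,X_{i-1},X_{i+1},\dots,X_n)\big)\in[0,\infty],$$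 $$\chi^*(X_1,\dots,X_n)=\frac12\int_0^\infty\Big(\frac n{1+t}-\Phi^*(X_1+t^{1/2}Z_1,\dots,X_n+t^{1/2}Z_n)\Big)\,dt+\frac n2\log 2\pi e\in[-\infty,\infty],$$ where $Z_1,\dots,Z_n$, in a trace-preserving extension of $(\mathcal A,\tau)$, are semicircular elements (of law $\frac1{2\pi}(4-x^2)_+^{1/2}\,dx$) that are free from each other and from $X_1,\dots,X_n$; the value does not depend on their choice. **Theorem (monotonicity for several variables).** Let $(\mathcal A,\tau)$ be a noncommutative probability space, $X_1,\dots,X_n\in\mathcal A$ self-adjoint, $k\ge1$ real, and $p\in\mathcal A$ a projection ($p=p^*=p^2$) with $\tau(p)=1/k$ that is free from $\{X_1,\dots,X_n\}$. Let $\mathcal A_p=p\mathcal Ap$ be the compressed algebra with unit $p$ and trace $\tau_p(x)=k\,\tau(x)$, and let $\pi:\mathcal A\to\mathcal A_p$, $\pi(X)=pXp$. Then, with the left-hand sides computed in $(\mathcal A_p,\tau_p)$, $$\Phi^*\big(k^{1/2}\pi(X_1),\dots,k^{1/2}\pi(X_n)\big)\le\Phi^*(X_1,\dots,X_n),$$ $$\chi^*\big(k^{1/2}\pi(X_1),\dots,k^{1/2}\pi(X_n)\big)\ge\chi^*(X_1,\dots,X_n).$$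 -/

import Mathlib

open scoped ComplexOrder TensorProduct ENNReal

set_option linter.unusedSectionVars false

universe u

noncomputable section

namespace FreeProb

section Spaces

variable {A : Type u} [Ring A] [StarRing A] [Algebra ℂ A] [StarModule ℂ A]

/-- A unital positive tracial linear functional `τ` on a complex unital `*`-algebra `A`;
the pair `(A, τ)` is a (tracial) noncommutative probability space. Faithfulness is not required. -/
structure TracialState (A : Type u) [Ring A] [StarRing A] [Algebra ℂ A] where
  /-- the underlying linear functional -/
  toLinearMap : A →ₗ[ℂ] ℂ
  map_one' : toLinearMap 1 = 1
  map_mul_comm' : ∀ a b : A, toLinearMap (a * b) = toLinearMap (b * a)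
  nonneg' : ∀ a : A, 0 ≤ toLinearMap (star a * a)

instance : CoeFun (TracialState A) (fun _ => A → ℂ) := ⟨fun τ => τ.toLinearMap⟩

theorem TracialState.map_star (τ : TracialState A) (a : A) :
    τ (star a) = starRingEnd ℂ (τ a) := by
  have h0 : (τ (star a * a)).im = 0 := ((Complex.nonneg_iff.mp (τ.nonneg' a)).2).symm
  have h0' : (τ (1 : A)).im = 0 := by rw [τ.map_one']; simp
  have h1 := ((Complex.nonneg_iff.mp (τ.nonneg' (1 + a))).2).symm
  have h2 := ((Complex.nonneg_iff.mp (τ.nonneg' (1 + Complex.I • a))).2).symm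
  simp only [star_add, star_one, star_smul, add_mul, mul_add, one_mul, mul_one, map_add,
    smul_mul_assoc, mul_smul_comm, map_smul, Complex.add_im, smul_eq_mul, Complex.mul_im,
    Complex.mul_re, RCLike.star_def, Complex.conj_I, Complex.I_re, Complex.I_im, Complex.neg_re,
    Complex.neg_im, h0, h0'] at h1 h2
  apply Complex.ext
  · rw [Complex.conj_re]; linarith
  · rw [Complex.conj_im]; linarith

/-! ### The Hilbert space `L²(τ)` -/

/-- A copy of `A`, carrying the semi-inner product `⟪a, b⟫ = τ (a* b)`. -/
def PreL2 (_τ : TracialState A) : Type u := A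

instance (τ : TracialState A) : AddCommGroup (PreL2 τ) := inferInstanceAs (AddCommGroup A)
instance (τ : TracialState A) : Module ℂ (PreL2 τ) := inferInstanceAs (Module ℂ A)

/-- The identity map from `A` to its copy. -/
def toPreL2 (τ : TracialState A) : A ≃ₗ[ℂ] PreL2 τ := LinearEquiv.refl ℂ A

abbrev preL2Core (τ : TracialState A) : PreInnerProductSpace.Core ℂ (PreL2 τ) where
  inner a b := τ (star ((toPreL2 τ).symm a) * (toPreL2 τ).symm b)
  conj_inner_symm a b := by rw [← τ.map_star, star_mul, star_star]
  re_inner_nonneg a := (Complex.nonneg_iff.mp (τ.nonneg' _)).1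
  add_left a b c := by rw [map_add, star_add, add_mul, map_add]
  smul_left a b r := by simp

instance (τ : TracialState A) : SeminormedAddCommGroup (PreL2 τ) :=
  InnerProductSpace.Core.toSeminormedAddCommGroup (c := preL2Core τ)
instance (τ : TracialState A) : InnerProductSpace ℂ (PreL2 τ) :=
  InnerProductSpace.ofCore (preL2Core τ)

/-- `L²(τ)`: the Hausdorff completion of `A` for the semi-inner product `⟪a, b⟫ = τ (a* b)`. -/
abbrev L2 (τ : TracialState A) : Type u := UniformSpace.Completion (PreL2 τ)

/-- The canonical linear map `A → L²(τ)`. -/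
def toL2 (τ : TracialState A) : A →ₗ[ℂ] L2 τ :=
  (UniformSpace.Completion.toComplL (𝕜 := ℂ) (E := PreL2 τ)).toLinearMap ∘ₗ
    (toPreL2 τ).toLinearMap

theorem inner_toL2 (τ : TracialState A) (a b : A) :
    inner ℂ (toL2 τ a) (toL2 τ b) = τ (star a * b) :=
  UniformSpace.Completion.inner_coe (𝕜 := ℂ) (toPreL2 τ a) (toPreL2 τ b)

/-- The pairing `τ (ξ P)` of `ξ ∈ L²(τ)` with `P ∈ A`, that is `⟪P*, ξ⟫`. -/
def traceMul (τ : TracialState A) (ξ : L2 τ) (P : A) : ℂ := inner ℂ (toL2 τ (star P)) ξ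

theorem traceMul_toL2 (τ : TracialState A) (a P : A) : traceMul τ (toL2 τ a) P = τ (a * P) := by
  rw [traceMul, inner_toL2, star_star]
  exact τ.map_mul_comm' P a

/-! ### Free independence -/

/-- Free independence of a family of unital subalgebras: `τ (a₁ ⋯ aₘ) = 0` whenever `m ≥ 1`,
each `aⱼ` is a centred element of one of the subalgebras, and neighbouring elements are taken from
subalgebras with different indices. -/
def IsFree (τ : TracialState A) {ι : Type*} (S : ι → Subalgebra ℂ A) : Prop :=
  ∀ l : List (ι × A), l ≠ [] → (∀ q ∈ l, q.2 ∈ S q.1 ∧ τ q.2 = 0) →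
    l.IsChain (fun q r => q.1 ≠ r.1) → τ (l.map Prod.snd).prod = 0

/-- Two sets are free from each other if the unital subalgebras that they generate are free. -/
def IsFreeFrom (τ : TracialState A) (S T : Set A) : Prop :=
  IsFree τ (fun b : Bool => if b then Algebra.adjoin ℂ S else Algebra.adjoin ℂ T)

/-- A (standard) semicircular element: it is self-adjoint and its law is
`(2π)⁻¹ (4 - x²)₊^{1/2} dx`. -/
def IsSemicircular (τ : TracialState A) (s : A) : Prop :=
  IsSelfAdjoint s ∧ ∀ m : ℕ,
    τ (s ^ m) = ((∫ x in (-2 : ℝ)..2, x ^ m * (√(4 - x ^ 2) / (2 * Real.pi)) : ℝ) : ℂ)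

/-! ### Free score and free Fisher information -/

/-- Evaluation of a noncommutative polynomial `P` in a variable `none` (standing for `X`) and
variables `some Y`, `Y ∈ B`, at the elements `X` and `Y`. -/
def evalPoly (X : A) (B : Subalgebra ℂ A) : FreeAlgebra ℂ (Option B) →ₐ[ℂ] A :=
  FreeAlgebra.lift ℂ (fun v => v.elim X (fun Y => (Y : A)))

/-- The free difference quotient `P ↦ (∂P)(X, Y₁, Y₂, …) ∈ A ⊗ A`: the derivation into the bimodule
`A ⊗ A` with `∂X = 1 ⊗ 1` and `∂Y = 0` for `Y ∈ B`. It is obtained as the upper right entry of the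
algebra homomorphism `P ↦ !![P ⊗ 1, ∂P; 0, 1 ⊗ P]`. -/
def freeDiff (X : A) (B : Subalgebra ℂ A) : FreeAlgebra ℂ (Option B) →ₗ[ℂ] A ⊗[ℂ] A :=
  (Matrix.entryLinearMap ℂ (A ⊗[ℂ] A) (0 : Fin 2) (1 : Fin 2)) ∘ₗ
    (FreeAlgebra.lift ℂ (fun v : Option B =>
      (!![evalPoly X B (FreeAlgebra.ι ℂ v) ⊗ₜ[ℂ] 1, v.elim (1 ⊗ₜ[ℂ] 1) (fun _ => 0);
        0, 1 ⊗ₜ[ℂ] evalPoly X B (FreeAlgebra.ι ℂ v)] :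
          Matrix (Fin 2) (Fin 2) (A ⊗[ℂ] A)))).toLinearMap

/-- The functional `τ ⊗ τ` on `A ⊗ A`. -/
def tensorTrace (τ : TracialState A) : A ⊗[ℂ] A →ₗ[ℂ] ℂ :=
  LinearMap.mul' ℂ ℂ ∘ₗ TensorProduct.map τ.toLinearMap τ.toLinearMap

/-- The closure in `L²(τ)` of the algebra `Alg(X, B)` generated by `X` and `B`. -/
def algClosure (τ : TracialState A) (X : A) (B : Subalgebra ℂ A) : Submodule ℂ (L2 τ) :=
  ((Subalgebra.toSubmodule (Algebra.adjoin ℂ (insert X (B : Set A)))).map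
    (toL2 τ)).topologicalClosure

/-- `ξ` is the free score `J(X : B)`: it lies in the `L²(τ)` closure of `Alg(X, B)` and
`(τ ⊗ τ)(∂P(X, Y₁, …, Yₘ)) = τ (ξ P(X, Y₁, …, Yₘ))` for all noncommutative polynomials `P` and all
`Y₁, …, Yₘ ∈ B`. -/
def IsFreeScore (τ : TracialState A) (X : A) (B : Subalgebra ℂ A) (ξ : L2 τ) : Prop :=
  ξ ∈ algClosure τ X B ∧ ∀ P : FreeAlgebra ℂ (Option B),
    tensorTrace τ (freeDiff X B P) = traceMul τ ξ (evalPoly X B P)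

/-- The relative free Fisher information `Φ*(X : B) = ‖J(X : B)‖²`, with value `∞` if the score
does not exist. As the score is unique, the infimum runs over at most one element. -/
def relFisher (τ : TracialState A) (X : A) (B : Subalgebra ℂ A) : ℝ≥0∞ :=
  ⨅ (ξ : L2 τ) (_ : IsFreeScore τ X B ξ), ENNReal.ofReal (‖ξ‖ ^ 2)

/-- The non-microstate free Fisher information
`Φ*(X₁, …, Xₙ) = ∑ᵢ Φ*(Xᵢ : X₁, …, Xᵢ₋₁, Xᵢ₊₁, …, Xₙ)`. -/
def fisherStar (τ : TracialState A) {n : ℕ} (X : Fin n → A) : ℝ≥0∞ :=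
  ∑ i, relFisher τ (X i) (Algebra.adjoin ℂ (X '' {j | j ≠ i}))

theorem evalPoly_ι (X : A) (B : Subalgebra ℂ A) (v : Option B) :
    evalPoly X B (FreeAlgebra.ι ℂ v) = v.elim X (fun Y => (Y : A)) := by
  simp [evalPoly]

theorem freeDiffHom_apply (X : A) (B : Subalgebra ℂ A) (P : FreeAlgebra ℂ (Option B)) :
    FreeAlgebra.lift ℂ (fun v : Option B =>
      (!![evalPoly X B (FreeAlgebra.ι ℂ v) ⊗ₜ[ℂ] 1, v.elim (1 ⊗ₜ[ℂ] 1) (fun _ => 0);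
        0, 1 ⊗ₜ[ℂ] evalPoly X B (FreeAlgebra.ι ℂ v)] : Matrix (Fin 2) (Fin 2) (A ⊗[ℂ] A))) P =
    !![evalPoly X B P ⊗ₜ[ℂ] 1, freeDiff X B P; 0, 1 ⊗ₜ[ℂ] evalPoly X B P] := by
  have key : ∀ P : FreeAlgebra ℂ (Option B), ∀ M : Matrix (Fin 2) (Fin 2) (A ⊗[ℂ] A),
      M = FreeAlgebra.lift ℂ (fun v : Option B =>
      (!![evalPoly X B (FreeAlgebra.ι ℂ v) ⊗ₜ[ℂ] 1, v.elim (1 ⊗ₜ[ℂ] 1) (fun _ => 0);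
        0, 1 ⊗ₜ[ℂ] evalPoly X B (FreeAlgebra.ι ℂ v)] : Matrix (Fin 2) (Fin 2) (A ⊗[ℂ] A))) P →
      M 0 0 = evalPoly X B P ⊗ₜ[ℂ] 1 ∧ M 1 0 = 0 ∧ M 1 1 = 1 ⊗ₜ[ℂ] evalPoly X B P := by
    intro P
    induction P using FreeAlgebra.induction with
    | grade0 r =>
      rintro _ rfl
      simp [Algebra.algebraMap_eq_smul_one,
        Algebra.TensorProduct.one_def, TensorProduct.smul_tmul', TensorProduct.tmul_smul]
    | grade1 v => rintro _ rfl; simp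
    | mul P Q hP hQ =>
      rintro _ rfl
      obtain ⟨a, b, c⟩ := hP _ rfl
      obtain ⟨a', b', c'⟩ := hQ _ rfl
      simp [Matrix.mul_apply, Fin.sum_univ_two, a, b, c, a', b', c']
    | add P Q hP hQ =>
      rintro _ rfl
      obtain ⟨a, b, c⟩ := hP _ rfl
      obtain ⟨a', b', c'⟩ := hQ _ rfl
      simp [a, b, c, a', b', c', TensorProduct.add_tmul, TensorProduct.tmul_add]
  obtain ⟨a, b, c⟩ := key P _ rfl
  ext i j
  fin_cases i <;> fin_cases j
  · simpa using a
  · rfl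
  · simpa using b
  · simpa using c

theorem freeDiff_X (X : A) (B : Subalgebra ℂ A) :
    freeDiff X B (FreeAlgebra.ι ℂ none) = 1 ⊗ₜ[ℂ] 1 := by
  simp [freeDiff]

theorem freeDiff_mem (X : A) (B : Subalgebra ℂ A) (Y : B) :
    freeDiff X B (FreeAlgebra.ι ℂ (some Y)) = 0 := by
  simp [freeDiff]

theorem freeDiff_mul (X : A) (B : Subalgebra ℂ A) (P Q : FreeAlgebra ℂ (Option B)) :
    freeDiff X B (P * Q) = (evalPoly X B P ⊗ₜ[ℂ] 1) * freeDiff X B Q +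
      freeDiff X B P * (1 ⊗ₜ[ℂ] evalPoly X B Q) := by
  have h := congrFun (congrFun (freeDiffHom_apply X B (P * Q)) 0) 1
  rw [map_mul, freeDiffHom_apply X B P, freeDiffHom_apply X B Q] at h
  simpa [Matrix.mul_apply, Fin.sum_univ_two] using h.symm

theorem evalPoly_range (X : A) (B : Subalgebra ℂ A) :
    Algebra.adjoin ℂ (insert X (B : Set A)) = (evalPoly X B).range := by
  rw [evalPoly, ← Algebra.adjoin_range_eq_range_freeAlgebra_lift]
  congr 1
  ext a
  constructor
  · rintro (rfl | h)
    · exact ⟨none, rfl⟩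
    · exact ⟨some ⟨a, h⟩, rfl⟩
  · rintro ⟨_ | Y, rfl⟩
    · exact Or.inl rfl
    · exact Or.inr Y.2

/-- The score is unique, for self-adjoint `X` and `*`-stable `B`. -/
theorem IsFreeScore.unique {τ : TracialState A} {X : A} {B : Subalgebra ℂ A} {ξ η : L2 τ}
    (hX : IsSelfAdjoint X) (hB : ∀ b ∈ B, star b ∈ B)
    (hξ : IsFreeScore τ X B ξ) (hη : IsFreeScore τ X B η) : ξ = η := by
  have hstar : ∀ a ∈ Algebra.adjoin ℂ (insert X (B : Set A)),
      star a ∈ Algebra.adjoin ℂ (insert X (B : Set A)) := by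
    intro a ha
    induction ha using Algebra.adjoin_induction with
    | mem x hx =>
      rcases hx with rfl | h
      · rw [hX.star_eq]; exact Algebra.subset_adjoin (Or.inl rfl)
      · exact Algebra.subset_adjoin (Or.inr (hB _ h))
    | algebraMap r => rw [← algebraMap_star_comm]; exact Subalgebra.algebraMap_mem _ _
    | add x y _ _ hx hy => rw [star_add]; exact add_mem hx hy
    | mul x y _ _ hx hy => rw [star_mul]; exact mul_mem hy hx
  have horth : ξ - η ∈ (algClosure τ X B)ᗮ := by
    rw [algClosure, Submodule.orthogonal_closure, Submodule.mem_orthogonal]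
    rintro _ ⟨a, ha, rfl⟩
    have ha' := hstar a ha
    rw [evalPoly_range] at ha'
    obtain ⟨P, hP⟩ := ha'
    have h := (hξ.2 P).symm.trans (hη.2 P)
    have hP' : evalPoly X B P = star a := hP
    rw [hP', traceMul, traceMul, star_star] at h
    rw [inner_sub_right, h, sub_self]
  have hmem : ξ - η ∈ algClosure τ X B := sub_mem hξ.1 hη.1
  have h0 : inner ℂ (ξ - η) (ξ - η) = 0 := (Submodule.mem_orthogonal _ _).mp horth _ hmem
  exact sub_eq_zero.mp (inner_self_eq_zero.mp h0)

/-! ### Free entropy -/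

/-- The integral over `(0, ∞)` of an extended-real function, as the difference of the integrals of
its positive and negative parts. -/
def integralIoi (f : ℝ → EReal) : EReal :=
  ((∫⁻ t in Set.Ioi (0 : ℝ), (f t).toENNReal : ℝ≥0∞) : EReal) -
    ((∫⁻ t in Set.Ioi (0 : ℝ), (-f t).toENNReal : ℝ≥0∞) : EReal)

/-- A noncommutative probability space `(C, σ)` extending `(A, τ)`, together with elements
`Z₁, …, Zₙ` that are semicircular and free from each other and from `X₁, …, Xₙ`. -/
structure SemicircularExtension (τ : TracialState A) {n : ℕ} (X : Fin n → A) where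
  /-- the larger algebra -/
  C : Type u
  [ring : Ring C]
  [starRing : StarRing C]
  [algebra : Algebra ℂ C]
  [starModule : StarModule ℂ C]
  /-- its trace -/
  σ : TracialState C
  /-- the trace-preserving unital `*`-homomorphism from the given algebra -/
  incl : A →⋆ₐ[ℂ] C
  map_incl : ∀ a, σ (incl a) = τ a
  /-- the semicircular elements -/
  Z : Fin n → C
  semicircular : ∀ i, IsSemicircular σ (Z i)
  free : IsFree σ (fun i : Option (Fin n) => i.elim
    (Algebra.adjoin ℂ (Set.range fun j => incl (X j))) (fun j => Algebra.adjoin ℂ {Z j}))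

attribute [instance] SemicircularExtension.ring SemicircularExtension.starRing
  SemicircularExtension.algebra SemicircularExtension.starModule

/-- The value `½ ∫₀^∞ (n / (1 + t) - Φ*(X₁ + t^{1/2} Z₁, …, Xₙ + t^{1/2} Zₙ)) dt + (n/2) log (2πe)`
computed in a given extension that contains suitable `Z₁, …, Zₙ`. -/
def SemicircularExtension.entropy {τ : TracialState A} {n : ℕ} {X : Fin n → A}
    (E : SemicircularExtension τ X) : EReal :=
  ((1 / 2 : ℝ) : EReal) * integralIoi (fun t =>
      (((n : ℝ) / (1 + t) : ℝ) : EReal) -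
        (fisherStar E.σ (fun i => E.incl (X i) + ((√t : ℝ) : ℂ) • E.Z i) : EReal)) +
    ((n / 2 * Real.log (2 * Real.pi * Real.exp 1) : ℝ) : EReal)

/-- The non-microstate free entropy `χ*(X₁, …, Xₙ) ∈ [-∞, ∞]`. Extensions that contain suitable
`Z₁, …, Zₙ` exist (free products), and the value depends only on the joint law of
`X₁, …, Xₙ, Z₁, …, Zₙ`, which is the same in all of them; the infimum picks this common value. -/
def chiStar (τ : TracialState A) {n : ℕ} (X : Fin n → A) : EReal :=
  ⨅ E : SemicircularExtension τ X, E.entropy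

end Spaces

/-! ### Compression by a projection -/

section Compression

variable {A : Type u} [Ring A] [StarRing A] [Algebra ℂ A] [StarModule ℂ A] {p : A}

/-- The compressed algebra `A_p = p A p`, with unit `p`. -/
def Corner (hp : IsStarProjection p) : Type u := hp.isIdempotentElem.Corner

namespace Corner

variable (hp : IsStarProjection p)

instance : Ring (Corner hp) := inferInstanceAs (Ring hp.isIdempotentElem.Corner)

/-- The inclusion of `p A p` into `A`. -/
def val {hp : IsStarProjection p} (x : Corner hp) : A := Subtype.val x

/-- The compression map `π(a) = p a p`. -/
def compress (a : A) : Corner hp := ⟨p * a * p, a, rfl⟩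

variable {hp}

theorem val_injective : Function.Injective (val (hp := hp)) := Subtype.val_injective

@[simp] theorem val_compress (a : A) : (compress hp a).val = p * a * p := rfl
@[simp] theorem val_one : (1 : Corner hp).val = p := rfl
@[simp] theorem val_zero : (0 : Corner hp).val = 0 := rfl
@[simp] theorem val_add (x y : Corner hp) : (x + y).val = x.val + y.val := rfl
@[simp] theorem val_mul (x y : Corner hp) : (x * y).val = x.val * y.val := rfl

theorem mul_val (x : Corner hp) : p * x.val = x.val :=
  ((Subsemigroup.mem_corner_iff hp.isIdempotentElem).mp x.2).1

theorem val_mul_self (x : Corner hp) : x.val * p = x.val :=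
  ((Subsemigroup.mem_corner_iff hp.isIdempotentElem).mp x.2).2

@[simp] theorem val_compress_val (x : Corner hp) : (compress hp x.val).val = x.val := by
  rw [val_compress, mul_val, val_mul_self]

instance : SMul ℂ (Corner hp) := ⟨fun c x => compress hp (c • x.val)⟩

@[simp] theorem val_smul (c : ℂ) (x : Corner hp) : (c • x).val = c • x.val := by
  change p * (c • x.val) * p = c • x.val
  rw [mul_smul_comm, smul_mul_assoc, mul_val, val_mul_self]

instance : Module ℂ (Corner hp) where
  one_smul x := val_injective (by simp)
  mul_smul a b x := val_injective (by simp [mul_smul])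
  smul_zero a := val_injective (by simp)
  smul_add a x y := val_injective (by simp)
  add_smul a b x := val_injective (by simp [add_smul])
  zero_smul x := val_injective (by simp)

instance : Algebra ℂ (Corner hp) :=
  Algebra.ofModule (fun c x y => val_injective (by simp)) (fun c x y => val_injective (by simp))

instance : Star (Corner hp) := ⟨fun x => compress hp (star x.val)⟩

@[simp] theorem val_star (x : Corner hp) : (star x).val = star x.val := by
  change p * star x.val * p = star x.val
  have h : star p = p := hp.isSelfAdjoint.star_eq
  calc p * star x.val * p = star (p * x.val * p) := by
        rw [star_mul, star_mul, h, mul_assoc]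
    _ = star x.val := by rw [mul_val, val_mul_self]

instance : StarRing (Corner hp) where
  star_involutive x := val_injective (by simp)
  star_mul x y := val_injective (by simp)
  star_add x y := val_injective (by simp)

instance : StarModule ℂ (Corner hp) where
  star_smul c x := val_injective (by simp)

end Corner

/-- The compressed trace `τ_p(x) = k τ(x)` on `A_p`, where `τ(p) = 1 / k`. -/
def TracialState.compress (τ : TracialState A) (hp : IsStarProjection p) {k : ℝ} (hk : 1 ≤ k)
    (hτ : τ p = ((1 / k : ℝ) : ℂ)) : TracialState (Corner hp) where
  toLinearMap :=
    { toFun := fun x => (k : ℂ) * τ x.val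
      map_add' := fun x y => by rw [Corner.val_add, map_add, mul_add]
      map_smul' := fun c x => by
        rw [Corner.val_smul, map_smul, RingHom.id_apply, smul_eq_mul, smul_eq_mul]; ring }
  map_one' := by
    have hk0 : (k : ℂ) ≠ 0 := by
      have : k ≠ 0 := by linarith
      exact_mod_cast this
    change (k : ℂ) * τ (1 : Corner hp).val = 1
    rw [Corner.val_one, hτ]
    push_cast
    field_simp
  map_mul_comm' a b := by
    change (k : ℂ) * τ (a * b).val = (k : ℂ) * τ (b * a).val
    rw [Corner.val_mul, Corner.val_mul, τ.map_mul_comm']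
  nonneg' a := by
    change 0 ≤ (k : ℂ) * τ (star a * a).val
    rw [Corner.val_mul, Corner.val_star]
    exact mul_nonneg (by exact_mod_cast (by linarith : (0 : ℝ) ≤ k)) (τ.nonneg' _)

end Compression

end FreeProb

end

/-!
The compression inequality is a statement about duality. The free score of `X` relative to an
algebra exists and has norm at most `r` as soon as `|(τ ⊗ τ)(∂P)| ≤ r ‖P‖₂` for all noncommutative
polynomials `P`, by the Riesz representation theorem (`relFisher_le_of_bound`). Let `ξ` be the score
of `Xᵢ` relative to the other `Xⱼ`.

* Freeness extends the score: `ξ` still satisfies the defining identity when elements free from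
  `X₁, …, Xₙ`, in particular `p`, are added to the variables that `∂` kills
  (`IsScoreOn.free_extend`).
* A polynomial in the compressions `k^{1/2} p Xⱼ p` is a polynomial in the `Xⱼ` and `p`, and the two
  difference quotients agree up to scaling. So the functional to be bounded in the corner is a
  multiple of `a ↦ τ(ξ a)` on elements `a = p a p` (`IsScoreOn.tensorTrace_corner`).
* There only `p ξ p` matters. For centred `y` free from `p` one has `‖p y p‖₂ = ‖y‖₂ / k`, and `ξ` is
  a limit of such `y`; the Cauchy–Schwarz inequality (`norm_inner_corner_le`) gives precisely the
  bound by `‖ξ‖`, because all powers of `k` cancel. Summing over `i` gives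
  `fisherStar_compress_le`.

For the entropy, the Fisher inequality is applied at each time `t` to `Xᵢ + t^{1/2} Zᵢ`. For this
`(A, τ)` is extended by free semicircular elements, acting on the free Fock space as sums of creation
and annihilation operators (`FockAlg.isFree`, `FockAlg.Z_isSemicircular`); the vacuum state is a trace
because the algebra has a commuting right action. In this extension `p` is free from all the
`Xᵢ + t^{1/2} Zᵢ`, and it remains to identify the compressed variables with those that define the
entropy of the corner. A semicircular `Z` is its own free score, so `τ(Zᵢ P) = (τ ⊗ τ)(∂ᵢ P)`; this
Schwinger–Dyson equation passes to the corner, where `k^{1/2} p Zᵢ p` satisfies it too, and it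
determines all joint moments recursively (`moments_eq_of_schwingerDyson`,
`law_corner_fockExtension`). As the free Fisher information depends only on the joint law
(`fisherStar_le_of_law`), the integrands compare pointwise (`fisherStar_perturbed_le`).
-/

namespace FreeProb

/-! ### The graph of the free difference quotient -/

section Variational

/-- The graph of the free difference quotient `∂`, as a relation: `DiffGraph X G a t` says that
`a` is the value at `X` and elements of `G` of some noncommutative polynomial `P`, and `t ∈ A ⊗ A`
the value of `∂P`. A relation is used since the value of `P` need not determine that of `∂P`. -/
inductive DiffGraph {A : Type*} [Ring A] [Algebra ℂ A] (X : A) (G : Set A) :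
    A → A ⊗[ℂ] A → Prop
  | scalar (r : ℂ) : DiffGraph X G (algebraMap ℂ A r) 0
  | var : DiffGraph X G X (1 ⊗ₜ[ℂ] 1)
  | mem {g : A} (hg : g ∈ G) : DiffGraph X G g 0
  | add {a b : A} {s t : A ⊗[ℂ] A} (ha : DiffGraph X G a s) (hb : DiffGraph X G b t) :
      DiffGraph X G (a + b) (s + t)
  | mul {a b : A} {s t : A ⊗[ℂ] A} (ha : DiffGraph X G a s) (hb : DiffGraph X G b t) :
      DiffGraph X G (a * b) ((a ⊗ₜ[ℂ] 1) * t + s * (1 ⊗ₜ[ℂ] b))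

namespace DiffGraph

variable {A : Type*} [Ring A] [Algebra ℂ A] {X : A} {G : Set A}

theorem mul_zero {a b : A} (ha : DiffGraph X G a 0) (hb : DiffGraph X G b 0) :
    DiffGraph X G (a * b) 0 := by
  simpa using ha.mul hb

theorem smul (c : ℂ) {a : A} {t : A ⊗[ℂ] A} (h : DiffGraph X G a t) :
    DiffGraph X G (c • a) (c • t) := by
  have := (scalar (X := X) (G := G) c).mul h
  rw [Algebra.algebraMap_eq_smul_one, ← TensorProduct.smul_tmul', zero_mul, add_zero,
    smul_mul_assoc, smul_mul_assoc, one_mul, ← Algebra.TensorProduct.one_def, one_mul] at this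
  exact this

theorem smul_zero (c : ℂ) {a : A} (h : DiffGraph X G a 0) : DiffGraph X G (c • a) 0 := by
  simpa using h.smul c

theorem of_mem_adjoin {b : A} (hb : b ∈ Algebra.adjoin ℂ G) : DiffGraph X G b 0 := by
  induction hb using Algebra.adjoin_induction with
  | mem x hx => exact mem hx
  | algebraMap r => exact scalar r
  | add x y _ _ hx hy => simpa using hx.add hy
  | mul x y _ _ hx hy => exact hx.mul_zero hy

theorem map {A' : Type*} [Ring A'] [Algebra ℂ A'] (f : A →ₐ[ℂ] A') {G' : Set A'}
    (hG : ∀ g ∈ G, f g ∈ G') {a : A} {t : A ⊗[ℂ] A} (h : DiffGraph X G a t) :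
    DiffGraph (f X) G' (f a) (Algebra.TensorProduct.map f f t) := by
  induction h with
  | scalar r => simpa using scalar r
  | var => simpa using var
  | mem hg => simpa using mem (hG _ hg)
  | add _ _ ha hb => simpa using ha.add hb
  | mul _ _ ha hb => simpa using ha.mul hb

/-- Every element of the graph lifts along an algebra homomorphism that hits the generators. -/
theorem exists_lift {A' : Type*} [Ring A'] [Algebra ℂ A'] (f : A →ₐ[ℂ] A') {G' : Set A'}
    (hG : ∀ g' ∈ G', ∃ g ∈ G, f g = g') {a' : A'} {t' : A' ⊗[ℂ] A'}
    (h : DiffGraph (f X) G' a' t') :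
    ∃ a t, DiffGraph X G a t ∧ f a = a' ∧ Algebra.TensorProduct.map f f t = t' := by
  induction h with
  | scalar r => exact ⟨_, _, scalar r, by simp, by simp⟩
  | var => exact ⟨_, _, var, rfl, by simp⟩
  | mem hg =>
    obtain ⟨g, hg', rfl⟩ := hG _ hg
    exact ⟨_, _, mem hg', rfl, by simp⟩
  | add _ _ ha hb =>
    obtain ⟨a, s, h1, rfl, rfl⟩ := ha
    obtain ⟨b, t, h2, rfl, rfl⟩ := hb
    exact ⟨_, _, h1.add h2, by simp, by simp⟩
  | mul _ _ ha hb =>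
    obtain ⟨a, s, h1, rfl, rfl⟩ := ha
    obtain ⟨b, t, h2, rfl, rfl⟩ := hb
    exact ⟨_, _, h1.mul h2, by simp, by simp⟩

/-- If a subalgebra contains the variables, then the values of `∂` have both legs in it. -/
theorem mem_span {S : Subalgebra ℂ A} (hX : X ∈ S) (hG : G ⊆ S) {a : A} {t : A ⊗[ℂ] A}
    (h : DiffGraph X G a t) :
    a ∈ S ∧ t ∈ Submodule.span ℂ {z | ∃ b ∈ S, ∃ c ∈ S, z = b ⊗ₜ[ℂ] c} := by
  induction h with
  | scalar r => exact ⟨S.algebraMap_mem r, zero_mem _⟩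
  | var => exact ⟨hX, Submodule.subset_span ⟨1, one_mem _, 1, one_mem _, rfl⟩⟩
  | mem hg => exact ⟨hG hg, zero_mem _⟩
  | add _ _ ha hb => exact ⟨add_mem ha.1 hb.1, add_mem ha.2 hb.2⟩
  | @mul a b s t _ _ ha hb =>
    refine ⟨mul_mem ha.1 hb.1, add_mem ?_ ?_⟩
    · refine (Submodule.span_le (p := (Submodule.span ℂ _).comap
        (LinearMap.mulLeft ℂ (a ⊗ₜ[ℂ] (1 : A)))).mpr ?_) hb.2
      rintro _ ⟨u, hu, v, hv, rfl⟩
      exact Submodule.subset_span ⟨_, mul_mem ha.1 hu, _, hv, by simp⟩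
    · refine (Submodule.span_le (p := (Submodule.span ℂ _).comap
        (LinearMap.mulRight ℂ ((1 : A) ⊗ₜ[ℂ] b))).mpr ?_) ha.2
      rintro _ ⟨u, hu, v, hv, rfl⟩
      exact Submodule.subset_span ⟨_, hu, _, mul_mem hv hb.1, by simp⟩

end DiffGraph

variable {A : Type*} [Ring A] [StarRing A] [Algebra ℂ A] [StarModule ℂ A]

/-- The pairs `(P, ∂P)` of evaluated polynomials lie in the graph. -/
theorem diffGraph_evalPoly (X : A) (G : Set A) (P : FreeAlgebra ℂ (Option (Algebra.adjoin ℂ G))) :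
    DiffGraph X G (evalPoly X _ P) (freeDiff X _ P) := by
  induction P using FreeAlgebra.induction with
  | grade0 r =>
    have : freeDiff X (Algebra.adjoin ℂ G) (algebraMap ℂ _ r) = 0 := by
      simp [freeDiff, Matrix.algebraMap_matrix_apply]
    rw [this, AlgHom.commutes]
    exact .scalar r
  | grade1 v =>
    rcases v with _ | Y
    · rw [freeDiff_X, evalPoly_ι]; exact .var
    · rw [freeDiff_mem, evalPoly_ι]; exact .of_mem_adjoin Y.2
  | mul P Q hP hQ => rw [freeDiff_mul, map_mul]; exact hP.mul hQ
  | add P Q hP hQ => rw [map_add, map_add]; exact hP.add hQ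

/-- Every pair in the graph comes from a noncommutative polynomial. -/
theorem DiffGraph.exists_poly {X : A} {G : Set A} {a : A} {t : A ⊗[ℂ] A} (h : DiffGraph X G a t) :
    ∃ P : FreeAlgebra ℂ (Option (Algebra.adjoin ℂ G)), evalPoly X _ P = a ∧ freeDiff X _ P = t := by
  induction h with
  | scalar r =>
    exact ⟨algebraMap ℂ _ r, by simp, by simp [freeDiff, Matrix.algebraMap_matrix_apply]⟩
  | var => exact ⟨FreeAlgebra.ι ℂ none, evalPoly_ι _ _ _, freeDiff_X _ _⟩
  | @mem g hg =>
    exact ⟨FreeAlgebra.ι ℂ (some ⟨g, Algebra.subset_adjoin hg⟩), evalPoly_ι _ _ _,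
      freeDiff_mem _ _ _⟩
  | add _ _ ha hb =>
    obtain ⟨P, rfl, rfl⟩ := ha
    obtain ⟨Q, rfl, rfl⟩ := hb
    exact ⟨P + Q, map_add _ _ _, map_add _ _ _⟩
  | mul _ _ ha hb =>
    obtain ⟨P, rfl, rfl⟩ := ha
    obtain ⟨Q, rfl, rfl⟩ := hb
    exact ⟨P * Q, map_mul _ _ _, freeDiff_mul _ _ _ _⟩

/-! ### Variational description of the relative free Fisher information -/

@[simp] theorem tensorTrace_tmul (τ : TracialState A) (a b : A) :
    tensorTrace τ (a ⊗ₜ[ℂ] b) = τ a * τ b := by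
  simp [tensorTrace]

theorem TracialState.mul_comm (τ : TracialState A) (a b : A) : τ (a * b) = τ (b * a) :=
  τ.map_mul_comm' a b

theorem norm_toL2_sq (τ : TracialState A) (a : A) :
    ((‖toL2 τ a‖ ^ 2 : ℝ) : ℂ) = τ (star a * a) := by
  rw [← inner_toL2, inner_self_eq_norm_sq_to_K]; simp

theorem norm_toL2_star (τ : TracialState A) (a : A) : ‖toL2 τ (star a)‖ = ‖toL2 τ a‖ := by
  have h : ((‖toL2 τ (star a)‖ ^ 2 : ℝ) : ℂ) = ((‖toL2 τ a‖ ^ 2 : ℝ) : ℂ) := by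
    rw [norm_toL2_sq, norm_toL2_sq, star_star, τ.mul_comm]
  have h' : ‖toL2 τ (star a)‖ ^ 2 = ‖toL2 τ a‖ ^ 2 := by exact_mod_cast h
  exact (sq_eq_sq₀ (norm_nonneg _) (norm_nonneg _)).mp h'

/-- The defining equation of the free score `J(X : Alg G)`, without the requirement that `ξ` lies
in the closure of `Alg(X, G)`. -/
def IsScoreOn (τ : TracialState A) (X : A) (G : Set A) (ξ : L2 τ) : Prop :=
  ∀ a t, DiffGraph X G a t → tensorTrace τ t = traceMul τ ξ a

theorem IsFreeScore.isScoreOn {τ : TracialState A} {X : A} {G : Set A} {ξ : L2 τ}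
    (h : IsFreeScore τ X (Algebra.adjoin ℂ G) ξ) : IsScoreOn τ X G ξ := by
  intro a t hat
  obtain ⟨P, rfl, rfl⟩ := hat.exists_poly
  exact h.2 P

theorem IsScoreOn.norm_le {τ : TracialState A} {X : A} {G : Set A} {ξ : L2 τ}
    (h : IsScoreOn τ X G ξ) {a : A} {t : A ⊗[ℂ] A} (hat : DiffGraph X G a t) :
    ‖tensorTrace τ t‖ ≤ ‖ξ‖ * ‖toL2 τ a‖ := by
  rw [h a t hat, traceMul, _root_.mul_comm, ← norm_toL2_star τ a]
  exact norm_inner_le_norm _ _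

theorem star_mem_adjoin {G : Set A} (hG : ∀ g ∈ G, star g ∈ G) {a : A}
    (ha : a ∈ Algebra.adjoin ℂ G) : star a ∈ Algebra.adjoin ℂ G := by
  induction ha using Algebra.adjoin_induction with
  | mem x hx => exact Algebra.subset_adjoin (hG _ hx)
  | algebraMap r => rw [← algebraMap_star_comm]; exact Subalgebra.algebraMap_mem _ _
  | add x y _ _ hx hy => rw [star_add]; exact add_mem hx hy
  | mul x y _ _ hx hy => rw [star_mul]; exact mul_mem hy hx

/-- Riesz representation: if `a ↦ (τ ⊗ τ)(∂a)` is bounded by `r` in the `L²`-norm, then the score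
exists and has norm at most `r`. -/
theorem relFisher_le_of_bound (τ : TracialState A) {X : A} {G : Set A} (hX : IsSelfAdjoint X)
    (hG : ∀ g ∈ G, star g ∈ G) {r : ℝ} (hr : 0 ≤ r)
    (h : ∀ a t, DiffGraph X G a t → ‖tensorTrace τ t‖ ≤ r * ‖toL2 τ a‖) :
    relFisher τ X (Algebra.adjoin ℂ G) ≤ ENNReal.ofReal (r ^ 2) := by
  set B := Algebra.adjoin ℂ G with hB
  have hbd : ∀ P, ‖tensorTrace τ (freeDiff X B P)‖ ≤ r * ‖toL2 τ (star (evalPoly X B P))‖ := by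
    intro P
    rw [norm_toL2_star]
    exact h _ _ (diffGraph_evalPoly X G P)
  have hBs : ∀ b ∈ insert X (B : Set A), star b ∈ insert X (B : Set A) := by
    rintro b (rfl | hb)
    · exact Or.inl hX.star_eq
    · exact Or.inr (star_mem_adjoin hG hb)
  set V := (Subalgebra.toSubmodule (Algebra.adjoin ℂ (insert X (B : Set A)))).map (toL2 τ) with hV
  have hex : ∀ v : V, ∃ P, toL2 τ (star (evalPoly X B P)) = v := by
    rintro ⟨_, b, hb, rfl⟩
    have hb' := star_mem_adjoin hBs hb
    rw [evalPoly_range] at hb'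
    obtain ⟨P, hP⟩ := hb'
    have hP' : evalPoly X B P = star b := hP
    exact ⟨P, by rw [hP', star_star]⟩
  choose p hp using hex
  -- The bound makes the functional `v ↦ conj ((τ ⊗ τ)(∂P))`, for `v` the vector of `P*`, independent
  -- of the choice of `P`; the conjugate makes it linear in `v`.
  have huniq : ∀ P Q, toL2 τ (star (evalPoly X B P)) = toL2 τ (star (evalPoly X B Q)) →
      tensorTrace τ (freeDiff X B P) = tensorTrace τ (freeDiff X B Q) := by
    intro P Q hPQ
    have h1 := hbd (P - Q)
    rw [map_sub (evalPoly X B), star_sub, map_sub (toL2 τ), hPQ, sub_self, norm_zero,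
      MulZeroClass.mul_zero, map_sub, map_sub] at h1
    exact sub_eq_zero.mp (norm_le_zero_iff.mp h1)
  let g : V →ₗ[ℂ] ℂ :=
    { toFun := fun v => starRingEnd ℂ (tensorTrace τ (freeDiff X B (p v)))
      map_add' := fun v w => by
        rw [← map_add, ← map_add, ← map_add, huniq (p (v + w)) (p v + p w)]
        rw [hp, map_add, star_add, map_add, hp, hp]; rfl
      map_smul' := fun c v => by
        rw [huniq (p (c • v)) ((starRingEnd ℂ c) • p v)]
        · simp
        · rw [hp, map_smul, star_smul, map_smul, hp]; simp }
  have hg : ∀ v, ‖g v‖ ≤ r * ‖v‖ := by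
    intro v
    change ‖starRingEnd ℂ (tensorTrace τ (freeDiff X B (p v)))‖ ≤ _
    rw [RCLike.norm_conj]
    refine (hbd _).trans_eq ?_
    rw [hp]; rfl
  obtain ⟨F, hF, hFn⟩ := exists_extension_norm_eq V (g.mkContinuous r hg)
  set ξ₀ := (InnerProductSpace.toDual ℂ (L2 τ)).symm F with hξ₀
  have hnorm : ‖ξ₀‖ ≤ r := by
    rw [hξ₀, LinearIsometryEquiv.norm_map, hFn]
    exact LinearMap.mkContinuous_norm_le _ hr _
  have hcl : algClosure τ X B = V.topologicalClosure := rfl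
  have : CompleteSpace (algClosure τ X B) := by
    rw [hcl]; exact (Submodule.isClosed_topologicalClosure V).completeSpace_coe
  -- A Hahn–Banach extension need not lie in the closure of `Alg(X, B)`, hence the projection.
  set ξ : L2 τ := (algClosure τ X B).starProjection ξ₀ with hξ
  have hξn : ‖ξ‖ ≤ r := ((algClosure τ X B).norm_starProjection_apply_le ξ₀).trans hnorm
  have hscore : IsFreeScore τ X B ξ := by
    refine ⟨Submodule.starProjection_apply_mem _ _, fun P => ?_⟩
    have hmem : toL2 τ (star (evalPoly X B P)) ∈ V := by
      refine ⟨_, star_mem_adjoin hBs ?_, rfl⟩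
      rw [evalPoly_range]; exact ⟨P, rfl⟩
    have h1 : traceMul τ ξ (evalPoly X B P) = inner ℂ (toL2 τ (star (evalPoly X B P))) ξ₀ := by
      have hmem' : toL2 τ (star (evalPoly X B P)) ∈ algClosure τ X B :=
        Submodule.le_topologicalClosure V hmem
      rw [traceMul, hξ, ← Submodule.inner_starProjection_left_eq_right,
        Submodule.starProjection_eq_self_iff.mpr hmem']
    rw [h1, ← inner_conj_symm, hξ₀, InnerProductSpace.toDual_symm_apply]
    have h2 := hF ⟨_, hmem⟩
    change F (toL2 τ (star (evalPoly X B P))) =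
      starRingEnd ℂ (tensorTrace τ (freeDiff X B (p ⟨_, hmem⟩))) at h2
    rw [h2, Complex.conj_conj]
    exact huniq _ _ (by rw [hp])
  refine (iInf₂_le ξ hscore).trans (ENNReal.ofReal_le_ofReal ?_)
  exact pow_le_pow_left₀ (norm_nonneg _) hξn 2

/-- To bound a relative free Fisher information by another one, it is enough to bound it by the
square of the norm of a score. -/
theorem le_relFisher {τ : TracialState A} {X : A} {G : Set A} {c : ℝ≥0∞}
    (h : ∀ ξ, ξ ∈ algClosure τ X (Algebra.adjoin ℂ G) → IsScoreOn τ X G ξ →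
      c ≤ ENNReal.ofReal (‖ξ‖ ^ 2)) : c ≤ relFisher τ X (Algebra.adjoin ℂ G) :=
  le_iInf₂ fun ξ hξ => h ξ hξ.1 hξ.isScoreOn

/-! ### The free Fisher information depends only on the joint law -/

/-- For self-adjoint variables the adjoint of a polynomial value is given by one polynomial, whatever
the variables are. -/
theorem exists_star_lift {A' : Type*} [Ring A'] [StarRing A'] [Algebra ℂ A'] [StarModule ℂ A']
    {ι : Type*} {Y : ι → A} {Y' : ι → A'} (hY : ∀ i, IsSelfAdjoint (Y i))
    (hY' : ∀ i, IsSelfAdjoint (Y' i)) (P : FreeAlgebra ℂ ι) :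
    ∃ Q, star (FreeAlgebra.lift ℂ Y P) = FreeAlgebra.lift ℂ Y Q ∧
      star (FreeAlgebra.lift ℂ Y' P) = FreeAlgebra.lift ℂ Y' Q := by
  induction P using FreeAlgebra.induction with
  | grade0 r =>
    refine ⟨algebraMap ℂ _ (star r), ?_, ?_⟩ <;> simp only [AlgHom.commutes, algebraMap_star_comm]
  | grade1 v => exact ⟨FreeAlgebra.ι ℂ v, by simp [(hY v).star_eq], by simp [(hY' v).star_eq]⟩
  | mul P Q hP hQ =>
    obtain ⟨P', h1, h2⟩ := hP
    obtain ⟨Q', h3, h4⟩ := hQ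
    exact ⟨Q' * P', by simp [h1, h3], by simp [h2, h4]⟩
  | add P Q hP hQ =>
    obtain ⟨P', h1, h2⟩ := hP
    obtain ⟨Q', h3, h4⟩ := hQ
    exact ⟨P' + Q', by simp [h1, h3], by simp [h2, h4]⟩

/-- Polynomials and their difference quotients lift to the free algebra, so the bound that
characterizes the score of `Yᵢ` involves only the moments. -/
theorem fisherStar_le_of_law {A' : Type*} [Ring A'] [StarRing A'] [Algebra ℂ A'] [StarModule ℂ A']
    {τ : TracialState A} {τ' : TracialState A'} {n : ℕ} {Y : Fin n → A} {Y' : Fin n → A'}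
    (hY : ∀ i, IsSelfAdjoint (Y i)) (hY' : ∀ i, IsSelfAdjoint (Y' i))
    (hlaw : ∀ P, τ (FreeAlgebra.lift ℂ Y P) = τ' (FreeAlgebra.lift ℂ Y' P)) :
    fisherStar τ' Y' ≤ fisherStar τ Y := by
  refine Finset.sum_le_sum fun i _ => le_relFisher fun ξ _ hξ => ?_
  refine relFisher_le_of_bound τ' (hY' i) ?_ (norm_nonneg _) fun a' t' h' => ?_
  · rintro _ ⟨j, hj, rfl⟩
    exact ⟨j, hj, (hY' j).star_eq.symm⟩
  have e' : Y' i = FreeAlgebra.lift ℂ Y' (FreeAlgebra.ι ℂ i) := by simp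
  rw [e'] at h'
  obtain ⟨P, s, hP, rfl, rfl⟩ := h'.exists_lift
    (G := (FreeAlgebra.ι ℂ) '' {j | j ≠ i}) (FreeAlgebra.lift ℂ Y') (by
      rintro _ ⟨j, hj, rfl⟩
      exact ⟨_, ⟨j, hj, rfl⟩, by simp⟩)
  have hP2 := hP.map (G' := Y '' {j | j ≠ i}) (FreeAlgebra.lift ℂ Y) (by
      rintro _ ⟨j, hj, rfl⟩
      exact ⟨j, hj, by simp⟩)
  rw [FreeAlgebra.lift_ι_apply] at hP2
  have hb := hξ.norm_le hP2
  have e1 : tensorTrace τ (Algebra.TensorProduct.map (FreeAlgebra.lift ℂ Y)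
      (FreeAlgebra.lift ℂ Y) s) = tensorTrace τ' (Algebra.TensorProduct.map
      (FreeAlgebra.lift ℂ Y') (FreeAlgebra.lift ℂ Y') s) := by
    clear hP h' hP2 hb
    induction s using TensorProduct.induction_on with
    | zero => simp
    | tmul x y => simp [hlaw]
    | add x y hx hy => simp only [map_add, hx, hy]
  have e2 : ‖toL2 τ (FreeAlgebra.lift ℂ Y P)‖ = ‖toL2 τ' (FreeAlgebra.lift ℂ Y' P)‖ := by
    obtain ⟨Q, hQ, hQ'⟩ := exists_star_lift hY hY' P
    have : ((‖toL2 τ (FreeAlgebra.lift ℂ Y P)‖ ^ 2 : ℝ) : ℂ) =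
        ((‖toL2 τ' (FreeAlgebra.lift ℂ Y' P)‖ ^ 2 : ℝ) : ℂ) := by
      rw [norm_toL2_sq, norm_toL2_sq, hQ, hQ', ← map_mul, ← map_mul, hlaw]
    have h' : ‖toL2 τ (FreeAlgebra.lift ℂ Y P)‖ ^ 2 =
      ‖toL2 τ' (FreeAlgebra.lift ℂ Y' P)‖ ^ 2 := by exact_mod_cast this
    exact (sq_eq_sq₀ (norm_nonneg _) (norm_nonneg _)).mp h'
  rwa [e1, e2] at hb

end Variational

/-! ### Alternating centred words -/

section Free

variable {A : Type*} [Ring A] [StarRing A] [Algebra ℂ A] [StarModule ℂ A] {τ : TracialState A}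
  {κ : Type*} {S : κ → Subalgebra ℂ A}

/-- A word whose letters are centred elements of the subalgebras `S j`, neighbouring letters being
taken from subalgebras with different indices. -/
def IsAlternating (τ : TracialState A) (S : κ → Subalgebra ℂ A) (l : List (κ × A)) : Prop :=
  (∀ q ∈ l, q.2 ∈ S q.1 ∧ τ q.2 = 0) ∧ l.IsChain (fun q r => q.1 ≠ r.1)

theorem IsAlternating.nil : IsAlternating τ S [] := ⟨by simp, by simp⟩

theorem IsAlternating.singleton {q : κ × A} (hq : q.2 ∈ S q.1 ∧ τ q.2 = 0) :
    IsAlternating τ S [q] := ⟨by simpa using hq, by simp⟩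

theorem isAlternating_cons {q : κ × A} {l : List (κ × A)} :
    IsAlternating τ S (q :: l) ↔
      (q.2 ∈ S q.1 ∧ τ q.2 = 0) ∧ (∀ r ∈ l.head?, q.1 ≠ r.1) ∧ IsAlternating τ S l := by
  simp only [IsAlternating, List.isChain_cons, List.forall_mem_cons]
  tauto

theorem isAlternating_append {l l' : List (κ × A)} :
    IsAlternating τ S (l ++ l') ↔
      IsAlternating τ S l ∧ IsAlternating τ S l' ∧
        ∀ q ∈ l.getLast?, ∀ r ∈ l'.head?, q.1 ≠ r.1 := by
  simp only [IsAlternating, List.isChain_append, List.forall_mem_append]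
  tauto

theorem isFree_iff : IsFree τ S ↔
    ∀ l : List (κ × A), l ≠ [] → IsAlternating τ S l → τ (l.map Prod.snd).prod = 0 :=
  ⟨fun h l hl ha => h l hl ha.1 ha.2, fun h l hl h1 h2 => h l hl ⟨h1, h2⟩⟩

theorem TracialState.map_centre (τ : TracialState A) (a : A) :
    τ (a - algebraMap ℂ A (τ a)) = 0 := by
  rw [map_sub, Algebra.algebraMap_eq_smul_one, map_smul, τ.map_one']; simp

theorem IsFree.map_prod_mul (hS : IsFree τ S) {l : List (κ × A)} (hl : l ≠ [])
    (ha : IsAlternating τ S l) {k : κ} (hk : ∀ q ∈ l.getLast?, q.1 ≠ k) {b : A} (hb : b ∈ S k) :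
    τ ((l.map Prod.snd).prod * b) = 0 := by
  have h1 := isFree_iff.mp hS (l ++ [(k, b - algebraMap ℂ A (τ b))]) (by simp)
    (isAlternating_append.mpr ⟨ha, .singleton
      ⟨sub_mem hb (Subalgebra.algebraMap_mem _ _), τ.map_centre b⟩, by simpa using hk⟩)
  have h2 := isFree_iff.mp hS l hl ha
  simp only [List.map_append, List.map_cons, List.map_nil, List.prod_append, List.prod_cons,
    List.prod_nil, mul_one, mul_sub, map_sub, Algebra.algebraMap_eq_smul_one, mul_smul_comm,
    map_smul, h2, smul_zero, sub_zero] at h1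
  exact h1

theorem IsFree.map_mul_prod (hS : IsFree τ S) {l : List (κ × A)} (hl : l ≠ [])
    (ha : IsAlternating τ S l) {k : κ} (hk : ∀ q ∈ l.head?, q.1 ≠ k) {b : A} (hb : b ∈ S k) :
    τ (b * (l.map Prod.snd).prod) = 0 := by
  have h1 := isFree_iff.mp hS ((k, b - algebraMap ℂ A (τ b)) :: l) (by simp)
    (isAlternating_cons.mpr ⟨⟨sub_mem hb (Subalgebra.algebraMap_mem _ _), τ.map_centre b⟩,
      fun r hr => (hk r hr).symm, ha⟩)
  have h2 := isFree_iff.mp hS l hl ha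
  simp only [List.map_cons, List.prod_cons, sub_mul, map_sub, Algebra.algebraMap_eq_smul_one,
    smul_mul_assoc, one_mul, map_smul, h2, smul_zero, sub_zero] at h1
  exact h1

theorem IsFree.mono {S' : κ → Subalgebra ℂ A} (hS : IsFree τ S) (h : ∀ j, S' j ≤ S j) :
    IsFree τ S' :=
  fun l hl h1 h2 => hS l hl (fun q hq => ⟨h _ (h1 q hq).1, (h1 q hq).2⟩) h2

/-! ### Free extension of a score -/

/-- The product of pairs `(a, ∂a)` that the Leibniz rule dictates. -/
def leibnizMul (x y : A × (A ⊗[ℂ] A)) : A × (A ⊗[ℂ] A) :=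
  (x.1 * y.1, (x.1 ⊗ₜ[ℂ] 1) * y.2 + x.2 * (1 ⊗ₜ[ℂ] y.1))

theorem leibnizMul_assoc (x y z : A × (A ⊗[ℂ] A)) :
    leibnizMul (leibnizMul x y) z = leibnizMul x (leibnizMul y z) := by
  have h1 : ((x.1 * y.1) ⊗ₜ[ℂ] (1 : A)) = (x.1 ⊗ₜ[ℂ] (1 : A)) * (y.1 ⊗ₜ[ℂ] (1 : A)) := by simp
  have h2 : ((1 : A) ⊗ₜ[ℂ] (y.1 * z.1)) = ((1 : A) ⊗ₜ[ℂ] y.1) * ((1 : A) ⊗ₜ[ℂ] z.1) := by simp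
  ext1
  · simp [leibnizMul, mul_assoc]
  · simp only [leibnizMul, h1, h2]; noncomm_ring

theorem leibnizMul_one (x : A × (A ⊗[ℂ] A)) : leibnizMul x (1, 0) = x := by
  simp [leibnizMul, ← Algebra.TensorProduct.one_def]

theorem one_leibnizMul (x : A × (A ⊗[ℂ] A)) : leibnizMul (1, 0) x = x := by
  simp [leibnizMul, ← Algebra.TensorProduct.one_def]

theorem leibnizMul_add (x y z : A × (A ⊗[ℂ] A)) :
    leibnizMul x (y + z) = leibnizMul x y + leibnizMul x z := by
  ext1 <;> simp [leibnizMul, mul_add, TensorProduct.tmul_add]; abel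

theorem add_leibnizMul (x y z : A × (A ⊗[ℂ] A)) :
    leibnizMul (x + y) z = leibnizMul x z + leibnizMul y z := by
  ext1 <;> simp [leibnizMul, add_mul, TensorProduct.add_tmul]; abel

theorem leibnizMul_smul (x y : A × (A ⊗[ℂ] A)) (c : ℂ) :
    leibnizMul x (c • y) = c • leibnizMul x y := by
  ext1 <;> simp [leibnizMul]

theorem smul_leibnizMul (x y : A × (A ⊗[ℂ] A)) (c : ℂ) :
    leibnizMul (c • x) y = c • leibnizMul x y := by
  ext1 <;> simp [leibnizMul, ← TensorProduct.smul_tmul']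

/-- The pair `(a, ∂a)` of the product of a word of such pairs. -/
def leibnizProd (l : List (κ × (A × (A ⊗[ℂ] A)))) : A × (A ⊗[ℂ] A) :=
  l.foldr (fun q r => leibnizMul q.2 r) (1, 0)

theorem leibnizProd_fst (l : List (κ × (A × (A ⊗[ℂ] A)))) :
    (leibnizProd l).1 = ((l.map fun q => (q.1, q.2.1)).map Prod.snd).prod := by
  induction l with
  | nil => rfl
  | cons q l ih => simp only [List.map_cons, List.prod_cons, ← ih]; rfl

variable (S) in
/-- A letter `(j, a, ∂a)` of a word from the free family `S`, where `∂` is the free difference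
quotient on `S k` and vanishes on the other algebras. -/
def IsDiffLetter (k : κ) (X : A) (G : Set A) (q : κ × (A × (A ⊗[ℂ] A))) : Prop :=
  q.2.1 ∈ S q.1 ∧ ((q.1 = k ∧ DiffGraph X G q.2.1 q.2.2) ∨ (q.1 ≠ k ∧ q.2.2 = 0))

theorem traceMul_eq_zero {T : Submodule ℂ A} {ξ : L2 τ}
    (hξ : ξ ∈ (T.map (toL2 τ)).topologicalClosure) {w : A} (h : ∀ c ∈ T, τ (c * w) = 0) :
    traceMul τ ξ w = 0 := by
  have hcl : IsClosed {η : L2 τ | traceMul τ η w = 0} :=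
    isClosed_eq (continuous_const.inner continuous_id) continuous_const
  refine closure_minimal ?_ hcl hξ
  rintro _ ⟨c, hc, rfl⟩
  exact (traceMul_toL2 τ c w).trans (h c hc)

theorem tensorTrace_mul_eq_zero {T : Subalgebra ℂ A} {t : A ⊗[ℂ] A}
    (ht : t ∈ Submodule.span ℂ {z | ∃ b ∈ T, ∃ c ∈ T, z = b ⊗ₜ[ℂ] c}) {u v : A}
    (h : (∀ b ∈ T, τ (u * b) = 0) ∨ (∀ c ∈ T, τ (c * v) = 0)) :
    tensorTrace τ ((u ⊗ₜ[ℂ] 1) * (t * (1 ⊗ₜ[ℂ] v))) = 0 := by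
  refine (Submodule.span_le (p := LinearMap.ker (tensorTrace τ ∘ₗ
    LinearMap.mulLeft ℂ (u ⊗ₜ[ℂ] (1 : A)) ∘ₗ LinearMap.mulRight ℂ ((1 : A) ⊗ₜ[ℂ] v)))).mpr ?_ ht
  rintro _ ⟨b, hb, c, hc, rfl⟩
  rcases h with h | h
  · simp [h b hb]
  · simp [h c hc]

variable {k : κ} {X : A} {G : Set A}

/-- Each term of `∂(a₁ ⋯ aₘ)` has in its left leg a nonempty alternating centred word times an element
of `S k`, when the word `w` is put in front; by freeness its trace vanishes. -/
theorem tensorTrace_prefix_eq_zero (hS : IsFree τ S) (hX : X ∈ S k) (hG : G ⊆ S k)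
    (l : List (κ × (A × (A ⊗[ℂ] A)))) : ∀ (w : List (κ × A)), w ≠ [] →
    (∀ q ∈ l, IsDiffLetter S k X G q) →
    IsAlternating τ S (w ++ l.map fun q => (q.1, q.2.1)) →
    tensorTrace τ (((w.map Prod.snd).prod ⊗ₜ[ℂ] 1) * (leibnizProd l).2) = 0 := by
  induction l with
  | nil => intro w _ _ _; simp [leibnizProd]
  | cons q l ih =>
    intro w hw hl ha
    have h1 := ih (w ++ [(q.1, q.2.1)]) (by simp) (fun r hr => hl r (List.mem_cons_of_mem _ hr))
      (by simpa using ha)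
    have e : (leibnizProd (q :: l)).2 =
      (q.2.1 ⊗ₜ[ℂ] 1) * (leibnizProd l).2 + q.2.2 * (1 ⊗ₜ[ℂ] (leibnizProd l).1) := rfl
    rw [e, mul_add, map_add]
    have h2 : (w.map Prod.snd).prod ⊗ₜ[ℂ] (1 : A) * (q.2.1 ⊗ₜ[ℂ] 1 * (leibnizProd l).2) =
        ((w ++ [(q.1, q.2.1)]).map Prod.snd).prod ⊗ₜ[ℂ] 1 * (leibnizProd l).2 := by
      simp [← mul_assoc]
    rw [h2, h1, zero_add]
    rcases (hl q (List.mem_cons_self ..)).2 with ⟨hk, hd⟩ | ⟨hk, hd⟩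
    · refine tensorTrace_mul_eq_zero (hd.mem_span hX hG).2 (Or.inl fun b hb => ?_)
      rw [isAlternating_append] at ha
      refine hS.map_prod_mul hw ha.1 (fun r hr => ?_) hb
      have := ha.2.2 r hr (q.1, q.2.1) (by simp)
      rwa [← hk]
    · simp [hd]

/-- On alternating centred words the score equation survives a free extension: both sides vanish
unless the word is a single letter from `S k`. -/
theorem score_leibnizProd (hS : IsFree τ S) (hX : X ∈ S k) (hG : G ⊆ S k) {ξ : L2 τ}
    (hξ : ξ ∈ ((Subalgebra.toSubmodule (S k)).map (toL2 τ)).topologicalClosure)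
    (hs : IsScoreOn τ X G ξ) (l : List (κ × (A × (A ⊗[ℂ] A))))
    (hl : ∀ q ∈ l, IsDiffLetter S k X G q)
    (ha : IsAlternating τ S (l.map fun q => (q.1, q.2.1))) :
    tensorTrace τ (leibnizProd l).2 = traceMul τ ξ (leibnizProd l).1 := by
  rcases l with _ | ⟨q, l⟩
  · have := hs _ _ (.scalar 1)
    simpa [leibnizProd] using this
  have e : (leibnizProd (q :: l)).2 =
      (q.2.1 ⊗ₜ[ℂ] 1) * (leibnizProd l).2 + q.2.2 * (1 ⊗ₜ[ℂ] (leibnizProd l).1) := rfl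
  have e' : (leibnizProd (q :: l)).1 = q.2.1 * (leibnizProd l).1 := rfl
  have hq := hl q (List.mem_cons_self ..)
  have h1 := tensorTrace_prefix_eq_zero hS hX hG l [(q.1, q.2.1)] (by simp)
    (fun r hr => hl r (List.mem_cons_of_mem _ hr)) (by simpa using ha)
  simp only [List.map_cons, List.map_nil, List.prod_cons, List.prod_nil, mul_one] at h1
  -- Only the term in which `∂` hits the first letter is left.
  rw [e, map_add, h1, zero_add]
  have ha' := ha
  rw [List.map_cons, isAlternating_cons] at ha'
  rcases hq.2 with ⟨hk, hd⟩ | ⟨hk, hd⟩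
  · rcases eq_or_ne l [] with rfl | hne
    · have := hs _ _ hd
      simpa [leibnizProd, leibnizMul, ← Algebra.TensorProduct.one_def] using this
    · have hne' : (l.map fun q => (q.1, q.2.1)) ≠ [] := by simpa using hne
      have h0 : ∀ b ∈ S k, τ (b * (leibnizProd l).1) = 0 := by
        intro b hb
        rw [leibnizProd_fst]
        refine hS.map_mul_prod hne' ha'.2.2 (fun r hr => ?_) hb
        rw [← hk]; exact (ha'.2.1 r hr).symm
      have h2 := tensorTrace_mul_eq_zero (τ := τ) (u := 1) (hd.mem_span hX hG).2 (Or.inr h0)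
      rw [← Algebra.TensorProduct.one_def, one_mul] at h2
      rw [h2, e']
      refine (traceMul_eq_zero hξ fun c hc => ?_).symm
      rw [← mul_assoc]
      exact h0 _ (mul_mem hc (hk ▸ hq.1))
  · rw [hd, zero_mul, map_zero]
    refine (traceMul_eq_zero hξ fun c hc => ?_).symm
    rw [leibnizProd_fst]
    refine hS.map_mul_prod (by simp) ha (fun r hr => ?_) hc
    simp only [List.map_cons, List.head?_cons, Option.mem_def, Option.some.injEq] at hr
    rw [← hr]; exact hk

variable (τ S k X G) in
/-- The span of the pairs `(a, ∂a)` for alternating centred words `a`. -/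
def leibnizSpan : Submodule ℂ (A × (A ⊗[ℂ] A)) :=
  Submodule.span ℂ {x | ∃ l : List (κ × (A × (A ⊗[ℂ] A))), (∀ q ∈ l, IsDiffLetter S k X G q) ∧
    IsAlternating τ S (l.map fun q => (q.1, q.2.1)) ∧ x = leibnizProd l}

theorem IsDiffLetter.centre {q : κ × (A × (A ⊗[ℂ] A))} (hq : IsDiffLetter S k X G q) :
    IsDiffLetter S k X G (q.1, q.2.1 - algebraMap ℂ A (τ q.2.1), q.2.2) := by
  refine ⟨sub_mem hq.1 (Subalgebra.algebraMap_mem _ _), ?_⟩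
  rcases hq.2 with ⟨h1, h2⟩ | h
  · refine Or.inl ⟨h1, ?_⟩
    have := h2.add (.scalar (-(τ q.2.1)))
    simpa [sub_eq_add_neg] using this
  · exact Or.inr h

theorem leibnizMul_letter_mem_of_head {q : κ × (A × (A ⊗[ℂ] A))} (hq : IsDiffLetter S k X G q)
    {l : List (κ × (A × (A ⊗[ℂ] A)))} (hl : ∀ q ∈ l, IsDiffLetter S k X G q)
    (ha : IsAlternating τ S (l.map fun q => (q.1, q.2.1))) (hh : ∀ r ∈ l.head?, q.1 ≠ r.1) :
    leibnizMul q.2 (leibnizProd l) ∈ leibnizSpan τ S k X G := by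
  have e : leibnizMul q.2 (leibnizProd l) =
      leibnizProd ((q.1, q.2.1 - algebraMap ℂ A (τ q.2.1), q.2.2) :: l) +
        (τ q.2.1) • leibnizProd l := by
    have e1 : q.2 = (q.2.1 - algebraMap ℂ A (τ q.2.1), q.2.2) + (τ q.2.1) • (1, 0) := by
      ext1 <;> simp [Algebra.algebraMap_eq_smul_one]
    conv_lhs => rw [e1, add_leibnizMul, smul_leibnizMul, one_leibnizMul]
    rfl
  rw [e]
  refine add_mem (Submodule.subset_span ⟨_, ?_, ?_, rfl⟩)
    (Submodule.smul_mem _ _ (Submodule.subset_span ⟨l, hl, ha, rfl⟩))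
  · rintro r hr
    rcases List.mem_cons.mp hr with rfl | hr
    · exact hq.centre
    · exact hl r hr
  · rw [List.map_cons, isAlternating_cons]
    refine ⟨⟨(hq.centre (τ := τ)).1, τ.map_centre _⟩, fun r hr => ?_, ha⟩
    rw [List.head?_map] at hr
    obtain ⟨r', hr', rfl⟩ := Option.map_eq_some_iff.mp hr
    exact hh r' hr'

theorem IsDiffLetter.mul {j : κ} {x y : A × (A ⊗[ℂ] A)} (hx : IsDiffLetter S k X G (j, x))
    (hy : IsDiffLetter S k X G (j, y)) : IsDiffLetter S k X G (j, leibnizMul x y) := by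
  refine ⟨mul_mem hx.1 hy.1, ?_⟩
  rcases hx.2 with ⟨h1, h2⟩ | ⟨h1, h2⟩ <;> rcases hy.2 with ⟨h3, h4⟩ | ⟨h3, h4⟩
  · exact Or.inl ⟨h1, h2.mul h4⟩
  · exact absurd h1 h3
  · exact absurd h3 h1
  · refine Or.inr ⟨h1, ?_⟩
    dsimp only at h2 h4
    simp [leibnizMul, h2, h4]

theorem leibnizMul_letter_mem {q : κ × (A × (A ⊗[ℂ] A))} (hq : IsDiffLetter S k X G q)
    {x : A × (A ⊗[ℂ] A)} (hx : x ∈ leibnizSpan τ S k X G) :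
    leibnizMul q.2 x ∈ leibnizSpan τ S k X G := by
  induction hx using Submodule.span_induction with
  | zero =>
    have : leibnizMul q.2 0 = 0 := by ext1 <;> simp [leibnizMul]
    rw [this]; exact zero_mem _
  | add x y _ _ hx hy => rw [leibnizMul_add]; exact add_mem hx hy
  | smul c x _ hx => rw [leibnizMul_smul]; exact Submodule.smul_mem _ _ hx
  | mem x hx =>
    obtain ⟨l, hl, ha, rfl⟩ := hx
    by_cases hh : ∀ r ∈ l.head?, q.1 ≠ r.1
    · exact leibnizMul_letter_mem_of_head hq hl ha hh
    · rcases l with _ | ⟨r, l⟩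
      · simp at hh
      have hr : q.1 = r.1 := by simpa using hh
      rw [List.map_cons, isAlternating_cons] at ha
      change leibnizMul q.2 (leibnizMul r.2 (leibnizProd l)) ∈ _
      rw [← leibnizMul_assoc]
      have hm : IsDiffLetter S k X G (r.1, leibnizMul q.2 r.2) :=
        IsDiffLetter.mul (by rw [← hr]; exact hq) (hl r (List.mem_cons_self ..))
      refine leibnizMul_letter_mem_of_head hm (fun q hq => hl q (List.mem_cons_of_mem _ hq))
        ha.2.2 fun s hs => ?_
      refine ha.2.1 (s.1, s.2.1) ?_
      rw [List.head?_map]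
      exact Option.map_eq_some_iff.mpr ⟨s, hs, rfl⟩

/-- The span of alternating centred words, paired with their difference quotients, absorbs
multiplication by any element of the graph, so it contains the graph. -/
theorem leibnizMul_diffGraph_mem (hX : X ∈ S k) (hG : G ⊆ S k) {G' : Set A}
    (hG' : ∀ g ∈ G', g ∈ Algebra.adjoin ℂ G ∨ ∃ j ≠ k, g ∈ S j) {a : A} {t : A ⊗[ℂ] A}
    (h : DiffGraph X G' a t) : ∀ x ∈ leibnizSpan τ S k X G,
      leibnizMul (a, t) x ∈ leibnizSpan τ S k X G := by
  induction h with
  | scalar r =>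
    intro x hx
    have e : ((algebraMap ℂ A r, 0) : A × (A ⊗[ℂ] A)) = r • (1, 0) := by
      ext1 <;> simp [Algebra.algebraMap_eq_smul_one]
    rw [e, smul_leibnizMul, one_leibnizMul]
    exact Submodule.smul_mem _ _ hx
  | var =>
    exact fun x hx => leibnizMul_letter_mem (q := (k, X, 1 ⊗ₜ[ℂ] 1))
      ⟨hX, Or.inl ⟨rfl, .var⟩⟩ hx
  | @mem g hg =>
    intro x hx
    rcases hG' g hg with h | ⟨j, hj, h⟩
    · exact leibnizMul_letter_mem (q := (k, g, 0))
        ⟨Algebra.adjoin_le (S := S k) hG h, Or.inl ⟨rfl, .of_mem_adjoin h⟩⟩ hx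
    · exact leibnizMul_letter_mem (q := (j, g, 0)) ⟨h, Or.inr ⟨hj, rfl⟩⟩ hx
  | add _ _ ha hb =>
    intro x hx
    rw [← Prod.mk_add_mk, add_leibnizMul]
    exact add_mem (ha x hx) (hb x hx)
  | @mul a b s t _ _ ha hb =>
    intro x hx
    have := ha _ (hb x hx)
    rwa [← leibnizMul_assoc] at this

/-- The score of `X` relative to `G` is unchanged when algebras free from `X` and `G` are adjoined
to `G`. -/
theorem IsScoreOn.free_extend (hS : IsFree τ S) (hX : X ∈ S k) (hG : G ⊆ S k) {ξ : L2 τ}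
    (hξ : ξ ∈ ((Subalgebra.toSubmodule (S k)).map (toL2 τ)).topologicalClosure)
    (hs : IsScoreOn τ X G ξ) {G' : Set A}
    (hG' : ∀ g ∈ G', g ∈ Algebra.adjoin ℂ G ∨ ∃ j ≠ k, g ∈ S j) : IsScoreOn τ X G' ξ := by
  intro a t h
  have hone : ((1, 0) : A × (A ⊗[ℂ] A)) ∈ leibnizSpan τ S k X G :=
    Submodule.subset_span ⟨[], by simp, .nil, rfl⟩
  have h1 := leibnizMul_diffGraph_mem (τ := τ) hX hG hG' h _ hone
  rw [leibnizMul_one] at h1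
  have key : ∀ x ∈ leibnizSpan τ S k X G, tensorTrace τ x.2 = traceMul τ ξ x.1 := by
    intro x hx
    induction hx using Submodule.span_induction with
    | zero => simp [traceMul]
    | add x y _ _ hx hy =>
      simp only [Prod.snd_add, Prod.fst_add, map_add, hx, hy, traceMul, star_add, inner_add_left]
    | smul c x _ hx =>
      simp only [Prod.smul_snd, Prod.smul_fst, map_smul, hx, traceMul, star_smul, inner_smul_left,
        smul_eq_mul, RCLike.star_def, Complex.conj_conj]
    | mem x hx =>
      obtain ⟨l, hl, ha, rfl⟩ := hx
      exact score_leibnizProd hS hX hG hξ hs l hl ha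
  exact key _ h1

end Free

/-! ### Free difference quotients in a corner -/

section Corner

variable {A : Type u} [Ring A] [StarRing A] [Algebra ℂ A] [StarModule ℂ A] {p : A}
  {hp : IsStarProjection p}

/-- The inclusion of `p A p` into `A`, as a linear map. -/
def Corner.valLinear (hp : IsStarProjection p) : Corner hp →ₗ[ℂ] A where
  toFun := Corner.val
  map_add' := Corner.val_add
  map_smul' := Corner.val_smul

@[simp] theorem Corner.valLinear_apply (x : Corner hp) : Corner.valLinear hp x = x.val := rfl

variable (τ : TracialState A) {k : ℝ} {hk : 1 ≤ k} {hτ : τ p = ((1 / k : ℝ) : ℂ)}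

theorem compress_apply (x : Corner hp) : τ.compress hp hk hτ x = (k : ℂ) * τ x.val := rfl

theorem tensorTrace_compress (t : Corner hp ⊗[ℂ] Corner hp) :
    tensorTrace (τ.compress hp hk hτ) t = (k : ℂ) ^ 2 *
      tensorTrace τ (TensorProduct.map (Corner.valLinear hp) (Corner.valLinear hp) t) := by
  induction t using TensorProduct.induction_on with
  | zero => simp
  | tmul x y => simp only [tensorTrace_tmul, compress_apply, TensorProduct.map_tmul,
      Corner.valLinear_apply]; ring
  | add x y hx hy => simp only [map_add, hx, hy, mul_add]

theorem Corner.map_val_mul_left (a : Corner hp) (t : Corner hp ⊗[ℂ] Corner hp) :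
    TensorProduct.map (Corner.valLinear hp) (Corner.valLinear hp) ((a ⊗ₜ[ℂ] 1) * t) =
      (a.val ⊗ₜ[ℂ] 1) * TensorProduct.map (Corner.valLinear hp) (Corner.valLinear hp) t := by
  induction t using TensorProduct.induction_on with
  | zero => simp
  | tmul x y => simp
  | add x y hx hy => simp only [map_add, hx, hy, mul_add]

theorem Corner.map_val_mul_right (a : Corner hp) (t : Corner hp ⊗[ℂ] Corner hp) :
    TensorProduct.map (Corner.valLinear hp) (Corner.valLinear hp) (t * (1 ⊗ₜ[ℂ] a)) =
      TensorProduct.map (Corner.valLinear hp) (Corner.valLinear hp) t * (1 ⊗ₜ[ℂ] a.val) := by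
  induction t using TensorProduct.induction_on with
  | zero => simp
  | tmul x y => simp
  | add x y hx hy => simp only [map_add, hx, hy, add_mul]

/-- The free difference quotient with respect to `s p X p` in the corner `p A p` is, up to the
factor `s`, the free difference quotient with respect to `X`, provided that `∂p = 0`. -/
theorem DiffGraph.of_corner {X : A} {G' : Set A} {s : ℂ} {G : Set (Corner hp)}
    (hpG : DiffGraph X G' p 0) (hG : ∀ g ∈ G, DiffGraph X G' g.val 0)
    {a : Corner hp} {t : Corner hp ⊗[ℂ] Corner hp}
    (h : DiffGraph (s • Corner.compress hp X) G a t) :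
    DiffGraph X G' a.val
      (s • TensorProduct.map (Corner.valLinear hp) (Corner.valLinear hp) t) := by
  induction h with
  | scalar r =>
    rw [Algebra.algebraMap_eq_smul_one, Corner.val_smul, Corner.val_one, map_zero,
      MulActionWithZero.smul_zero]
    exact hpG.smul_zero r
  | var =>
    have := ((hpG.mul .var).mul hpG).smul s
    simpa using this
  | mem hg => simpa using hG _ hg
  | add _ _ ha hb => rw [map_add, smul_add]; exact ha.add hb
  | mul _ _ ha hb =>
    have := ha.mul hb
    rw [map_add, Corner.map_val_mul_left, Corner.map_val_mul_right, smul_add, Corner.val_mul]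
    simpa using this

/-- If `ξ` satisfies the score equation for `X` relative to a set that contains `p`, then the
compression of `√k ξ` satisfies it for `√k p X p`. -/
theorem IsScoreOn.tensorTrace_corner {X : A} {G' : Set A} {ξ : L2 τ} (hs : IsScoreOn τ X G' ξ)
    {G : Set (Corner hp)} (hpG : p ∈ G') (hG : ∀ g ∈ G, DiffGraph X G' g.val 0)
    {a : Corner hp} {t : Corner hp ⊗[ℂ] Corner hp}
    (h : DiffGraph (((√k : ℝ) : ℂ) • Corner.compress hp X) G a t) :
    tensorTrace (τ.compress hp hk hτ) t = (k : ℂ) * ((√k : ℝ) : ℂ) * traceMul τ ξ a.val := by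
  have h1 := hs _ _ (DiffGraph.of_corner (.mem hpG) hG h)
  rw [map_smul, smul_eq_mul] at h1
  have hkk : ((√k : ℝ) : ℂ) * ((√k : ℝ) : ℂ) = (k : ℂ) := by
    rw [← Complex.ofReal_mul, Real.mul_self_sqrt (by linarith)]
  rw [tensorTrace_compress, ← h1]
  linear_combination (-(k : ℂ)) * tensorTrace τ (TensorProduct.map (Corner.valLinear hp)
    (Corner.valLinear hp) t) * hkk

theorem norm_toL2_compress (x : Corner hp) :
    ‖toL2 (τ.compress hp hk hτ) x‖ = √k * ‖toL2 τ x.val‖ := by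
  have h : ((‖toL2 (τ.compress hp hk hτ) x‖ ^ 2 : ℝ) : ℂ) =
      ((k * ‖toL2 τ x.val‖ ^ 2 : ℝ) : ℂ) := by
    rw [norm_toL2_sq, compress_apply, Complex.ofReal_mul, norm_toL2_sq, Corner.val_mul,
      Corner.val_star]
  have h' : ‖toL2 (τ.compress hp hk hτ) x‖ ^ 2 = k * ‖toL2 τ x.val‖ ^ 2 := by exact_mod_cast h
  rw [← Real.sqrt_sq (norm_nonneg (toL2 (τ.compress hp hk hτ) x)), h',
    Real.sqrt_mul (by linarith), Real.sqrt_sq (norm_nonneg _)]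

/-! ### The norm of a compression by a free projection -/

/-- The second mixed moment of `c₁, c₂` and a projection `p` that is free from them. -/
theorem map_mul_proj_mul_proj {T : Set A} {α : ℂ} (hp : IsStarProjection p)
    (hα : τ p = α) (hfree : IsFreeFrom τ {p} T) {c₁ c₂ : A} (h₁ : c₁ ∈ Algebra.adjoin ℂ T)
    (h₂ : c₂ ∈ Algebra.adjoin ℂ T) :
    τ (c₁ * p * c₂ * p) = α ^ 2 * τ (c₁ * c₂) + (α - α ^ 2) * (τ c₁ * τ c₂) := by
  have hpp : p * p = p := hp.isIdempotentElem
  set S : Bool → Subalgebra ℂ A :=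
    fun b : Bool => if b then Algebra.adjoin ℂ {p} else Algebra.adjoin ℂ T with hS
  have hf : IsFree τ S := hfree
  have hpS : p ∈ S true := by simp [hS]
  set q : A := p - algebraMap ℂ A α with hq
  have hqS : q ∈ S true := sub_mem hpS (Subalgebra.algebraMap_mem _ _)
  have hq0 : τ q = 0 := by rw [hq, ← hα]; exact τ.map_centre p
  have hpq : p = q + α • 1 := by rw [hq, Algebra.algebraMap_eq_smul_one]; abel
  have h₁' : c₁ ∈ S false := by simpa [hS] using h₁
  have h₂' : c₂ ∈ S false := by simpa [hS] using h₂
  have z1 : ∀ b ∈ S false, τ (b * q) = 0 := by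
    intro b hb
    simpa using hf.map_mul_prod (l := [(true, q)]) (by simp) (.singleton ⟨hqS, hq0⟩) (k := false)
      (by simp) hb
  have hqq : τ (q * q) = α - α ^ 2 := by
    have e : q * q = p - (2 * α) • p + (α ^ 2) • 1 := by
      rw [hq, Algebra.algebraMap_eq_smul_one]
      simp only [mul_sub, sub_mul, hpp, smul_mul_assoc, mul_smul_comm, one_mul, mul_one]
      module
    rw [e, map_add, map_sub, map_smul, map_smul, hα, τ.map_one']
    simp only [smul_eq_mul]; ring
  have z2 : τ (c₁ * (q * q)) = (α - α ^ 2) * τ c₁ := by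
    have h := hf.map_mul_prod (l := [(true, q * q - algebraMap ℂ A (τ (q * q)))]) (by simp)
      (.singleton ⟨sub_mem (mul_mem hqS hqS) (Subalgebra.algebraMap_mem _ _), τ.map_centre _⟩)
      (k := false) (by simp) h₁'
    simp only [List.map_cons, List.map_nil, List.prod_cons, List.prod_nil, mul_one, mul_sub,
      map_sub, Algebra.algebraMap_eq_smul_one, mul_smul_comm, map_smul, hqq, smul_eq_mul] at h
    linear_combination h
  have z3 : τ (c₁ * (q * ((c₂ - algebraMap ℂ A (τ c₂)) * q))) = 0 := by
    have h := hf.map_mul_prod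
      (l := [(true, q), (false, c₂ - algebraMap ℂ A (τ c₂)), (true, q)]) (by simp)
      (isAlternating_cons.mpr ⟨⟨hqS, hq0⟩, by simp, isAlternating_cons.mpr
        ⟨⟨sub_mem h₂' (Subalgebra.algebraMap_mem _ _), τ.map_centre _⟩, by simp,
          .singleton ⟨hqS, hq0⟩⟩⟩)
      (k := false) (by simp) h₁'
    simpa using h
  have z4 : τ (c₁ * q * c₂ * q) = (α - α ^ 2) * (τ c₁ * τ c₂) := by
    have e : c₁ * q * c₂ * q = c₁ * (q * ((c₂ - algebraMap ℂ A (τ c₂)) * q)) +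
        τ c₂ • (c₁ * (q * q)) := by
      rw [Algebra.algebraMap_eq_smul_one]
      simp only [mul_sub, sub_mul, smul_mul_assoc, mul_smul_comm, one_mul, mul_assoc]
      abel
    rw [e, map_add, z3, map_smul, z2, smul_eq_mul]; ring
  have e : c₁ * p * c₂ * p = c₁ * q * c₂ * q + α • (c₁ * c₂ * q) + α • (c₁ * q * c₂) +
      (α ^ 2) • (c₁ * c₂) := by
    rw [hpq]
    simp only [mul_add, add_mul, smul_mul_assoc, mul_smul_comm, mul_one]
    module
  rw [e, map_add, map_add, map_add, map_smul, map_smul, map_smul, z4,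
    z1 _ (mul_mem h₁' h₂'), mul_assoc c₁ q c₂, τ.mul_comm c₁, mul_assoc, τ.mul_comm q,
    z1 _ (mul_mem h₂' h₁')]
  simp only [smul_eq_mul]; ring

/-- Pairing with an element of the corner `p A p` shrinks the norm of a centred vector `ξ` that is
free from `p` by the factor `τ(p) = 1 / k`. -/
theorem norm_inner_corner_le {T : Set A} (hT : ∀ g ∈ T, star g ∈ T) (hk : 1 ≤ k)
    (hp : IsStarProjection p) (hτ : τ p = ((1 / k : ℝ) : ℂ)) (hfree : IsFreeFrom τ {p} T)
    {w : A} (hw : p * w * p = w) {ξ : L2 τ}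
    (hξ : ξ ∈ ((Subalgebra.toSubmodule (Algebra.adjoin ℂ T)).map (toL2 τ)).topologicalClosure)
    (h0 : inner ℂ (toL2 τ 1) ξ = 0) :
    ‖inner ℂ (toL2 τ w) ξ‖ ≤ ‖toL2 τ w‖ * (‖ξ‖ / k) := by
  have hps : star p = p := hp.isSelfAdjoint.star_eq
  have hpp : p * p = p := hp.isIdempotentElem
  have hk0 : 0 < k := by linarith
  -- The estimate without centring passes from `Alg T` to its closure, as both sides are continuous;
  -- elements of `Alg T` that approximate `ξ` need not themselves be centred.
  have key : ∀ η ∈ ((Subalgebra.toSubmodule (Algebra.adjoin ℂ T)).map (toL2 τ)).topologicalClosure,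
      ‖inner ℂ (toL2 τ w) η‖ ^ 2 ≤ ‖toL2 τ w‖ ^ 2 *
        ((1 / k) ^ 2 * ‖η‖ ^ 2 + (1 / k - (1 / k) ^ 2) * ‖inner ℂ (toL2 τ 1) η‖ ^ 2) := by
    intro η hη
    have hcl : IsClosed {η : L2 τ | ‖inner ℂ (toL2 τ w) η‖ ^ 2 ≤ ‖toL2 τ w‖ ^ 2 *
        ((1 / k) ^ 2 * ‖η‖ ^ 2 + (1 / k - (1 / k) ^ 2) * ‖inner ℂ (toL2 τ 1) η‖ ^ 2)} :=
      isClosed_le (by fun_prop) (by fun_prop)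
    refine closure_minimal ?_ hcl hη
    rintro _ ⟨c, hc, rfl⟩
    have e1 : inner ℂ (toL2 τ w) (toL2 τ c) = inner ℂ (toL2 τ w) (toL2 τ (p * c * p)) := by
      rw [inner_toL2, inner_toL2]
      conv_lhs => rw [← hw]
      rw [star_mul, star_mul, hps, mul_assoc, τ.mul_comm p, ← mul_assoc, ← mul_assoc]
    have e2 : ‖toL2 τ (p * c * p)‖ ^ 2 = (1 / k) ^ 2 * ‖toL2 τ c‖ ^ 2 +
        (1 / k - (1 / k) ^ 2) * ‖inner ℂ (toL2 τ 1) (toL2 τ c)‖ ^ 2 := by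
      have e : ((‖toL2 τ (p * c * p)‖ ^ 2 : ℝ) : ℂ) = ((((1 / k) ^ 2 * ‖toL2 τ c‖ ^ 2 +
          (1 / k - (1 / k) ^ 2) * ‖inner ℂ (toL2 τ 1) (toL2 τ c)‖ ^ 2 : ℝ)) : ℂ) := by
        have e3 : τ (star (p * c * p) * (p * c * p)) = τ (star c * p * c * p) := by
          rw [star_mul, star_mul, hps]
          have : p * (star c * p) * (p * c * p) = p * (star c * (p * p) * c * p) := by
            simp only [mul_assoc]
          rw [this, hpp, τ.mul_comm p, mul_assoc _ p p, hpp]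
        have e4 : τ (star c) * τ c = ((‖inner ℂ (toL2 τ 1) (toL2 τ c)‖ ^ 2 : ℝ) : ℂ) := by
          rw [inner_toL2, star_one, one_mul, τ.map_star, ← Complex.normSq_eq_conj_mul_self,
            Complex.normSq_eq_norm_sq]
        rw [norm_toL2_sq, e3, map_mul_proj_mul_proj τ hp hτ hfree (star_mem_adjoin hT hc) hc, e4,
          ← norm_toL2_sq]
        push_cast; ring
      exact_mod_cast e
    change ‖inner ℂ (toL2 τ w) (toL2 τ c)‖ ^ 2 ≤ _
    rw [← e2, e1, ← mul_pow]
    exact pow_le_pow_left₀ (norm_nonneg _) (norm_inner_le_norm _ _) 2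
  have h := key ξ hξ
  rw [h0, norm_zero] at h
  refine (sq_le_sq₀ (norm_nonneg _) (by positivity)).mp (h.trans_eq ?_)
  ring

theorem algClosure_adjoin (X : A) (G : Set A) :
    algClosure τ X (Algebra.adjoin ℂ G) =
      ((Subalgebra.toSubmodule (Algebra.adjoin ℂ (insert X G))).map
        (toL2 τ)).topologicalClosure := by
  rw [algClosure, Set.insert_eq, Algebra.adjoin_union, Algebra.adjoin_eq, Set.insert_eq,
    Algebra.adjoin_union]

/-! ### Monotonicity of the free Fisher information -/

theorem compress_smul_isSelfAdjoint {X : A} (hX : IsSelfAdjoint X) (s : ℝ) :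
    IsSelfAdjoint ((s : ℂ) • Corner.compress hp X) := by
  have h : star p = p := hp.isSelfAdjoint.star_eq
  have h1 : IsSelfAdjoint (Corner.compress hp X) :=
    Corner.val_injective (by simp [hX.star_eq, h, mul_assoc])
  exact IsSelfAdjoint.smul (Complex.conj_ofReal s) h1

/-- The free Fisher information does not increase under compression by a free projection with the
scaling `k^{1/2}`. -/
theorem fisherStar_compress_le {n : ℕ} {X : Fin n → A} (hX : ∀ i, IsSelfAdjoint (X i))
    (hk : 1 ≤ k) (hp : IsStarProjection p) (hτ : τ p = ((1 / k : ℝ) : ℂ))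
    (hfree : IsFreeFrom τ {p} (Set.range X)) :
    fisherStar (τ.compress hp hk hτ)
        (fun i => ((√k : ℝ) : ℂ) • FreeProb.Corner.compress hp (X i)) ≤
      fisherStar τ X := by
  refine Finset.sum_le_sum fun i _ => le_relFisher fun ξ hξ hs => ?_
  refine relFisher_le_of_bound _ (compress_smul_isSelfAdjoint (hX i) _) ?_ (norm_nonneg _)
    fun a t h => ?_
  · rintro _ ⟨j, hj, rfl⟩
    exact ⟨j, hj, (compress_smul_isSelfAdjoint (hX j) _).star_eq.symm⟩
  have hins : insert (X i) (X '' {j | j ≠ i}) = Set.range X := by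
    ext x
    constructor
    · rintro (rfl | ⟨j, -, rfl⟩) <;> exact ⟨_, rfl⟩
    · rintro ⟨j, rfl⟩
      by_cases h : j = i
      · exact Or.inl (by rw [h])
      · exact Or.inr ⟨j, h, rfl⟩
  rw [algClosure_adjoin, hins] at hξ
  have hs' : IsScoreOn τ (X i) (insert p (X '' {j | j ≠ i})) ξ := by
    refine hs.free_extend hfree (k := false) ?_ ?_ (by simpa using hξ) ?_
    · simpa using Algebra.subset_adjoin (R := ℂ) (Set.mem_range_self (f := X) i)
    · rintro _ ⟨j, -, rfl⟩
      simpa using Algebra.subset_adjoin (R := ℂ) (Set.mem_range_self (f := X) j)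
    · rintro g (rfl | hg)
      · exact Or.inr ⟨true, by simp, by simp⟩
      · exact Or.inl (Algebra.subset_adjoin hg)
  have hpm : p ∈ insert p (X '' {j | j ≠ i}) := Or.inl rfl
  have h1 := hs'.tensorTrace_corner τ (hk := hk) (hτ := hτ) hpm (by
    rintro _ ⟨j, hj, rfl⟩
    rw [Corner.val_smul, Corner.val_compress]
    exact (((DiffGraph.mem hpm).mul_zero (.mem (Or.inr ⟨j, hj, rfl⟩))).mul_zero
      (.mem hpm)).smul_zero _) h
  have hk0 : 0 < k := by linarith
  -- The score is centred because `∂1 = 0`.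
  have h0 : inner ℂ (toL2 τ 1) ξ = 0 := by
    have := hs _ _ (.scalar 1)
    simpa [traceMul] using this.symm
  have hps : star p = p := hp.isSelfAdjoint.star_eq
  have hT : ∀ g ∈ Set.range X, star g ∈ Set.range X := by
    rintro _ ⟨j, rfl⟩; exact ⟨j, (hX j).star_eq.symm⟩
  have hw : p * star a.val * p = star a.val := by
    rw [← Corner.val_star, Corner.mul_val, Corner.val_mul_self]
  have h2 := norm_inner_corner_le τ hT hk hp hτ hfree hw hξ h0
  rw [h1, norm_mul, norm_mul, norm_toL2_compress, Complex.norm_real, Complex.norm_real,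
    Real.norm_of_nonneg hk0.le, Real.norm_of_nonneg (Real.sqrt_nonneg _), traceMul]
  rw [norm_toL2_star] at h2
  -- One factor `k` comes from the trace of the corner, `√k` from the scaling of the variables, and
  -- `1 / k` from the compression of `ξ`; the last `√k` goes into the norm of `a` in the corner.
  calc k * √k * ‖inner ℂ (toL2 τ (star a.val)) ξ‖
      ≤ k * √k * (‖toL2 τ a.val‖ * (‖ξ‖ / k)) := by gcongr
    _ = ‖ξ‖ * (√k * ‖toL2 τ a.val‖) := by field_simp

end Corner

section Assoc

variable {A : Type*} [Ring A] [StarRing A] [Algebra ℂ A] [StarModule ℂ A] {τ : TracialState A}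

/-! ### Associativity of free independence -/

section Regroup

variable {κ : Type*} {T : κ → Subalgebra ℂ A}

theorem mul_mem_altSpan {P : κ → Prop} {j : κ} (hj : P j) {a : A} (ha : a ∈ T j) {x : A}
    (hx : x ∈ Submodule.span ℂ {x | ∃ w : List (κ × A), IsAlternating τ T w ∧
      (∀ q ∈ w, P q.1) ∧ x = (w.map Prod.snd).prod}) :
    a * x ∈ Submodule.span ℂ {x | ∃ w : List (κ × A), IsAlternating τ T w ∧
      (∀ q ∈ w, P q.1) ∧ x = (w.map Prod.snd).prod} := by
  have hhead : ∀ (w : List (κ × A)) (b : A), b ∈ T j → IsAlternating τ T w → (∀ q ∈ w, P q.1) →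
      (∀ r ∈ w.head?, j ≠ r.1) → b * (w.map Prod.snd).prod ∈
        Submodule.span ℂ {x | ∃ w : List (κ × A), IsAlternating τ T w ∧
          (∀ q ∈ w, P q.1) ∧ x = (w.map Prod.snd).prod} := by
    intro w b hb hw hP hh
    have e : b * (w.map Prod.snd).prod =
        (((j, b - algebraMap ℂ A (τ b)) :: w).map Prod.snd).prod +
          τ b • (w.map Prod.snd).prod := by
      simp [Algebra.algebraMap_eq_smul_one, sub_mul]
    rw [e]
    refine add_mem (Submodule.subset_span ⟨_, ?_, ?_, rfl⟩)
      (Submodule.smul_mem _ _ (Submodule.subset_span ⟨w, hw, hP, rfl⟩))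
    · exact isAlternating_cons.mpr
        ⟨⟨sub_mem hb (Subalgebra.algebraMap_mem _ _), τ.map_centre b⟩, hh, hw⟩
    · rintro q hq
      rcases List.mem_cons.mp hq with rfl | hq
      · exact hj
      · exact hP q hq
  induction hx using Submodule.span_induction with
  | zero => rw [mul_zero]; exact zero_mem _
  | add x y _ _ hx hy => rw [mul_add]; exact add_mem hx hy
  | smul c x _ hx => rw [mul_smul_comm]; exact Submodule.smul_mem _ _ hx
  | mem x hx =>
    obtain ⟨w, hw, hP, rfl⟩ := hx
    by_cases hh : ∀ r ∈ w.head?, j ≠ r.1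
    · exact hhead w a ha hw hP hh
    · rcases w with _ | ⟨⟨i, b⟩, w⟩
      · simp at hh
      obtain rfl : j = i := by simpa using hh
      rw [isAlternating_cons] at hw
      rw [List.map_cons, List.prod_cons, ← mul_assoc]
      exact hhead w _ (mul_mem ha hw.1.1) hw.2.2 (fun q hq => hP q (List.mem_cons_of_mem _ hq))
        hw.2.1

/-- The algebra generated by some members of a free family is spanned by alternating centred words
of their elements. -/
theorem adjoin_le_altSpan {P : κ → Prop} {a : A}
    (ha : a ∈ Algebra.adjoin ℂ {a | ∃ j, P j ∧ a ∈ T j}) :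
    a ∈ Submodule.span ℂ {x | ∃ w : List (κ × A), IsAlternating τ T w ∧
      (∀ q ∈ w, P q.1) ∧ x = (w.map Prod.snd).prod} := by
  have key : ∀ x ∈ Submodule.span ℂ {x | ∃ w : List (κ × A), IsAlternating τ T w ∧
      (∀ q ∈ w, P q.1) ∧ x = (w.map Prod.snd).prod}, a * x ∈
      Submodule.span ℂ {x | ∃ w : List (κ × A), IsAlternating τ T w ∧
      (∀ q ∈ w, P q.1) ∧ x = (w.map Prod.snd).prod} := by
    induction ha using Algebra.adjoin_induction with
    | mem a ha =>
      obtain ⟨j, hj, ha⟩ := ha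
      exact fun x hx => mul_mem_altSpan hj ha hx
    | algebraMap r =>
      intro x hx
      rw [Algebra.algebraMap_eq_smul_one, smul_mul_assoc, one_mul]
      exact Submodule.smul_mem _ _ hx
    | add a b _ _ ha hb => intro x hx; rw [add_mul]; exact add_mem (ha x hx) (hb x hx)
    | mul a b _ _ ha hb => intro x hx; rw [mul_assoc]; exact ha _ (hb x hx)
  simpa using key 1 (Submodule.subset_span ⟨[], .nil, by simp, by simp⟩)

/-- A centred element of the algebra generated by some members of a free family is a combination
of nonempty alternating centred words. -/
theorem IsFree.mem_span_of_centred (hT : IsFree τ T) {P : κ → Prop} {a : A}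
    (ha : a ∈ Algebra.adjoin ℂ {a | ∃ j, P j ∧ a ∈ T j}) (h0 : τ a = 0) :
    a ∈ Submodule.span ℂ {x | ∃ w : List (κ × A), w ≠ [] ∧ IsAlternating τ T w ∧
      (∀ q ∈ w, P q.1) ∧ x = (w.map Prod.snd).prod} := by
  set N := Submodule.span ℂ {x | ∃ w : List (κ × A), w ≠ [] ∧ IsAlternating τ T w ∧
      (∀ q ∈ w, P q.1) ∧ x = (w.map Prod.snd).prod} with hN
  have h1 : a ∈ N ⊔ Submodule.span ℂ {1} := by
    refine (Submodule.span_le.mpr ?_) (adjoin_le_altSpan (τ := τ) ha)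
    rintro _ ⟨w, hw, hP, rfl⟩
    rcases eq_or_ne w [] with rfl | hne
    · exact Submodule.mem_sup_right (by simp [Submodule.mem_span_singleton_self])
    · exact Submodule.mem_sup_left (Submodule.subset_span ⟨w, hne, hw, hP, rfl⟩)
  obtain ⟨y, hy, z, hz, rfl⟩ := Submodule.mem_sup.mp h1
  obtain ⟨c, rfl⟩ := Submodule.mem_span_singleton.mp hz
  have hy0 : N ≤ LinearMap.ker τ.toLinearMap := by
    refine Submodule.span_le.mpr ?_
    rintro _ ⟨w, hne, hw, -, rfl⟩
    exact isFree_iff.mp hT w hne hw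
  have hy1 : τ y = 0 := hy0 hy
  rw [map_add, hy1, map_smul, τ.map_one', zero_add, smul_eq_mul, mul_one] at h0
  simpa [h0] using hy

/-- Free products are associative: algebras generated by disjoint groups of members of a free
family are free. -/
theorem IsFree.regroup (hT : IsFree τ T) {κ' : Type*} (g : κ → κ') {R : κ' → Subalgebra ℂ A}
    (hR : ∀ l, R l ≤ Algebra.adjoin ℂ {a | ∃ j, g j = l ∧ a ∈ T j}) : IsFree τ R := by
  have key : ∀ (L : List (κ' × A)) (q : κ' × A), IsAlternating τ R (q :: L) →
      ((q :: L).map Prod.snd).prod ∈ Submodule.span ℂ {x | ∃ w : List (κ × A), w ≠ [] ∧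
        IsAlternating τ T w ∧ (∀ r ∈ w.head?, g r.1 = q.1) ∧ x = (w.map Prod.snd).prod} := by
    intro L
    induction L with
    | nil =>
      intro q hq
      rw [isAlternating_cons] at hq
      simp only [List.map_cons, List.map_nil, List.prod_cons, List.prod_nil, mul_one]
      refine Submodule.span_mono ?_ (hT.mem_span_of_centred (hR _ hq.1.1) hq.1.2)
      rintro _ ⟨w, hne, hw, hP, rfl⟩
      exact ⟨w, hne, hw, fun r hr => hP r (List.mem_of_mem_head? hr), rfl⟩
    | cons q' L ih =>
      intro q hq
      rw [isAlternating_cons] at hq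
      have h1 := hT.mem_span_of_centred (hR _ hq.1.1) hq.1.2
      have h2 := ih q' hq.2.2
      have h3 := Submodule.mul_mem_mul h1 h2
      rw [Submodule.span_mul_span] at h3
      rw [List.map_cons, List.prod_cons]
      refine Submodule.span_mono ?_ h3
      rintro _ ⟨_, ⟨w, hne, hw, hP, rfl⟩, _, ⟨w', hne', hw', hP', rfl⟩, rfl⟩
      refine ⟨w ++ w', by simp [hne], isAlternating_append.mpr ⟨hw, hw', ?_⟩, ?_, by simp⟩
      · intro r hr r' hr' hrr
        have e1 := hP r (List.mem_of_getLast? hr)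
        have e2 := hP' r' hr'
        refine hq.2.1 q' (by simp) ?_
        rw [← e1, ← e2, hrr]
      · intro r hr
        rw [List.head?_append_of_ne_nil _ hne] at hr
        exact hP r (List.mem_of_mem_head? hr)
  rw [isFree_iff]
  intro L hL ha
  obtain ⟨q, L, rfl⟩ := List.exists_cons_of_ne_nil hL
  have hle : Submodule.span ℂ {x | ∃ w : List (κ × A), w ≠ [] ∧
        IsAlternating τ T w ∧ (∀ r ∈ w.head?, g r.1 = q.1) ∧ x = (w.map Prod.snd).prod} ≤
      LinearMap.ker τ.toLinearMap := by
    refine Submodule.span_le.mpr ?_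
    rintro _ ⟨w, hne, hw, -, rfl⟩
    exact isFree_iff.mp hT w hne hw
  exact hle (key L q ha)

end Regroup

section Refine

variable {μ ν : Type*} {S : Option μ → Subalgebra ℂ A} {U : ν → Subalgebra ℂ A}

/-- A member of a free family may be replaced by a family of free subalgebras of it. -/
theorem IsFree.refine_none (hS : IsFree τ S) (hU : IsFree τ U) (hUS : ∀ v, U v ≤ S none) :
    IsFree τ (Sum.elim U (fun m => S (some m))) := by
  have hprod : ∀ w : List (ν × A), w ≠ [] → IsAlternating τ U w →
      (w.map Prod.snd).prod ∈ S none ∧ τ (w.map Prod.snd).prod = 0 := by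
    intro w hne hw
    refine ⟨list_prod_mem ?_, isFree_iff.mp hU w hne hw⟩
    intro x hx
    obtain ⟨q, hq, rfl⟩ := List.mem_map.mp hx
    exact hUS _ (hw.1 q hq).1
  -- Maximal runs of letters from the `U v` are merged into one centred letter from `S none`.
  have key : ∀ (L : List ((ν ⊕ μ) × A)) (q : (ν ⊕ μ) × A),
      IsAlternating τ (Sum.elim U (fun m => S (some m))) (q :: L) →
      (∀ v, q.1 = Sum.inl v → ∃ (w : List (ν × A)) (R : List (Option μ × A)), w ≠ [] ∧
        IsAlternating τ U w ∧ (∀ r ∈ w.head?, r.1 = v) ∧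
        IsAlternating τ S ((none, (w.map Prod.snd).prod) :: R) ∧
        (w.map Prod.snd).prod * (R.map Prod.snd).prod = ((q :: L).map Prod.snd).prod) ∧
      (∀ m, q.1 = Sum.inr m → ∃ R : List (Option μ × A),
        IsAlternating τ S ((some m, q.2) :: R) ∧
        q.2 * (R.map Prod.snd).prod = ((q :: L).map Prod.snd).prod) := by
    intro L
    induction L with
    | nil =>
      rintro ⟨j, a⟩ hq
      rw [isAlternating_cons] at hq
      refine ⟨?_, ?_⟩
      · rintro v rfl
        have hw : IsAlternating τ U [(v, a)] := .singleton hq.1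
        exact ⟨[(v, a)], [], by simp, hw, by simp, .singleton (hprod _ (by simp) hw), by simp⟩
      · rintro m rfl
        exact ⟨[], .singleton hq.1, by simp⟩
    | cons q' L ih =>
      rintro ⟨j, a⟩ hq
      rw [isAlternating_cons] at hq
      obtain ⟨hq1, hq2, hq3⟩ := hq
      have hne := hq2 q' (by simp)
      obtain ⟨j', a'⟩ := q'
      obtain ⟨ih1, ih2⟩ := ih _ hq3
      refine ⟨?_, ?_⟩
      · rintro v rfl
        rcases j' with v' | m'
        · obtain ⟨w, R, hw0, hw, hwv, hR, he⟩ := ih1 v' rfl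
          have hw' : IsAlternating τ U ((v, a) :: w) := by
            refine isAlternating_cons.mpr ⟨hq1, fun r hr hvr => hne ?_, hw⟩
            have hvr' : v = r.1 := hvr
            rw [hvr', hwv r hr]
          refine ⟨(v, a) :: w, R, by simp, hw', by simp, ?_, ?_⟩
          · rw [isAlternating_cons] at hR ⊢
            exact ⟨hprod _ (by simp) hw', hR.2⟩
          · rw [List.map_cons, List.prod_cons, List.map_cons, List.prod_cons, ← he, mul_assoc]
        · obtain ⟨R, hR, he⟩ := ih2 m' rfl
          have hw : IsAlternating τ U [(v, a)] := .singleton hq1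
          refine ⟨[(v, a)], (some m', a') :: R, by simp, hw, by simp, ?_, ?_⟩
          · exact isAlternating_cons.mpr ⟨hprod _ (by simp) hw, by simp, hR⟩
          · conv_rhs => rw [List.map_cons, List.prod_cons, ← he]
            simp
      · rintro m rfl
        rcases j' with v' | m'
        · obtain ⟨w, R, hw0, hw, hwv, hR, he⟩ := ih1 v' rfl
          refine ⟨(none, (w.map Prod.snd).prod) :: R, ?_, ?_⟩
          · exact isAlternating_cons.mpr ⟨hq1, by simp, hR⟩
          · conv_rhs => rw [List.map_cons, List.prod_cons, ← he]
            simp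
        · obtain ⟨R, hR, he⟩ := ih2 m' rfl
          refine ⟨(some m', a') :: R, ?_, ?_⟩
          · refine isAlternating_cons.mpr ⟨hq1, ?_, hR⟩
            simp only [List.head?_cons, Option.mem_def, Option.some.injEq, forall_eq', ne_eq]
            rintro rfl
            exact hne rfl
          · conv_rhs => rw [List.map_cons, List.prod_cons, ← he]
            simp
  rw [isFree_iff]
  intro L hL ha
  obtain ⟨⟨j, a⟩, L, rfl⟩ := List.exists_cons_of_ne_nil hL
  obtain ⟨h1, h2⟩ := key L _ ha
  rcases j with v | m
  · obtain ⟨w, R, -, -, -, hR, he⟩ := h1 v rfl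
    rw [← he]
    simpa using isFree_iff.mp hS _ (by simp) hR
  · obtain ⟨R, hR, he⟩ := h2 m rfl
    rw [← he]
    simpa using isFree_iff.mp hS _ (by simp) hR

/-- If `p` is free from `T` inside a member `S none` of a free family, then `p` is free from
everything generated by `T` and the other members. -/
theorem IsFree.isFreeFrom_of_none (hS : IsFree τ S) {p : A} {T T' : Set A}
    (hpT : IsFreeFrom τ {p} T) (hp : p ∈ S none) (hT : T ⊆ S none)
    (hT' : ∀ x ∈ T', x ∈ Algebra.adjoin ℂ (T ∪ {a | ∃ m, a ∈ S (some m)})) :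
    IsFreeFrom τ {p} T' := by
  have h1 := hS.refine_none hpT (by
    rintro (_ | _)
    · simpa using Algebra.adjoin_le (S := S none) hT
    · simpa using Algebra.adjoin_le (S := S none) (Set.singleton_subset_iff.mpr hp))
  refine h1.regroup (fun j => j.elim id (fun _ => false)) ?_
  rintro (_ | _)
  · rw [if_neg (by simp)]
    refine Algebra.adjoin_le fun x hx => ?_
    refine Algebra.adjoin_le ?_ (hT' x hx)
    rintro y (hy | ⟨m, hy⟩)
    · exact Algebra.subset_adjoin
        ⟨Sum.inl false, rfl, by simpa using Algebra.subset_adjoin (R := ℂ) hy⟩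
    · exact Algebra.subset_adjoin ⟨Sum.inr m, rfl, hy⟩
  · rw [if_pos rfl]
    exact Algebra.adjoin_mono fun x hx =>
      ⟨Sum.inl true, rfl, by simpa using Algebra.subset_adjoin (R := ℂ) hx⟩

end Refine

end Assoc

/-! ### Chebyshev polynomials and the semicircle law -/

section Semicircle

open Polynomial

/-- Integration of a complex polynomial against the semicircle law. -/
noncomputable def semicircleIntegral : ℂ[X] →ₗ[ℂ] ℂ :=
  Polynomial.lsum fun m => LinearMap.toSpanSingleton ℂ ℂ
    ((∫ x in (-2 : ℝ)..2, x ^ m * (√(4 - x ^ 2) / (2 * Real.pi)) : ℝ) : ℂ)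

theorem semicircleIntegral_X_pow (m : ℕ) : semicircleIntegral (X ^ m) =
    ((∫ x in (-2 : ℝ)..2, x ^ m * (√(4 - x ^ 2) / (2 * Real.pi)) : ℝ) : ℂ) := by
  rw [semicircleIntegral, ← monomial_one_right_eq_X_pow, lsum_apply, sum_monomial_index] <;> simp

theorem semicircleIntegral_map (P : ℝ[X]) : semicircleIntegral (P.map (algebraMap ℝ ℂ)) =
    ((∫ x in (-2 : ℝ)..2, P.eval x * (√(4 - x ^ 2) / (2 * Real.pi)) : ℝ) : ℂ) := by
  induction P using Polynomial.induction_on' with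
  | add P Q hP hQ =>
    rw [Polynomial.map_add, map_add, hP, hQ, ← Complex.ofReal_add,
      ← intervalIntegral.integral_add]
    · simp [add_mul]
    · exact Continuous.intervalIntegrable (by fun_prop) _ _
    · exact Continuous.intervalIntegrable (by fun_prop) _ _
  | monomial m c =>
    rw [map_monomial, ← mul_one (algebraMap ℝ ℂ c), ← smul_eq_mul, ← smul_monomial, map_smul,
      monomial_one_right_eq_X_pow, semicircleIntegral_X_pow]
    simp [mul_assoc, intervalIntegral.integral_const_mul]

/-- The Chebyshev polynomials `S k` are orthogonal to the constants for the semicircle law. -/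
theorem semicircleIntegral_S (k : ℕ) :
    semicircleIntegral (Chebyshev.S ℂ k) = if k = 0 then 1 else 0 := by
  rw [← Chebyshev.map_S (algebraMap ℝ ℂ), semicircleIntegral_map]
  -- The substitution `x = 2y` turns `S k` into `U k`, and the semicircle density into the weight
  -- `1 - y²` times the arcsine density, for which the `T k` are orthogonal.
  have h1 : ∫ x in (-2 : ℝ)..2, (Chebyshev.S ℝ k).eval x * (√(4 - x ^ 2) / (2 * Real.pi)) =
      (2 / Real.pi) * ∫ y in (-1 : ℝ)..1, ((Chebyshev.U ℝ k).eval y * (1 - y ^ 2)) *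
        √(1 - y ^ 2)⁻¹ := by
    have h := intervalIntegral.mul_integral_comp_mul_left
      (f := fun x => (Chebyshev.S ℝ k).eval x * (√(4 - x ^ 2) / (2 * Real.pi)))
      (a := -1) (b := 1) (c := 2)
    norm_num at h
    rw [← h, ← intervalIntegral.integral_const_mul, ← intervalIntegral.integral_const_mul]
    congr 1
    ext y
    have e1 : (Chebyshev.S ℝ k).eval (2 * y) = (Chebyshev.U ℝ k).eval y := by
      rw [← Chebyshev.S_comp_two_mul_X]; simp
    have e2 : √(4 - (2 * y) ^ 2) = 2 * √(1 - y ^ 2) := by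
      rw [show 4 - (2 * y) ^ 2 = 2 ^ 2 * (1 - y ^ 2) by ring, Real.sqrt_mul (by norm_num),
        Real.sqrt_sq (by norm_num)]
    rw [e1, e2]
    rcases le_or_gt (1 - y ^ 2) 0 with h0 | h0
    · simp [Real.sqrt_eq_zero_of_nonpos h0, Real.sqrt_inv]
    · have : (1 - y ^ 2) = √(1 - y ^ 2) * √(1 - y ^ 2) := (Real.mul_self_sqrt h0.le).symm
      have h0' : √(1 - y ^ 2) ≠ 0 := (Real.sqrt_pos.mpr h0).ne'
      rw [Real.sqrt_inv]
      have e3 : (1 - y ^ 2) * (√(1 - y ^ 2))⁻¹ = √(1 - y ^ 2) := by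
        nth_rewrite 1 [this]
        field_simp
      rw [mul_assoc (eval y _), e3]
      field_simp
  have h2 : ∀ y : ℝ, (Chebyshev.U ℝ k).eval y * (1 - y ^ 2) =
      ((Chebyshev.T ℝ k).eval y - (Chebyshev.T ℝ (k + 2)).eval y) / 2 := by
    intro y
    have e1 := congrArg (eval y) (Chebyshev.one_sub_X_sq_mul_U_eq_pol_in_T ℝ k)
    have e2 := congrArg (eval y) (Chebyshev.T_add_two ℝ k)
    simp only [eval_mul, eval_sub, eval_one, eval_pow, eval_X, eval_ofNat] at e1 e2
    linear_combination e1 - e2 / 2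
  rw [h1, ← Chebyshev.integral_measureT]
  simp_rw [h2]
  rw [MeasureTheory.integral_div, MeasureTheory.integral_sub
    (Chebyshev.integrable_measureT (by fun_prop)) (Chebyshev.integrable_measureT (by fun_prop))]
  rw [show ((k : ℤ) + 2) = ((k + 2 : ℕ) : ℤ) by push_cast; rfl,
    Chebyshev.integral_eval_T_real_measureT_of_ne_zero (n := ((k + 2 : ℕ) : ℤ)) (by omega)]
  rcases eq_or_ne k 0 with rfl | hk
  · have := Chebyshev.integral_eval_T_real_measureT_zero
    rw [Nat.cast_zero, this, if_pos rfl]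
    have := Real.pi_ne_zero
    push_cast
    norm_cast
    field_simp
    norm_num
  · rw [Chebyshev.integral_eval_T_real_measureT_of_ne_zero (by exact_mod_cast hk), if_neg hk]
    simp

/-- A linear functional on polynomials is determined by its values on the `S k`. -/
theorem functional_ext_S {f g : ℂ[X] →ₗ[ℂ] ℂ}
    (h : ∀ k : ℕ, f (Chebyshev.S ℂ k) = g (Chebyshev.S ℂ k)) : f = g := by
  have key : ∀ m k : ℕ, f (X ^ m * Chebyshev.S ℂ k) = g (X ^ m * Chebyshev.S ℂ k) := by
    intro m
    induction m with
    | zero => simpa using h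
    | succ m ih =>
      intro k
      rcases k with _ | k
      · have := ih 1
        simpa [pow_succ] using this
      · have e : (X : ℂ[X]) ^ (m + 1) * Chebyshev.S ℂ ((k + 1 : ℕ) : ℤ) =
            X ^ m * Chebyshev.S ℂ ((k + 2 : ℕ) : ℤ) + X ^ m * Chebyshev.S ℂ (k : ℤ) := by
          push_cast
          rw [Chebyshev.S_add_two]; ring
        rw [e, map_add, map_add, ih, ih]
  ext m
  have := key m 0
  simpa [← monomial_one_right_eq_X_pow] using this

end Semicircle

section Cheb

variable {A : Type*} [Ring A] [Algebra ℂ A]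

/-- The Chebyshev polynomials `S k`, normalised by `S₀ = 1`, `S₁ = x`, `S_{k+2} = x S_{k+1} - S_k`,
at an element of an algebra. -/
noncomputable def chebS (a : A) (k : ℕ) : A := Polynomial.aeval a (Polynomial.Chebyshev.S ℂ k)

@[simp] theorem chebS_zero (a : A) : chebS a 0 = 1 := by simp [chebS]

@[simp] theorem chebS_one (a : A) : chebS a 1 = a := by simp [chebS]

theorem chebS_add_two (a : A) (k : ℕ) : chebS a (k + 2) = a * chebS a (k + 1) - chebS a k := by
  simp only [chebS]
  push_cast
  rw [Polynomial.Chebyshev.S_add_two]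
  simp

theorem mul_chebS (a : A) (k : ℕ) : a * chebS a (k + 1) = chebS a (k + 2) + chebS a k := by
  rw [chebS_add_two]; abel

theorem mem_span_chebS {a b : A} (hb : b ∈ Algebra.adjoin ℂ {a}) :
    b ∈ Submodule.span ℂ (Set.range (chebS a)) := by
  have key : ∀ x ∈ Submodule.span ℂ (Set.range (chebS a)),
      b * x ∈ Submodule.span ℂ (Set.range (chebS a)) := by
    induction hb using Algebra.adjoin_induction with
    | mem b hb =>
      obtain rfl := hb
      intro x hx
      induction hx using Submodule.span_induction with
      | zero => simp
      | add x y _ _ hx hy => rw [mul_add]; exact add_mem hx hy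
      | smul c x _ hx => rw [mul_smul_comm]; exact Submodule.smul_mem _ _ hx
      | mem x hx =>
        obtain ⟨k, rfl⟩ := hx
        rcases k with _ | k
        · exact Submodule.subset_span ⟨1, by simp⟩
        · rw [mul_chebS]
          exact add_mem (Submodule.subset_span ⟨_, rfl⟩) (Submodule.subset_span ⟨_, rfl⟩)
    | algebraMap r =>
      intro x hx
      rw [Algebra.algebraMap_eq_smul_one, smul_mul_assoc, one_mul]
      exact Submodule.smul_mem _ _ hx
    | add a b _ _ ha hb => intro x hx; rw [add_mul]; exact add_mem (ha x hx) (hb x hx)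
    | mul a b _ _ ha hb => intro x hx; rw [mul_assoc]; exact ha _ (hb x hx)
  simpa using key 1 (Submodule.subset_span ⟨0, by simp⟩)

/-- The free difference quotient of the Chebyshev polynomial `S k`, namely
`∑ⱼ Sⱼ ⊗ S_{k-1-j}` over `j < k`. -/
noncomputable def diffChebS (a : A) (k : ℕ) : A ⊗[ℂ] A :=
  ∑ j ∈ Finset.range k, chebS a j ⊗ₜ[ℂ] chebS a (k - 1 - j)

/-- The derivative of the recursion `x S_{k+1} = S_{k+2} + S_k`. -/
theorem diffChebS_add_two (a : A) (k : ℕ) :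
    (a ⊗ₜ[ℂ] 1) * diffChebS a (k + 1) + 1 ⊗ₜ[ℂ] chebS a (k + 1) =
      diffChebS a (k + 2) + diffChebS a k := by
  have h1 : (a ⊗ₜ[ℂ] 1) * diffChebS a (k + 1) =
      a ⊗ₜ[ℂ] chebS a k + ∑ j ∈ Finset.range k, (chebS a (j + 2) ⊗ₜ[ℂ] chebS a (k - 1 - j) +
        chebS a j ⊗ₜ[ℂ] chebS a (k - 1 - j)) := by
    rw [diffChebS, Finset.mul_sum, Finset.sum_range_succ']
    simp only [Algebra.TensorProduct.tmul_mul_tmul, one_mul, mul_chebS, TensorProduct.add_tmul,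
      chebS_zero, mul_one, Nat.add_sub_cancel, Nat.sub_zero]
    rw [add_comm]
    congr 1
    refine Finset.sum_congr rfl fun j _ => ?_
    rw [show k - (j + 1) = k - 1 - j by omega]
  have h2 : diffChebS a (k + 2) = 1 ⊗ₜ[ℂ] chebS a (k + 1) + (a ⊗ₜ[ℂ] chebS a k +
      ∑ j ∈ Finset.range k, chebS a (j + 2) ⊗ₜ[ℂ] chebS a (k - 1 - j)) := by
    rw [diffChebS, Finset.sum_range_succ', Finset.sum_range_succ']
    simp only [chebS_zero, zero_add, chebS_one]
    rw [add_comm, add_comm (∑ j ∈ _, _)]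
    congr 2
    refine Finset.sum_congr rfl fun j _ => ?_
    rw [show k + 2 - 1 - (j + 1 + 1) = k - 1 - j by omega]
  rw [h1, h2, Finset.sum_add_distrib, diffChebS]
  abel

end Cheb

section SemicircularElements

variable {A : Type*} [Ring A] [StarRing A] [Algebra ℂ A] [StarModule ℂ A] {τ : TracialState A}

/-- The semicircle law is characterized by the vanishing of the moments of the `S k`, `k ≥ 1`. -/
theorem isSemicircular_iff {s : A} : IsSemicircular τ s ↔
    IsSelfAdjoint s ∧ ∀ k : ℕ, τ (chebS s k) = if k = 0 then 1 else 0 := by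
  refine and_congr_right fun _ => ?_
  have h1 : (∀ m : ℕ, τ (s ^ m) =
      ((∫ x in (-2 : ℝ)..2, x ^ m * (√(4 - x ^ 2) / (2 * Real.pi)) : ℝ) : ℂ)) ↔
      τ.toLinearMap ∘ₗ (Polynomial.aeval (R := ℂ) s).toLinearMap = semicircleIntegral := by
    constructor
    · intro h
      ext m
      have := h m
      rw [← semicircleIntegral_X_pow] at this
      simpa [← Polynomial.monomial_one_right_eq_X_pow, Polynomial.aeval_monomial] using this
    · intro h m
      have := congrArg (fun f : Polynomial ℂ →ₗ[ℂ] ℂ => f (Polynomial.X ^ m)) h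
      simp only [semicircleIntegral_X_pow] at this
      rw [← this]
      simp
  rw [h1]
  constructor
  · intro h k
    rw [← semicircleIntegral_S, ← h]; rfl
  · intro h
    refine functional_ext_S fun k => ?_
    rw [semicircleIntegral_S, ← h k]; rfl

/-- A semicircular element is its own free score. -/
theorem IsSemicircular.isScoreOn {s : A} (hs : IsSemicircular τ s) :
    IsScoreOn τ s ∅ (toL2 τ s) := by
  have hc := (isSemicircular_iff.mp hs).2
  intro a t h
  set V : Submodule ℂ (A × (A ⊗[ℂ] A)) :=
    Submodule.span ℂ (Set.range fun k => (chebS s k, diffChebS s k)) with hV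
  have key : ∀ x ∈ V, leibnizMul (a, t) x ∈ V := by
    clear hs hc
    induction h with
    | scalar r =>
      intro x hx
      have e : ((algebraMap ℂ A r, 0) : A × (A ⊗[ℂ] A)) = r • (1, 0) := by
        ext1 <;> simp [Algebra.algebraMap_eq_smul_one]
      rw [e, smul_leibnizMul, one_leibnizMul]
      exact Submodule.smul_mem _ _ hx
    | var =>
      intro x hx
      induction hx using Submodule.span_induction with
      | zero =>
        have : leibnizMul (s, 1 ⊗ₜ[ℂ] 1) 0 = 0 := by ext1 <;> simp [leibnizMul]
        rw [this]; exact zero_mem _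
      | add x y _ _ hx hy => rw [leibnizMul_add]; exact add_mem hx hy
      | smul c x _ hx => rw [leibnizMul_smul]; exact Submodule.smul_mem _ _ hx
      | mem x hx =>
        obtain ⟨k, rfl⟩ := hx
        rcases k with _ | k
        · refine Submodule.subset_span ⟨1, ?_⟩
          simp [leibnizMul, diffChebS]
        · have e : leibnizMul (s, 1 ⊗ₜ[ℂ] 1) (chebS s (k + 1), diffChebS s (k + 1)) =
              (chebS s (k + 2), diffChebS s (k + 2)) + (chebS s k, diffChebS s k) := by
            rw [leibnizMul, Prod.mk_add_mk, mul_chebS, ← diffChebS_add_two]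
            simp
          dsimp only
          rw [e]
          exact add_mem (Submodule.subset_span ⟨_, rfl⟩) (Submodule.subset_span ⟨_, rfl⟩)
    | mem hg => exact absurd hg (Set.notMem_empty _)
    | add _ _ ha hb =>
      intro x hx
      rw [← Prod.mk_add_mk, add_leibnizMul]
      exact add_mem (ha x hx) (hb x hx)
    | mul _ _ ha hb =>
      intro x hx
      have := ha _ (hb x hx)
      rwa [← leibnizMul_assoc] at this
  have h1 := key (1, 0) (Submodule.subset_span ⟨0, by simp [diffChebS]⟩)
  rw [leibnizMul_one] at h1
  have key2 : ∀ x ∈ V, tensorTrace τ x.2 = τ (s * x.1) := by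
    intro x hx
    induction hx using Submodule.span_induction with
    | zero => simp
    | add x y _ _ hx hy => simp [hx, hy, mul_add]
    | smul c x _ hx => simp [hx]
    | mem x hx =>
      obtain ⟨k, rfl⟩ := hx
      simp only [diffChebS, map_sum, tensorTrace_tmul, hc]
      rcases k with _ | _ | k
      · have := hc 1
        simp at this
        simp [this]
      · have h2 := hc 2
        have h0 := hc 0
        rw [chebS_add_two, map_sub, h0] at h2
        simp at h2
        simp [sub_eq_zero.mp h2]
      · rw [mul_chebS, map_add, hc, hc]
        simp only [Nat.add_eq_zero_iff, one_ne_zero, and_false, if_false, add_zero, and_self,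
          OfNat.ofNat_ne_zero]
        refine Finset.sum_eq_zero fun j hj => ?_
        split_ifs <;> first | (exfalso; omega) | simp
  rw [traceMul_toL2]
  exact key2 _ h1

end SemicircularElements

/-! ### The inner product space of a positive semidefinite kernel -/

section Kernel

variable {W : Type u} {K : Matrix W W ℂ}

/-- Finitely supported functions on `W`, with the semi-inner product `⟪x, y⟫ = ∑ x̄ᵢ Kᵢⱼ yⱼ`. -/
def KernelPre (_hK : K.PosSemidef) : Type u := W →₀ ℂ

namespace KernelPre

variable (hK : K.PosSemidef)

noncomputable instance : AddCommGroup (KernelPre hK) := inferInstanceAs (AddCommGroup (W →₀ ℂ))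
noncomputable instance : Module ℂ (KernelPre hK) := inferInstanceAs (Module ℂ (W →₀ ℂ))

/-- The identity map from finitely supported functions to their copy. -/
noncomputable def of : (W →₀ ℂ) ≃ₗ[ℂ] KernelPre hK := LinearEquiv.refl ℂ (W →₀ ℂ)

/-- The semi-inner product given by the kernel. -/
noncomputable abbrev core : PreInnerProductSpace.Core ℂ (KernelPre hK) where
  inner x y := ((of hK).symm x).sum fun i a => ((of hK).symm y).sum fun j b => star a * K i j * b
  conj_inner_symm f g := by
    rw [Finsupp.sum_comm]
    simp only [map_finsuppSum]
    congr! 6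
    rw [← hK.isHermitian.apply]
    simp only [map_mul, RCLike.star_def, Complex.conj_conj]
    ring
  add_left f g h := by
    rw [map_add, Finsupp.sum_add_index'] <;> simp [← Finsupp.sum_add, add_mul]
  smul_left f g c := by
    rw [map_smul, Finsupp.sum_smul_index] <;> simp [Finsupp.mul_sum, ← mul_assoc]
  re_inner_nonneg f := (Complex.nonneg_iff.mp (hK.2 _)).1

noncomputable instance : SeminormedAddCommGroup (KernelPre hK) :=
  InnerProductSpace.Core.toSeminormedAddCommGroup (c := core hK)
noncomputable instance : InnerProductSpace ℂ (KernelPre hK) :=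
  InnerProductSpace.ofCore (core hK)

end KernelPre

variable (hK : K.PosSemidef)

/-- The inner product space spanned by vectors whose Gram matrix is the given kernel. -/
abbrev KernelSpace : Type u := SeparationQuotient (KernelPre hK)

/-- The spanning vectors of `KernelSpace`. -/
noncomputable def kernelVec (w : W) : KernelSpace hK :=
  SeparationQuotient.mk (KernelPre.of hK (Finsupp.single w 1))

theorem inner_kernelVec (x y : W) : inner ℂ (kernelVec hK x) (kernelVec hK y) = K x y := by
  change (Finsupp.single x (1 : ℂ)).sum (fun i a => (Finsupp.single y (1 : ℂ)).sum
    fun j b => star a * K i j * b) = K x y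
  rw [Finsupp.sum_single_index (by simp), Finsupp.sum_single_index (by simp)]
  simp

theorem span_kernelVec : Submodule.span ℂ (Set.range (kernelVec hK)) = ⊤ := by
  rw [eq_top_iff]
  rintro x -
  obtain ⟨f, rfl⟩ := SeparationQuotient.surjective_mk x
  obtain ⟨f, rfl⟩ := (KernelPre.of hK).surjective f
  induction f using Finsupp.induction_linear with
  | zero => simp
  | add f g hf hg => rw [map_add, SeparationQuotient.mk_add]; exact add_mem hf hg
  | single w c =>
    rw [← mul_one c, ← smul_eq_mul, ← Finsupp.smul_single, map_smul, SeparationQuotient.mk_smul]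
    exact Submodule.smul_mem _ _ (Submodule.subset_span ⟨w, rfl⟩)

end Kernel

section Adjoint

variable {W : Type*} {H : Type*} [NormedAddCommGroup H] [InnerProductSpace ℂ H] {v : W → H}

theorem inner_ext_of_span (hv : Submodule.span ℂ (Set.range v) = ⊤) {x y : H}
    (h : ∀ w, inner ℂ x (v w) = inner ℂ y (v w)) : x = y := by
  refine ext_inner_right ℂ fun z => ?_
  have hz : z ∈ Submodule.span ℂ (Set.range v) := hv ▸ Submodule.mem_top
  induction hz using Submodule.span_induction with
  | zero => simp
  | add a b _ _ ha hb => rw [inner_add_right, inner_add_right, ha, hb]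
  | smul c a _ ha => rw [inner_smul_right, inner_smul_right, ha]
  | mem a ha => obtain ⟨w, rfl⟩ := ha; exact h w

theorem linearMap_ext_of_span (hv : Submodule.span ℂ (Set.range v) = ⊤) {S T : H →ₗ[ℂ] H}
    (h : ∀ w, S (v w) = T (v w)) : S = T :=
  LinearMap.ext_on_range hv h

/-- A map on spanning vectors extends to a linear map as soon as it has a formal adjoint. -/
theorem exists_linearMap_of_adjoint (hv : Submodule.span ℂ (Set.range v) = ⊤) {f g : W → H}
    (h : ∀ x y, inner ℂ (f x) (v y) = inner ℂ (v x) (g y)) :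
    ∃ T : H →ₗ[ℂ] H, ∀ x, T (v x) = f x := by
  set π := Finsupp.linearCombination ℂ v with hπ
  set F := Finsupp.linearCombination ℂ f with hF
  have hFg : ∀ c y, inner ℂ (F c) (v y) = inner ℂ (π c) (g y) := by
    intro c y
    simp only [hF, hπ, Finsupp.linearCombination_apply, Finsupp.sum_inner, inner_smul_left, h]
  have hsurj : LinearMap.range π = ⊤ := by rw [hπ, Finsupp.range_linearCombination, hv]
  have hker : LinearMap.ker π ≤ LinearMap.ker F := by
    intro c hc
    rw [LinearMap.mem_ker] at hc ⊢
    exact inner_ext_of_span hv fun w => by rw [hFg, hc, inner_zero_left, inner_zero_left]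
  refine ⟨(LinearMap.ker π).liftQ F hker ∘ₗ
    (π.quotKerEquivOfSurjective (LinearMap.range_eq_top.mp hsurj)).symm.toLinearMap, fun x => ?_⟩
  have e : v x = π.quotKerEquivOfSurjective (LinearMap.range_eq_top.mp hsurj)
      (Submodule.Quotient.mk (Finsupp.single x 1)) := by
    simp [hπ]
  rw [LinearMap.comp_apply, LinearEquiv.coe_coe, e, LinearEquiv.symm_apply_apply]
  simp [hF]

/-- `T` and `T'` are formal adjoints of each other. -/
def IsAdj (T T' : Module.End ℂ H) : Prop := ∀ x y, inner ℂ (T x) y = inner ℂ x (T' y)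

theorem IsAdj.of_span (hv : Submodule.span ℂ (Set.range v) = ⊤) {T T' : Module.End ℂ H}
    (h : ∀ x y, inner ℂ (T (v x)) (v y) = inner ℂ (v x) (T' (v y))) : IsAdj T T' := by
  intro x y
  have hx : x ∈ Submodule.span ℂ (Set.range v) := hv ▸ Submodule.mem_top
  have hy : y ∈ Submodule.span ℂ (Set.range v) := hv ▸ Submodule.mem_top
  induction hx using Submodule.span_induction with
  | zero => simp
  | add a b _ _ ha hb => rw [map_add, inner_add_left, inner_add_left, ha, hb]
  | smul c a _ ha => rw [map_smul, inner_smul_left, inner_smul_left, ha]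
  | mem a ha =>
    obtain ⟨w, rfl⟩ := ha
    induction hy using Submodule.span_induction with
    | zero => simp
    | add a b _ _ ha hb => rw [map_add, inner_add_right, inner_add_right, ha, hb]
    | smul c a _ ha => rw [map_smul, inner_smul_right, inner_smul_right, ha]
    | mem a ha => obtain ⟨w', rfl⟩ := ha; exact h w w'

theorem IsAdj.symm {T T' : Module.End ℂ H} (h : IsAdj T T') : IsAdj T' T := fun x y => by
  rw [← inner_conj_symm, ← h, inner_conj_symm]

theorem IsAdj.add {T T' S S' : Module.End ℂ H} (h : IsAdj T T') (h' : IsAdj S S') :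
    IsAdj (T + S) (T' + S') := fun x y => by
  rw [LinearMap.add_apply, LinearMap.add_apply, inner_add_left, inner_add_right, h, h']

theorem IsAdj.mul {T T' S S' : Module.End ℂ H} (h : IsAdj T T') (h' : IsAdj S S') :
    IsAdj (T * S) (S' * T') := fun x y => by
  rw [Module.End.mul_apply, Module.End.mul_apply, h, h']

theorem IsAdj.smul {T T' : Module.End ℂ H} (h : IsAdj T T') (c : ℂ) :
    IsAdj (c • T) (star c • T') := fun x y => by
  rw [LinearMap.smul_apply, LinearMap.smul_apply, inner_smul_left, inner_smul_right, h]; rfl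

theorem IsAdj.one : IsAdj (1 : Module.End ℂ H) 1 := fun _ _ => rfl

theorem IsAdj.unique {T T' T'' : Module.End ℂ H} (h : IsAdj T T') (h' : IsAdj T T'') :
    T' = T'' := by
  ext y
  exact ext_inner_left ℂ fun x => by rw [← h, ← h']

end Adjoint

/-! ### Positive semidefinite kernels on words -/

section PosSemidef

variable {W : Type*}

theorem posSemidef_gram_infinite {H : Type*} [SeminormedAddCommGroup H] [InnerProductSpace ℂ H]
    (v : W → H) : (Matrix.of fun x y => inner ℂ (v x) (v y) : Matrix W W ℂ).PosSemidef := by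
  refine ⟨?_, fun c => ?_⟩
  · ext x y
    simp [Matrix.conjTranspose_apply, inner_conj_symm]
  · have e : (c.sum fun i a => c.sum fun j b =>
        star a * (Matrix.of fun x y => inner ℂ (v x) (v y) : Matrix W W ℂ) i j * b) =
        inner ℂ (c.sum fun i a => a • v i) (c.sum fun i a => a • v i) := by
      rw [Finsupp.sum_inner]
      refine Finsupp.sum_congr fun i _ => ?_
      rw [Finsupp.inner_sum]
      refine Finsupp.sum_congr fun j _ => ?_
      rw [inner_smul_left, inner_smul_right, Matrix.of_apply]
      simp only [RCLike.star_def]; ring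
    rw [e, inner_self_eq_norm_sq_to_K]
    positivity

theorem posSemidef_indicator (P : W → Prop) [DecidablePred P] :
    (Matrix.of fun x y => if P x ∧ P y then 1 else 0 : Matrix W W ℂ).PosSemidef := by
  have := posSemidef_gram_infinite (fun x : W => if P x then (1 : ℂ) else 0)
  convert this using 1
  ext x y
  by_cases hx : P x <;> by_cases hy : P y <;> simp [hx, hy]

end PosSemidef

/-! ### Free Fock space -/

section FockKernel

variable {A : Type u} [Ring A] [StarRing A] [Algebra ℂ A] [StarModule ℂ A] (τ : TracialState A)

/-- Words `a₀ e_{i₁} a₁ ⋯ e_{iₘ} aₘ` with letters `aⱼ ∈ A` and indices `iⱼ`, encoded as `a₀` and the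
list of the pairs `(iⱼ, aⱼ)`. -/
abbrev FockWord (A : Type u) (n : ℕ) : Type u := A × List (Fin n × A)

variable {n : ℕ}

/-- The inner product `∏ τ(aⱼ* bⱼ)` of words with the same indices; words with different indices
are orthogonal. -/
def fockKernel : A → List (Fin n × A) → A → List (Fin n × A) → ℂ
  | a, [], b, [] => τ (star a * b)
  | a, (i, a') :: l, b, (j, b') :: m => if i = j then τ (star a * b) * fockKernel a' l b' m else 0
  | _, [], _, _ :: _ => 0
  | _, _ :: _, _, [] => 0

theorem fockKernel_conj (l : List (Fin n × A)) : ∀ (a b : A) (m : List (Fin n × A)),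
    star (fockKernel τ a l b m) = fockKernel τ b m a l := by
  induction l with
  | nil =>
    rintro a b (_ | ⟨⟨j, b'⟩, m⟩)
    · rw [fockKernel, fockKernel, RCLike.star_def, ← τ.map_star, star_mul, star_star]
    · simp [fockKernel]
  | cons q l ih =>
    obtain ⟨i, a'⟩ := q
    rintro a b (_ | ⟨⟨j, b'⟩, m⟩)
    · simp [fockKernel]
    · rw [fockKernel, fockKernel]
      by_cases h : i = j
      · rw [if_pos h, if_pos h.symm, star_mul', ih, RCLike.star_def, ← τ.map_star, star_mul,
          star_star]
      · rw [if_neg h, if_neg (Ne.symm h), star_zero]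

/-- The shift that drops the initial part `a₀ e_{i₁}` of a word; a word without indices is kept, a
value that never matters. -/
def FockWord.tail : FockWord A n → FockWord A n
  | (a, []) => (a, [])
  | (_, (_, b) :: l) => (b, l)

/-- The restriction of the Fock kernel to words of length less than `N`, as a matrix built from
Schur products. -/
noncomputable def fockKernelTrunc : ℕ → Matrix (FockWord A n) (FockWord A n) ℂ
  | 0 => 0
  | N + 1 => Matrix.hadamard (Matrix.of fun x y => inner ℂ (toL2 τ x.1) (toL2 τ y.1))
      ((Matrix.of fun x y => if x.2 = [] ∧ y.2 = [] then 1 else 0) +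
        ∑ i : Fin n, Matrix.hadamard
          (Matrix.of fun x y => if x.2.head?.map Prod.fst = some i ∧
            y.2.head?.map Prod.fst = some i then 1 else 0)
          ((fockKernelTrunc N).submatrix FockWord.tail FockWord.tail))

theorem fockKernelTrunc_posSemidef (N : ℕ) : (fockKernelTrunc (n := n) τ N).PosSemidef := by
  classical
  induction N with
  | zero => exact Matrix.PosSemidef.zero
  | succ N ih =>
    refine Matrix.PosSemidef.hadamard
      (posSemidef_gram_infinite (fun x : FockWord A n => toL2 τ x.1)) ?_
    refine Matrix.PosSemidef.add ?_ ?_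
    · convert posSemidef_indicator (fun x : FockWord A n => x.2 = [])
    · refine Matrix.posSemidef_sum _ fun i _ => Matrix.PosSemidef.hadamard ?_ (ih.submatrix _)
      convert posSemidef_indicator (fun x : FockWord A n => x.2.head?.map Prod.fst = some i)

theorem fockKernelTrunc_apply (N : ℕ) : ∀ x y : FockWord A n, x.2.length < N → y.2.length < N →
    fockKernelTrunc (n := n) τ N x y = fockKernel τ x.1 x.2 y.1 y.2 := by
  induction N with
  | zero => intro x y hx; exact absurd hx (Nat.not_lt_zero _)
  | succ N ih =>
    rintro ⟨a, _ | ⟨⟨i, a'⟩, l⟩⟩ ⟨b, _ | ⟨⟨j, b'⟩, m⟩⟩ hx hy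
    · simp [fockKernelTrunc, fockKernel, inner_toL2, Matrix.sum_apply]
    · simp [fockKernelTrunc, fockKernel, inner_toL2, Matrix.sum_apply]
    · simp [fockKernelTrunc, fockKernel, inner_toL2, Matrix.sum_apply]
    · have := ih (a', l) (b', m) (by simpa using hx) (by simpa using hy)
      simp only [fockKernelTrunc, fockKernel, inner_toL2, Matrix.sum_apply, Matrix.hadamard_apply,
        Matrix.add_apply, Matrix.of_apply, Matrix.submatrix_apply, FockWord.tail, this]
      by_cases h : i = j
      · subst h
        simp [Finset.sum_ite_eq]
      · have : ∀ k : Fin n, ¬ (i = k ∧ j = k) := fun k hk => h (hk.1.trans hk.2.symm)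
        simp [h, this]

/-- The Fock kernel is positive semidefinite, being built from Gram matrices by Schur products. -/
theorem fockKernel_posSemidef : (Matrix.of fun x y : FockWord A n =>
    fockKernel τ x.1 x.2 y.1 y.2).PosSemidef := by
  refine ⟨?_, fun c => ?_⟩
  · ext x y
    exact fockKernel_conj τ _ _ _ _
  · set N := (c.support.sup fun x => x.2.length) + 1 with hN
    have h := (fockKernelTrunc_posSemidef (n := n) τ N).2 c
    convert h using 1
    refine Finsupp.sum_congr fun x hx => Finsupp.sum_congr fun y hy => ?_
    have hlt : ∀ z ∈ c.support, z.2.length < N := fun z hz =>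
      Nat.lt_succ_of_le (Finset.le_sup (f := fun x : FockWord A n => x.2.length) hz)
    rw [fockKernelTrunc_apply τ N x y (hlt x hx) (hlt y hy), Matrix.of_apply]

end FockKernel

/-! ### Left and right operators on the free Fock space -/

section FockOperators

variable {A : Type u} [Ring A] [StarRing A] [Algebra ℂ A] [StarModule ℂ A] (τ : TracialState A)
  (n : ℕ)

/-- The free Fock space over `(A, τ)` with `n` creation operators. -/
abbrev FockSpace : Type u := KernelSpace (fockKernel_posSemidef (n := n) τ)

variable {n}

/-- The vector of the word `a e_{i₁} a₁ ⋯ e_{iₘ} aₘ`. -/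
noncomputable def fockVec (a : A) (l : List (Fin n × A)) : FockSpace τ n :=
  kernelVec (fockKernel_posSemidef (n := n) τ) (a, l)

theorem inner_fockVec (a b : A) (l m : List (Fin n × A)) :
    inner ℂ (fockVec τ a l) (fockVec τ b m) = fockKernel τ a l b m :=
  inner_kernelVec _ _ _

theorem span_fockVec :
    Submodule.span ℂ (Set.range fun w : FockWord A n => fockVec τ w.1 w.2) = ⊤ :=
  span_kernelVec _

theorem fockVec_ext {x y : FockSpace τ n}
    (h : ∀ a l, inner ℂ x (fockVec τ a l) = inner ℂ y (fockVec τ a l)) : x = y :=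
  inner_ext_of_span (span_fockVec τ) fun w => h w.1 w.2

theorem fock_op_ext {S T : Module.End ℂ (FockSpace τ n)}
    (h : ∀ a l, S (fockVec τ a l) = T (fockVec τ a l)) : S = T :=
  linearMap_ext_of_span (span_fockVec τ) fun w => h w.1 w.2

theorem fock_isAdj {T T' : Module.End ℂ (FockSpace τ n)}
    (h : ∀ a l b m, inner ℂ (T (fockVec τ a l)) (fockVec τ b m) =
      inner ℂ (fockVec τ a l) (T' (fockVec τ b m))) : IsAdj T T' :=
  IsAdj.of_span (span_fockVec τ) fun x y => h x.1 x.2 y.1 y.2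

theorem exists_fock_op {f g : FockWord A n → FockSpace τ n}
    (h : ∀ a l b m, inner ℂ (f (a, l)) (fockVec τ b m) = inner ℂ (fockVec τ a l) (g (b, m))) :
    ∃ T : Module.End ℂ (FockSpace τ n), ∀ a l, T (fockVec τ a l) = f (a, l) := by
  obtain ⟨T, hT⟩ := exists_linearMap_of_adjoint (span_fockVec τ) (f := f) (g := g)
    fun x y => h x.1 x.2 y.1 y.2
  exact ⟨T, fun a l => hT (a, l)⟩

theorem fockVec_add (a b : A) (l : List (Fin n × A)) :
    fockVec τ (a + b) l = fockVec τ a l + fockVec τ b l := by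
  refine fockVec_ext τ fun c m => ?_
  rw [inner_add_left, inner_fockVec, inner_fockVec, inner_fockVec]
  rcases l with _ | ⟨⟨i, x⟩, l⟩ <;> rcases m with _ | ⟨⟨j, y⟩, m⟩ <;>
    simp only [fockKernel, star_add, add_mul, map_add, add_zero]
  split_ifs <;> simp

theorem fockVec_smul (r : ℂ) (a : A) (l : List (Fin n × A)) :
    fockVec τ (r • a) l = r • fockVec τ a l := by
  refine fockVec_ext τ fun c m => ?_
  rw [inner_smul_left, inner_fockVec, inner_fockVec]
  rcases l with _ | ⟨⟨i, x⟩, l⟩ <;> rcases m with _ | ⟨⟨j, y⟩, m⟩ <;>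
    simp only [fockKernel, star_smul, smul_mul_assoc, map_smul, smul_eq_mul, mul_zero,
      RCLike.star_def]
  split_ifs <;> simp [mul_assoc]

/-! #### Left multiplication, creation and annihilation -/

theorem fockKernel_mul_left (a b c : A) (l m : List (Fin n × A)) :
    fockKernel τ (a * b) l c m = fockKernel τ b l (star a * c) m := by
  rcases l with _ | ⟨⟨i, x⟩, l⟩ <;> rcases m with _ | ⟨⟨j, y⟩, m⟩ <;>
    simp [fockKernel, mul_assoc]

theorem exists_fockLeft (a : A) : ∃ T : Module.End ℂ (FockSpace τ n),
    ∀ b l, T (fockVec τ b l) = fockVec τ (a * b) l :=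
  exists_fock_op τ (f := fun w => fockVec τ (a * w.1) w.2)
    (g := fun w => fockVec τ (star a * w.1) w.2) fun b l c m => by
      rw [inner_fockVec, inner_fockVec, fockKernel_mul_left]

/-- Left multiplication by an element of `A`. -/
noncomputable def fockLeft (a : A) : Module.End ℂ (FockSpace τ n) := (exists_fockLeft τ a).choose

@[simp] theorem fockLeft_vec (a b : A) (l : List (Fin n × A)) :
    fockLeft τ a (fockVec τ b l) = fockVec τ (a * b) l := (exists_fockLeft τ a).choose_spec b l

theorem fockLeft_isAdj (a : A) : IsAdj (fockLeft (n := n) τ a) (fockLeft τ (star a)) :=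
  fock_isAdj τ fun b l c m => by
    rw [fockLeft_vec, fockLeft_vec, inner_fockVec, inner_fockVec, fockKernel_mul_left]

/-- The value `τ(a₀) a₁ e_{i₂} ⋯` (or `0` if `i₁ ≠ i`) of the left annihilation operator at a word. -/
noncomputable def annVec (i : Fin n) : A → List (Fin n × A) → FockSpace τ n
  | _, [] => 0
  | a, (j, b) :: l => if i = j then τ a • fockVec τ b l else 0

theorem inner_creat_vec (i : Fin n) (b c : A) (l m : List (Fin n × A)) :
    inner ℂ (fockVec τ 1 ((i, b) :: l)) (fockVec τ c m) =
      inner ℂ (fockVec τ b l) (annVec τ i c m) := by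
  rw [inner_fockVec]
  rcases m with _ | ⟨⟨j, d⟩, m⟩
  · simp [fockKernel, annVec]
  · rw [fockKernel, annVec]
    split_ifs
    · rw [inner_smul_right, inner_fockVec, star_one, one_mul]
    · simp

theorem exists_fockCreat (i : Fin n) : ∃ T : Module.End ℂ (FockSpace τ n),
    ∀ b l, T (fockVec τ b l) = fockVec τ 1 ((i, b) :: l) :=
  exists_fock_op τ (f := fun w => fockVec τ 1 ((i, w.1) :: w.2))
    (g := fun w => annVec τ i w.1 w.2) fun b l c m => inner_creat_vec τ i b c l m

theorem exists_fockAnn (i : Fin n) : ∃ T : Module.End ℂ (FockSpace τ n),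
    ∀ b l, T (fockVec τ b l) = annVec τ i b l :=
  exists_fock_op τ (f := fun w => annVec τ i w.1 w.2)
    (g := fun w => fockVec τ 1 ((i, w.1) :: w.2)) fun b l c m => by
      rw [← inner_conj_symm, ← inner_creat_vec, inner_conj_symm]

/-- The left creation operator. -/
noncomputable def fockCreat (i : Fin n) : Module.End ℂ (FockSpace τ n) :=
  (exists_fockCreat τ i).choose

/-- The left annihilation operator. -/
noncomputable def fockAnn (i : Fin n) : Module.End ℂ (FockSpace τ n) :=
  (exists_fockAnn τ i).choose

@[simp] theorem fockCreat_vec (i : Fin n) (b : A) (l : List (Fin n × A)) :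
    fockCreat τ i (fockVec τ b l) = fockVec τ 1 ((i, b) :: l) :=
  (exists_fockCreat τ i).choose_spec b l

@[simp] theorem fockAnn_vec (i : Fin n) (b : A) (l : List (Fin n × A)) :
    fockAnn τ i (fockVec τ b l) = annVec τ i b l :=
  (exists_fockAnn τ i).choose_spec b l

theorem fockCreat_isAdj (i : Fin n) : IsAdj (fockCreat τ i) (fockAnn τ i) :=
  fock_isAdj τ fun b l c m => by rw [fockCreat_vec, fockAnn_vec, inner_creat_vec]

/-! #### Right multiplication, creation and annihilation -/

/-- Right multiplication of a word by an element of `A`. -/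
def rmulWord (b : A) : A → List (Fin n × A) → FockWord A n
  | a, [] => (a * b, [])
  | a, (i, c) :: l => (a, (i, (rmulWord b c l).1) :: (rmulWord b c l).2)

theorem fockKernel_rmulWord (b : A) (l : List (Fin n × A)) : ∀ (a c : A) (m : List (Fin n × A)),
    fockKernel τ (rmulWord b a l).1 (rmulWord b a l).2 c m =
      fockKernel τ a l (rmulWord (star b) c m).1 (rmulWord (star b) c m).2 := by
  induction l with
  | nil =>
    rintro a c (_ | ⟨⟨j, d⟩, m⟩)
    · simp only [rmulWord, fockKernel, star_mul]
      rw [mul_assoc, τ.mul_comm, mul_assoc]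
    · simp [rmulWord, fockKernel]
  | cons q l ih =>
    obtain ⟨i, x⟩ := q
    rintro a c (_ | ⟨⟨j, d⟩, m⟩)
    · simp [rmulWord, fockKernel]
    · simp only [rmulWord, fockKernel, ih]

theorem exists_fockRight (b : A) : ∃ T : Module.End ℂ (FockSpace τ n),
    ∀ a l, T (fockVec τ a l) = fockVec τ (rmulWord b a l).1 (rmulWord b a l).2 :=
  exists_fock_op τ (f := fun w => fockVec τ (rmulWord b w.1 w.2).1 (rmulWord b w.1 w.2).2)
    (g := fun w => fockVec τ (rmulWord (star b) w.1 w.2).1 (rmulWord (star b) w.1 w.2).2)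
    fun a l c m => by rw [inner_fockVec, inner_fockVec, fockKernel_rmulWord]

/-- Right multiplication by an element of `A`. -/
noncomputable def fockRight (b : A) : Module.End ℂ (FockSpace τ n) :=
  (exists_fockRight τ b).choose

@[simp] theorem fockRight_vec (b a : A) (l : List (Fin n × A)) :
    fockRight τ b (fockVec τ a l) = fockVec τ (rmulWord b a l).1 (rmulWord b a l).2 :=
  (exists_fockRight τ b).choose_spec a l

theorem fockRight_isAdj (b : A) : IsAdj (fockRight (n := n) τ b) (fockRight τ (star b)) :=
  fock_isAdj τ fun a l c m => by
    rw [fockRight_vec, fockRight_vec, inner_fockVec, inner_fockVec, fockKernel_rmulWord]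

/-- The right annihilation operator at a word: the coefficient (`τ` of the last letter, or `0`) and the
shortened word. -/
noncomputable def rannWord (j : Fin n) : A → List (Fin n × A) → ℂ × FockWord A n
  | a, [] => (0, (a, []))
  | a, [(i, b)] => (if j = i then τ b else 0, (a, []))
  | a, (i, b) :: q :: l =>
    ((rannWord j b (q :: l)).1,
      (a, (i, (rannWord j b (q :: l)).2.1) :: (rannWord j b (q :: l)).2.2))

theorem fockKernel_rannWord (j : Fin n) (m : List (Fin n × A)) :
    ∀ (a b : A) (l : List (Fin n × A)), fockKernel τ a (l ++ [(j, 1)]) b m =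
      (rannWord τ j b m).1 * fockKernel τ a l (rannWord τ j b m).2.1 (rannWord τ j b m).2.2 := by
  induction m with
  | nil => rintro a b (_ | ⟨⟨i, x⟩, l⟩) <;> simp [rannWord, fockKernel]
  | cons q m ih =>
    obtain ⟨i, d⟩ := q
    rcases m with _ | ⟨q', m⟩
    · rintro a b (_ | ⟨⟨i', x⟩, _ | ⟨⟨i'', x'⟩, l⟩⟩)
      · simp only [List.nil_append, fockKernel, rannWord, star_one, one_mul]
        split_ifs
        · ring
        · simp
      · simp [fockKernel, rannWord]
      · simp [fockKernel, rannWord]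
    · rintro a b (_ | ⟨⟨i', x⟩, l⟩)
      · simp [fockKernel, rannWord]
      · simp only [List.cons_append, fockKernel, rannWord, ih]
        split_ifs
        · ring
        · simp

theorem inner_rcreat_vec (j : Fin n) (a b : A) (l m : List (Fin n × A)) :
    inner ℂ (fockVec τ a (l ++ [(j, 1)])) (fockVec τ b m) = inner ℂ (fockVec τ a l)
      ((rannWord τ j b m).1 • fockVec τ (rannWord τ j b m).2.1 (rannWord τ j b m).2.2) := by
  rw [inner_smul_right, inner_fockVec, inner_fockVec, fockKernel_rannWord]

theorem exists_fockRCreat (j : Fin n) : ∃ T : Module.End ℂ (FockSpace τ n),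
    ∀ b l, T (fockVec τ b l) = fockVec τ b (l ++ [(j, 1)]) :=
  exists_fock_op τ (f := fun w => fockVec τ w.1 (w.2 ++ [(j, 1)]))
    (g := fun w => (rannWord τ j w.1 w.2).1 •
      fockVec τ (rannWord τ j w.1 w.2).2.1 (rannWord τ j w.1 w.2).2.2)
    fun a l b m => inner_rcreat_vec τ j a b l m

theorem exists_fockRAnn (j : Fin n) : ∃ T : Module.End ℂ (FockSpace τ n),
    ∀ b l, T (fockVec τ b l) = (rannWord τ j b l).1 •
      fockVec τ (rannWord τ j b l).2.1 (rannWord τ j b l).2.2 :=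
  exists_fock_op τ (f := fun w => (rannWord τ j w.1 w.2).1 •
      fockVec τ (rannWord τ j w.1 w.2).2.1 (rannWord τ j w.1 w.2).2.2)
    (g := fun w => fockVec τ w.1 (w.2 ++ [(j, 1)])) fun a l b m => by
      rw [← inner_conj_symm, ← inner_rcreat_vec, inner_conj_symm]

/-- The right creation operator. -/
noncomputable def fockRCreat (j : Fin n) : Module.End ℂ (FockSpace τ n) :=
  (exists_fockRCreat τ j).choose

/-- The right annihilation operator. -/
noncomputable def fockRAnn (j : Fin n) : Module.End ℂ (FockSpace τ n) :=
  (exists_fockRAnn τ j).choose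

@[simp] theorem fockRCreat_vec (j : Fin n) (b : A) (l : List (Fin n × A)) :
    fockRCreat τ j (fockVec τ b l) = fockVec τ b (l ++ [(j, 1)]) :=
  (exists_fockRCreat τ j).choose_spec b l

@[simp] theorem fockRAnn_vec (j : Fin n) (b : A) (l : List (Fin n × A)) :
    fockRAnn τ j (fockVec τ b l) = (rannWord τ j b l).1 •
      fockVec τ (rannWord τ j b l).2.1 (rannWord τ j b l).2.2 :=
  (exists_fockRAnn τ j).choose_spec b l

theorem fockRCreat_isAdj (j : Fin n) : IsAdj (fockRCreat τ j) (fockRAnn τ j) :=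
  fock_isAdj τ fun b l c m => by rw [fockRCreat_vec, fockRAnn_vec, inner_rcreat_vec]

/-! #### Left and right operators commute -/

/-- The left semicircular operator `ℓᵢ + ℓᵢ*`. -/
noncomputable def fockZ (i : Fin n) : Module.End ℂ (FockSpace τ n) := fockCreat τ i + fockAnn τ i

/-- The right semicircular operator. -/
noncomputable def fockRZ (j : Fin n) : Module.End ℂ (FockSpace τ n) :=
  fockRCreat τ j + fockRAnn τ j

theorem fockZ_isAdj (i : Fin n) : IsAdj (fockZ τ i) (fockZ τ i) := by
  have := (fockCreat_isAdj τ i).add (fockCreat_isAdj τ i).symm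
  rwa [add_comm (fockAnn τ i)] at this

theorem fockRZ_isAdj (j : Fin n) : IsAdj (fockRZ τ j) (fockRZ τ j) := by
  have := (fockRCreat_isAdj τ j).add (fockRCreat_isAdj τ j).symm
  rwa [add_comm (fockRAnn τ j)] at this

theorem fockRight_commute_left (b a : A) :
    fockRight (n := n) τ b * fockLeft τ a = fockLeft τ a * fockRight τ b :=
  fock_op_ext τ fun c l => by
    rcases l with _ | ⟨⟨i, x⟩, l⟩ <;> simp [rmulWord, mul_assoc]

theorem fockRight_commute_Z (b : A) (i : Fin n) :
    fockRight τ b * fockZ τ i = fockZ τ i * fockRight τ b :=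
  fock_op_ext τ fun c l => by
    rcases l with _ | ⟨⟨j, x⟩, l⟩
    · simp [rmulWord, fockZ, annVec]
    · by_cases h : i = j <;> simp [rmulWord, fockZ, annVec, h]

theorem fockRZ_commute_left (j : Fin n) (a : A) :
    fockRZ τ j * fockLeft τ a = fockLeft τ a * fockRZ τ j :=
  fock_op_ext τ fun c l => by
    rcases l with _ | ⟨⟨i, x⟩, _ | ⟨q, l⟩⟩
    · simp [fockRZ, rannWord]
    · by_cases h : j = i <;> simp [fockRZ, rannWord, h]
    · simp [fockRZ, rannWord]

theorem fockRZ_commute_Z (j i : Fin n) :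
    fockRZ τ j * fockZ τ i = fockZ τ i * fockRZ τ j :=
  fock_op_ext τ fun c l => by
    rcases l with _ | ⟨⟨i', x⟩, _ | ⟨⟨i'', y⟩, l⟩⟩
    · by_cases h : j = i
      · subst h
        simp [fockRZ, fockZ, rannWord, annVec, ← fockVec_smul]
      · simp [fockRZ, fockZ, rannWord, annVec, h, Ne.symm h]
    · by_cases h : i = i' <;> by_cases h' : j = i' <;>
        (simp [fockRZ, fockZ, rannWord, annVec, h, h']; try abel)
    · by_cases h : i = i'
      · simp only [fockRZ, fockZ, Module.End.mul_apply, LinearMap.add_apply, fockCreat_vec,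
          fockAnn_vec, annVec, h, if_true, map_add, map_smul, fockRCreat_vec, fockRAnn_vec,
          rannWord, List.cons_append, smul_add]
        rw [smul_comm (τ c) (rannWord τ j x ((i'', y) :: l)).1]
        abel
      · simp [fockRZ, fockZ, rannWord, annVec, h]

end FockOperators

/-! ### The extension of a noncommutative probability space by free semicircular elements -/

section FockAlgebra

variable {A : Type u} [Ring A] [StarRing A] [Algebra ℂ A] [StarModule ℂ A] (τ : TracialState A)
  (n : ℕ)

/-- The algebra of operators on the Fock space that is generated by left multiplications and left
semicircular operators. -/
noncomputable def fockAlgebra : Subalgebra ℂ (Module.End ℂ (FockSpace τ n)) :=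
  Algebra.adjoin ℂ (Set.range (fockLeft τ) ∪ Set.range (fockZ τ))

/-- The underlying type of `fockAlgebra`. -/
def FockAlg : Type u := fockAlgebra τ n

noncomputable instance : Ring (FockAlg τ n) := inferInstanceAs (Ring (fockAlgebra τ n))
noncomputable instance : Algebra ℂ (FockAlg τ n) := inferInstanceAs (Algebra ℂ (fockAlgebra τ n))

variable {n}

theorem fockLeft_mem (a : A) : fockLeft τ a ∈ fockAlgebra τ n :=
  Algebra.subset_adjoin (Or.inl ⟨a, rfl⟩)

theorem fockZ_mem (i : Fin n) : fockZ τ i ∈ fockAlgebra τ n :=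
  Algebra.subset_adjoin (Or.inr ⟨i, rfl⟩)

theorem commute_fockAlgebra {R : Module.End ℂ (FockSpace τ n)}
    (h1 : ∀ a, R * fockLeft τ a = fockLeft τ a * R) (h2 : ∀ i, R * fockZ τ i = fockZ τ i * R)
    {S : Module.End ℂ (FockSpace τ n)} (hS : S ∈ fockAlgebra τ n) : R * S = S * R := by
  induction hS using Algebra.adjoin_induction with
  | mem S hS => rcases hS with ⟨a, rfl⟩ | ⟨i, rfl⟩ <;> simp [h1, h2]
  | algebraMap r => exact (Algebra.commutes r R).symm
  | add S T _ _ hS hT => rw [mul_add, add_mul, hS, hT]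
  | mul S T _ _ hS hT => rw [← mul_assoc, hS, mul_assoc, hT, mul_assoc]

/-- Every operator `T` in the Fock algebra has an adjoint `T'` there, and a counterpart `R` that
commutes with the algebra and agrees with `T` at the vacuum, as do the adjoints. This is what makes
the vacuum state a trace. -/
theorem exists_adj_and_right {T : Module.End ℂ (FockSpace τ n)} (hT : T ∈ fockAlgebra τ n) :
    ∃ T' ∈ fockAlgebra τ n, ∃ R R' : Module.End ℂ (FockSpace τ n), IsAdj T T' ∧ IsAdj R R' ∧
      (∀ S ∈ fockAlgebra τ n, R * S = S * R) ∧ (∀ S ∈ fockAlgebra τ n, R' * S = S * R') ∧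
      R (fockVec τ 1 []) = T (fockVec τ 1 []) ∧ R' (fockVec τ 1 []) = T' (fockVec τ 1 []) := by
  induction hT using Algebra.adjoin_induction with
  | mem T hT =>
    rcases hT with ⟨a, rfl⟩ | ⟨i, rfl⟩
    · refine ⟨_, fockLeft_mem τ (star a), fockRight τ a, fockRight τ (star a),
        fockLeft_isAdj τ a, fockRight_isAdj τ a, fun S hS => ?_, fun S hS => ?_, ?_, ?_⟩
      · exact commute_fockAlgebra τ (fockRight_commute_left τ a) (fockRight_commute_Z τ a) hS
      · exact commute_fockAlgebra τ (fockRight_commute_left τ _) (fockRight_commute_Z τ _) hS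
      · simp [rmulWord]
      · simp [rmulWord]
    · have hc : ∀ S ∈ fockAlgebra τ n, fockRZ τ i * S = S * fockRZ τ i := fun S hS =>
        commute_fockAlgebra τ (fockRZ_commute_left τ i) (fockRZ_commute_Z τ i) hS
      have hΩ : fockRZ τ i (fockVec τ 1 []) = fockZ τ i (fockVec τ 1 []) := by
        simp [fockRZ, fockZ, rannWord, annVec]
      exact ⟨_, fockZ_mem τ i, fockRZ τ i, fockRZ τ i, fockZ_isAdj τ i, fockRZ_isAdj τ i, hc, hc,
        hΩ, hΩ⟩
  | algebraMap r =>
    refine ⟨algebraMap ℂ _ (star r), Subalgebra.algebraMap_mem _ _, algebraMap ℂ _ r,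
      algebraMap ℂ _ (star r), ?_, ?_, fun S _ => Algebra.commutes _ _,
      fun S _ => Algebra.commutes _ _, rfl, rfl⟩ <;>
    · rw [Algebra.algebraMap_eq_smul_one, Algebra.algebraMap_eq_smul_one]
      exact IsAdj.one.smul r
  | add T S _ _ hT hS =>
    obtain ⟨T', hT', R, R', h1, h2, h3, h4, h5, h6⟩ := hT
    obtain ⟨S', hS', Q, Q', k1, k2, k3, k4, k5, k6⟩ := hS
    refine ⟨T' + S', add_mem hT' hS', R + Q, R' + Q', h1.add k1, h2.add k2, fun U hU => ?_,
      fun U hU => ?_, ?_, ?_⟩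
    · rw [add_mul, mul_add, h3 U hU, k3 U hU]
    · rw [add_mul, mul_add, h4 U hU, k4 U hU]
    · rw [LinearMap.add_apply, LinearMap.add_apply, h5, k5]
    · rw [LinearMap.add_apply, LinearMap.add_apply, h6, k6]
  | mul T S hTm hSm hT hS =>
    obtain ⟨T', hT', R, R', h1, h2, h3, h4, h5, h6⟩ := hT
    obtain ⟨S', hS', Q, Q', k1, k2, k3, k4, k5, k6⟩ := hS
    refine ⟨S' * T', mul_mem hS' hT', Q * R, R' * Q', h1.mul k1, k2.mul h2, fun U hU => ?_,
      fun U hU => ?_, ?_, ?_⟩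
    · rw [mul_assoc, h3 U hU, ← mul_assoc, k3 U hU, mul_assoc]
    · rw [mul_assoc, k4 U hU, ← mul_assoc, h4 U hU, mul_assoc]
    · rw [Module.End.mul_apply, Module.End.mul_apply, h5, ← k5, ← Module.End.mul_apply,
        ← Module.End.mul_apply, k3 T hTm]
    · rw [Module.End.mul_apply, Module.End.mul_apply, k6, ← h6, ← Module.End.mul_apply,
        ← Module.End.mul_apply, h4 S' hS']

namespace FockAlg

/-- The operator underlying an element of the Fock algebra. -/
noncomputable def op : FockAlg τ n →ₐ[ℂ] Module.End ℂ (FockSpace τ n) := (fockAlgebra τ n).val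

variable {τ}

theorem op_injective : Function.Injective (op (n := n) τ) := Subtype.val_injective

theorem op_mem (T : FockAlg τ n) : op τ T ∈ fockAlgebra τ n := T.2

theorem exists_star (T : FockAlg τ n) : ∃ T' : FockAlg τ n, IsAdj (op τ T) (op τ T') := by
  obtain ⟨T', hT', -, -, h, -⟩ := exists_adj_and_right τ T.2
  exact ⟨⟨T', hT'⟩, h⟩

noncomputable instance : Star (FockAlg τ n) := ⟨fun T => (exists_star T).choose⟩

theorem isAdj_star (T : FockAlg τ n) : IsAdj (op τ T) (op τ (star T)) :=
  (exists_star T).choose_spec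

theorem star_eq_of_isAdj {T T' : FockAlg τ n} (h : IsAdj (op τ T) (op τ T')) : star T = T' :=
  op_injective ((isAdj_star T).unique h)

noncomputable instance : StarRing (FockAlg τ n) where
  star_involutive T := star_eq_of_isAdj (isAdj_star T).symm
  star_mul S T := star_eq_of_isAdj (by
    rw [map_mul, map_mul]; exact (isAdj_star S).mul (isAdj_star T))
  star_add S T := star_eq_of_isAdj (by
    rw [map_add, map_add]; exact (isAdj_star S).add (isAdj_star T))

instance : StarModule ℂ (FockAlg τ n) where
  star_smul c T := star_eq_of_isAdj (by
    rw [map_smul, map_smul]; exact (isAdj_star T).smul c)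

variable (τ n) in
/-- The vacuum state, which is a trace on the Fock algebra. -/
noncomputable def vacuum : TracialState (FockAlg τ n) where
  toLinearMap := (innerₛₗ ℂ (fockVec τ 1 [])) ∘ₗ LinearMap.applyₗ (fockVec τ 1 []) ∘ₗ
    (op τ).toLinearMap
  map_one' := by
    change inner ℂ (fockVec τ 1 []) (op (n := n) τ 1 (fockVec τ 1 [])) = 1
    rw [map_one, Module.End.one_apply, inner_fockVec, fockKernel, star_one, mul_one, τ.map_one']
  map_mul_comm' S T := by
    change inner ℂ (fockVec τ 1 []) (op (n := n) τ (S * T) (fockVec τ 1 [])) =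
      inner ℂ (fockVec τ 1 []) (op (n := n) τ (T * S) (fockVec τ 1 []))
    obtain ⟨S', -, R, R', h1, h2, h3, -, h5, h6⟩ := exists_adj_and_right τ (op_mem S)
    rw [map_mul, map_mul, Module.End.mul_apply, ← h1.symm, ← h6, h2.symm, ← Module.End.mul_apply,
      h3 _ (op_mem T), Module.End.mul_apply, h5, Module.End.mul_apply]
  nonneg' T := by
    change 0 ≤ inner ℂ (fockVec τ 1 []) (op (n := n) τ (star T * T) (fockVec τ 1 []))
    rw [map_mul, Module.End.mul_apply, ← isAdj_star, inner_self_eq_norm_sq_to_K]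
    positivity

theorem vacuum_apply (T : FockAlg τ n) :
    vacuum τ n T = inner ℂ (fockVec τ 1 []) (op τ T (fockVec τ 1 [])) := rfl

variable (τ n) in
/-- The embedding of the given algebra by left multiplications. -/
noncomputable def incl : A →⋆ₐ[ℂ] FockAlg τ n where
  toFun a := ⟨fockLeft τ a, fockLeft_mem τ a⟩
  map_one' := op_injective (fock_op_ext τ fun b l => by
    change fockLeft τ 1 _ = _; simp [map_one])
  map_mul' a b := op_injective (fock_op_ext τ fun c l => by
    change fockLeft τ (a * b) _ = fockLeft τ a (fockLeft τ b _); simp [mul_assoc])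
  map_zero' := op_injective (fock_op_ext τ fun c l => by
    change fockLeft τ 0 _ = (0 : Module.End ℂ (FockSpace τ n)) _
    rw [fockLeft_vec, zero_mul, ← zero_smul ℂ (1 : A), fockVec_smul]; simp)
  map_add' a b := op_injective (fock_op_ext τ fun c l => by
    change fockLeft τ (a + b) _ = fockLeft τ a _ + fockLeft τ b _
    simp [add_mul, fockVec_add])
  commutes' r := op_injective (fock_op_ext τ fun c l => by
    rw [AlgHom.commutes]
    change fockLeft τ (algebraMap ℂ A r) _ = _
    simp [Algebra.algebraMap_eq_smul_one, fockVec_smul])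
  map_star' a := (star_eq_of_isAdj (fockLeft_isAdj τ a)).symm

@[simp] theorem op_incl (a : A) : op τ (incl τ n a) = fockLeft τ a := rfl

theorem vacuum_incl (a : A) : vacuum τ n (incl τ n a) = τ a := by
  rw [vacuum_apply, op_incl, fockLeft_vec, inner_fockVec, fockKernel, star_one, one_mul, mul_one]

variable (τ) in
/-- The semicircular elements of the Fock algebra. -/
noncomputable def Z (i : Fin n) : FockAlg τ n := ⟨fockZ τ i, fockZ_mem τ i⟩

@[simp] theorem op_Z (i : Fin n) : op τ (Z τ i) = fockZ τ i := rfl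

theorem Z_isSelfAdjoint (i : Fin n) : IsSelfAdjoint (Z τ i) :=
  star_eq_of_isAdj (fockZ_isAdj τ i)

theorem ann_creat (i : Fin n) (x : FockSpace τ n) : fockAnn τ i (fockCreat τ i x) = x := by
  have : fockAnn τ i * fockCreat τ i = 1 := fock_op_ext τ fun b l => by
    simp only [Module.End.mul_apply, fockCreat_vec, fockAnn_vec, annVec, if_true,
      Module.End.one_apply]
    rw [τ.map_one', one_smul]
  exact congrArg (fun T : Module.End ℂ (FockSpace τ n) => T x) this

/-- Chebyshev polynomials turn powers of the semicircular operator into powers of the creation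
operator, at vectors killed by the annihilation operator. -/
theorem chebS_Z_apply (i : Fin n) {x : FockSpace τ n} (hx : fockAnn τ i x = 0) (k : ℕ) :
    op τ (chebS (Z τ i) k) x = (fockCreat τ i ^ k) x := by
  induction k using Nat.twoStepInduction with
  | zero => simp
  | one => simp [fockZ, hx]
  | more k ih1 ih2 =>
    rw [chebS_add_two, map_sub, map_mul, LinearMap.sub_apply, Module.End.mul_apply, ih1, ih2, op_Z,
      fockZ, LinearMap.add_apply, pow_succ' _ k, Module.End.mul_apply, ann_creat,
      pow_succ' _ (k + 1), pow_succ' _ k, Module.End.mul_apply, Module.End.mul_apply]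
    abel

theorem inner_vac_creat (i : Fin n) (x : FockSpace τ n) :
    inner ℂ (fockVec τ 1 []) (fockCreat τ i x) = 0 := by
  rw [← (fockCreat_isAdj τ i).symm, fockAnn_vec, annVec, inner_zero_left]

theorem vacuum_chebS (i : Fin n) (k : ℕ) :
    vacuum τ n (chebS (Z τ i) k) = if k = 0 then 1 else 0 := by
  rw [vacuum_apply, chebS_Z_apply i (by simp [annVec])]
  rcases k with _ | k
  · rw [pow_zero, Module.End.one_apply, inner_fockVec, fockKernel, star_one, mul_one, τ.map_one',
      if_pos rfl]
  · rw [pow_succ', Module.End.mul_apply, inner_vac_creat]; simp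

theorem Z_isSemicircular (i : Fin n) : IsSemicircular (vacuum τ n) (Z τ i) :=
  isSemicircular_iff.mpr ⟨Z_isSelfAdjoint i, vacuum_chebS i⟩

variable (τ n) in
/-- The span of the words that begin with a centred letter from `A`. -/
noncomputable def centredSpan : Submodule ℂ (FockSpace τ n) :=
  Submodule.span ℂ {x | ∃ (a : A) (l : List (Fin n × A)), τ a = 0 ∧ x = fockVec τ a l}

theorem inner_vac_centredSpan {x : FockSpace τ n} (hx : x ∈ centredSpan τ n) :
    inner ℂ (fockVec τ 1 []) x = 0 := by
  induction hx using Submodule.span_induction with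
  | zero => simp
  | add x y _ _ hx hy => rw [inner_add_right, hx, hy, add_zero]
  | smul c x _ hx => rw [inner_smul_right, hx, mul_zero]
  | mem x hx =>
    obtain ⟨a, l, ha, rfl⟩ := hx
    rw [inner_fockVec]
    rcases l with _ | ⟨q, l⟩ <;> simp [fockKernel, ha]

theorem ann_centredSpan (i : Fin n) {x : FockSpace τ n} (hx : x ∈ centredSpan τ n) :
    fockAnn τ i x = 0 := by
  induction hx using Submodule.span_induction with
  | zero => simp
  | add x y _ _ hx hy => rw [map_add, hx, hy, add_zero]
  | smul c x _ hx => rw [map_smul, hx, smul_zero]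
  | mem x hx =>
    obtain ⟨a, l, ha, rfl⟩ := hx
    rcases l with _ | ⟨⟨j, b⟩, l⟩ <;> simp [annVec, ha]

theorem left_creat_mem (i : Fin n) {a : A} (ha : τ a = 0) (x : FockSpace τ n) :
    fockLeft τ a (fockCreat τ i x) ∈ centredSpan τ n := by
  have hx : x ∈ Submodule.span ℂ (Set.range fun w : FockWord A n => fockVec τ w.1 w.2) :=
    span_fockVec τ ▸ Submodule.mem_top
  induction hx using Submodule.span_induction with
  | zero => simp
  | add x y _ _ hx hy => rw [map_add, map_add]; exact add_mem hx hy
  | smul c x _ hx => rw [map_smul, map_smul]; exact Submodule.smul_mem _ _ hx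
  | mem x hx =>
    obtain ⟨⟨b, l⟩, rfl⟩ := hx
    exact Submodule.subset_span ⟨a, (i, b) :: l, ha, by simp⟩

theorem ann_creat_of_ne {i j : Fin n} (h : i ≠ j) (x : FockSpace τ n) :
    fockAnn τ i (fockCreat τ j x) = 0 := by
  have : fockAnn τ i * fockCreat τ j = 0 := fock_op_ext τ fun b l => by simp [annVec, h]
  exact congrArg (fun T : Module.End ℂ (FockSpace τ n) => T x) this

/-- A centred polynomial in a semicircular element is a combination of the `S k` with `k ≥ 1`. -/
theorem mem_span_chebS_of_centred {i : Fin n} {T : FockAlg τ n}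
    (hT : T ∈ Algebra.adjoin ℂ {Z τ i}) (h0 : vacuum τ n T = 0) :
    T ∈ Submodule.span ℂ (Set.range fun k => chebS (Z τ i) (k + 1)) := by
  have h1 : T ∈ Submodule.span ℂ (Set.range fun k => chebS (Z τ i) (k + 1)) ⊔
      Submodule.span ℂ {1} := by
    refine (Submodule.span_le.mpr ?_) (mem_span_chebS hT)
    rintro _ ⟨k, rfl⟩
    rcases k with _ | k
    · exact Submodule.mem_sup_right (by simp [Submodule.mem_span_singleton_self])
    · exact Submodule.mem_sup_left (Submodule.subset_span ⟨k, rfl⟩)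
  obtain ⟨y, hy, z, hz, rfl⟩ := Submodule.mem_sup.mp h1
  obtain ⟨c, rfl⟩ := Submodule.mem_span_singleton.mp hz
  have hle : Submodule.span ℂ (Set.range fun k => chebS (Z τ i) (k + 1)) ≤
      LinearMap.ker (vacuum τ n).toLinearMap := by
    refine Submodule.span_le.mpr ?_
    rintro _ ⟨k, rfl⟩
    exact (vacuum_chebS i (k + 1)).trans (if_neg (Nat.succ_ne_zero k))
  have hy1 : vacuum τ n y = 0 := hle hy
  rw [map_add, hy1, map_smul, (vacuum τ n).map_one', zero_add, smul_eq_mul, mul_one] at h0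
  simpa [h0] using hy

variable (τ n) in
/-- The subspace that alternating centred words starting in a given algebra map the vacuum to:
words beginning with a centred letter for `A` itself, and the range of `ℓᵢ` for `Alg(Zᵢ)`. -/
noncomputable def headSpace (j : Option (Fin n)) : Submodule ℂ (FockSpace τ n) :=
  j.elim (centredSpan τ n) fun i => LinearMap.range (fockCreat τ i)

theorem inner_vac_headSpace (j : Option (Fin n)) {x : FockSpace τ n} (hx : x ∈ headSpace τ n j) :
    inner ℂ (fockVec τ 1 []) x = 0 := by
  rcases j with _ | i
  · exact inner_vac_centredSpan hx
  · obtain ⟨y, rfl⟩ := hx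
    exact inner_vac_creat i y

/-- In the Fock algebra the given algebra and the semicircular elements are free. -/
theorem isFree : IsFree (vacuum τ n) (fun j : Option (Fin n) =>
    j.elim (incl τ n).toAlgHom.range fun i => Algebra.adjoin ℂ {Z τ i}) := by
  set S : Option (Fin n) → Subalgebra ℂ (FockAlg τ n) := fun j =>
    j.elim (incl τ n).toAlgHom.range fun i => Algebra.adjoin ℂ {Z τ i} with hS
  have step : ∀ (q : Option (Fin n) × FockAlg τ n) (x : FockSpace τ n), q.2 ∈ S q.1 →
      vacuum τ n q.2 = 0 → (x = fockVec τ 1 [] ∨ ∃ j, q.1 ≠ j ∧ x ∈ headSpace τ n j) →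
      op τ q.2 x ∈ headSpace τ n q.1 := by
    rintro ⟨_ | i, T⟩ x hT h0 hx
    · obtain ⟨a, rfl⟩ := hT
      change vacuum τ n (incl τ n a) = 0 at h0
      rw [vacuum_incl] at h0
      change fockLeft τ a x ∈ centredSpan τ n
      rcases hx with rfl | ⟨_ | j, hj, hx⟩
      · exact Submodule.subset_span ⟨a, [], h0, by simp⟩
      · exact absurd rfl hj
      · obtain ⟨y, rfl⟩ := hx
        exact left_creat_mem j h0 y
    · have hann : fockAnn τ i x = 0 := by
        rcases hx with rfl | ⟨_ | j, hj, hx⟩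
        · simp [annVec]
        · exact ann_centredSpan i hx
        · obtain ⟨y, rfl⟩ := hx
          exact ann_creat_of_ne (fun h => hj (by rw [h])) y
      have hle : Submodule.span ℂ (Set.range fun k => chebS (Z τ i) (k + 1)) ≤
          (LinearMap.range (fockCreat τ i)).comap
            (LinearMap.applyₗ x ∘ₗ (op τ).toLinearMap) := by
        refine Submodule.span_le.mpr ?_
        rintro _ ⟨k, rfl⟩
        refine ⟨(fockCreat τ i ^ k) x, ?_⟩
        change _ = op τ (chebS (Z τ i) (k + 1)) x
        rw [chebS_Z_apply i hann, pow_succ', Module.End.mul_apply]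
      exact hle (mem_span_chebS_of_centred hT h0)
  have key : ∀ (L : List (Option (Fin n) × FockAlg τ n)) (q : Option (Fin n) × FockAlg τ n),
      IsAlternating (vacuum τ n) S (q :: L) →
      op τ ((q :: L).map Prod.snd).prod (fockVec τ 1 []) ∈ headSpace τ n q.1 := by
    intro L
    induction L with
    | nil =>
      intro q hq
      rw [isAlternating_cons] at hq
      simpa using step q _ hq.1.1 hq.1.2 (Or.inl rfl)
    | cons q' L ih =>
      intro q hq
      rw [isAlternating_cons] at hq
      rw [List.map_cons, List.prod_cons, map_mul, Module.End.mul_apply]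
      exact step q _ hq.1.1 hq.1.2 (Or.inr ⟨q'.1, hq.2.1 q' (by simp), ih q' hq.2.2⟩)
  rw [isFree_iff]
  intro L hL ha
  obtain ⟨q, L, rfl⟩ := List.exists_cons_of_ne_nil hL
  rw [vacuum_apply]
  exact inner_vac_headSpace q.1 (key L q ha)

end FockAlg

end FockAlgebra

/-! ### Schwinger–Dyson equations determine the joint law -/

section Law

variable {A : Type*} [Ring A] [StarRing A] [Algebra ℂ A] [StarModule ℂ A] {ι : Type*}

open Classical in
/-- The splittings `w = u i v` of a word `w` at the occurrences of the letter `i`. -/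
noncomputable def splits (i : ι) : List ι → List (List ι × List ι)
  | [] => []
  | j :: w => (if j = i then [([], w)] else []) ++ (splits i w).map fun q => (j :: q.1, q.2)

theorem length_of_mem_splits {i : ι} {w : List ι} {q : List ι × List ι} (hq : q ∈ splits i w) :
    q.1.length + q.2.length < w.length := by
  induction w generalizing q with
  | nil => simp [splits] at hq
  | cons j w ih =>
    rw [splits, List.mem_append, List.mem_map] at hq
    rcases hq with hq | ⟨q', hq', rfl⟩
    · split_ifs at hq
      · obtain rfl := List.mem_singleton.mp hq
        simp
      · simp at hq
    · have := ih hq'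
      simp only [List.length_cons]
      omega

/-- The free difference quotient of a word is the sum of its splittings `u ⊗ v`. -/
theorem diffGraph_word (v : ι → A) (i : ι) (w : List ι) :
    DiffGraph (v i) (v '' {j | j ≠ i}) (w.map v).prod
      ((splits i w).map fun q => (q.1.map v).prod ⊗ₜ[ℂ] (q.2.map v).prod).sum := by
  induction w with
  | nil => simpa [splits] using DiffGraph.scalar (X := v i) (G := v '' {j | j ≠ i}) 1
  | cons j w ih =>
    have e : (v j ⊗ₜ[ℂ] (1 : A)) *
        ((splits i w).map fun q => (q.1.map v).prod ⊗ₜ[ℂ] (q.2.map v).prod).sum =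
        (((splits i w).map fun q => (j :: q.1, q.2)).map
          fun q => (q.1.map v).prod ⊗ₜ[ℂ] (q.2.map v).prod).sum := by
      rw [← List.sum_map_mul_left, List.map_map]
      simp [Function.comp_def]
    rw [List.map_cons, List.prod_cons, splits, List.map_append, List.sum_append, ← e]
    by_cases h : j = i
    · subst h
      have := DiffGraph.mul .var ih
      rw [add_comm] at this
      simpa using this
    · have := (DiffGraph.mem (X := v i) (G := v '' {j | j ≠ i}) (g := v j) ⟨j, h, rfl⟩).mul ih
      simpa [h] using this

variable {A' : Type*} [Ring A'] [StarRing A'] [Algebra ℂ A'] [StarModule ℂ A']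
  {τ : TracialState A} {τ' : TracialState A'} {n : ℕ}

/-- The equations `τ(Zᵢ P) = (τ ⊗ τ)(∂_{Zᵢ} P)` determine the joint moments of `X` and `Z` from
those of `X`: by the trace property a letter `Zᵢ` may be moved to the front, and the equation
expresses the moment through shorter ones. -/
theorem moments_eq_of_schwingerDyson {κ μ : Type*} {v : κ ⊕ μ → A} {v' : κ ⊕ μ → A'}
    (hX : ∀ w : List κ, τ (w.map (v ∘ Sum.inl)).prod = τ' (w.map (v' ∘ Sum.inl)).prod)
    (hZ : ∀ i a t, DiffGraph (v (.inr i)) (v '' {j | j ≠ .inr i}) a t →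
      tensorTrace τ t = τ (v (.inr i) * a))
    (hZ' : ∀ i a t, DiffGraph (v' (.inr i)) (v' '' {j | j ≠ .inr i}) a t →
      tensorTrace τ' t = τ' (v' (.inr i) * a)) (N : ℕ) :
    ∀ w : List (κ ⊕ μ), w.length < N → τ (w.map v).prod = τ' (w.map v').prod := by
  induction N with
  | zero => intro w hw; exact absurd hw (Nat.not_lt_zero _)
  | succ N ih =>
    intro w hw
    by_cases h : ∃ i, Sum.inr i ∈ w
    · obtain ⟨i, hi⟩ := h
      obtain ⟨a, b, rfl⟩ := List.append_of_mem hi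
      have e : τ ((a ++ Sum.inr i :: b).map v).prod = τ (v (.inr i) * ((b ++ a).map v).prod) := by
        simp only [List.map_append, List.map_cons, List.prod_append, List.prod_cons]
        rw [τ.mul_comm, mul_assoc]
      have e' : τ' ((a ++ Sum.inr i :: b).map v').prod =
          τ' (v' (.inr i) * ((b ++ a).map v').prod) := by
        simp only [List.map_append, List.map_cons, List.prod_append, List.prod_cons]
        rw [τ'.mul_comm, mul_assoc]
      rw [e, e', ← hZ i _ _ (diffGraph_word v (.inr i) (b ++ a)),
        ← hZ' i _ _ (diffGraph_word v' (.inr i) (b ++ a)), map_list_sum, map_list_sum,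
        List.map_map, List.map_map]
      congr 1
      refine List.map_congr_left fun q hq => ?_
      have hlen := length_of_mem_splits hq
      simp only [List.length_append, List.length_cons] at hlen hw
      simp only [Function.comp_apply, tensorTrace_tmul]
      rw [ih q.1 (by omega), ih q.2 (by omega)]
    · have hw' : ∃ u : List κ, w = u.map Sum.inl := by
        refine ⟨w.filterMap Sum.getLeft?, ?_⟩
        clear hw
        induction w with
        | nil => rfl
        | cons j w ihw =>
          rcases j with j | j
          · simp only [List.filterMap_cons, Sum.getLeft?_inl, List.map_cons, List.cons.injEq,
              true_and]
            exact ihw fun ⟨i, hi⟩ => h ⟨i, List.mem_cons_of_mem _ hi⟩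
          · exact absurd ⟨j, by simp⟩ h
      obtain ⟨u, rfl⟩ := hw'
      rw [List.map_map, List.map_map]
      exact hX u

/-- Equality of the moments of all words extends to all noncommutative polynomials. -/
theorem law_eq_of_moments {v : ι → A} {v' : ι → A'}
    (h : ∀ w : List ι, τ (w.map v).prod = τ' (w.map v').prod) (P : FreeAlgebra ℂ ι) :
    τ (FreeAlgebra.lift ℂ v P) = τ' (FreeAlgebra.lift ℂ v' P) := by
  have hP : P ∈ Algebra.adjoin ℂ (Set.range (FreeAlgebra.ι ℂ : ι → FreeAlgebra ℂ ι)) := by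
    rw [FreeAlgebra.adjoin_range_ι]; exact Algebra.mem_top
  rw [← Subalgebra.mem_toSubmodule, Algebra.adjoin_eq_span] at hP
  induction hP using Submodule.span_induction with
  | zero => simp
  | add x y _ _ hx hy => simp only [map_add, hx, hy]
  | smul c x _ hx => simp only [map_smul, hx]
  | mem x hx =>
    obtain ⟨l, hl, rfl⟩ := Submonoid.exists_list_of_mem_closure hx
    have hl' : ∃ w : List ι, l = w.map (FreeAlgebra.ι ℂ) := by
      clear hx
      induction l with
      | nil => exact ⟨[], rfl⟩
      | cons a l ih =>
        obtain ⟨w, rfl⟩ := ih fun y hy => hl y (List.mem_cons_of_mem _ hy)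
        obtain ⟨j, rfl⟩ := hl a (by simp)
        exact ⟨j :: w, rfl⟩
    obtain ⟨w, rfl⟩ := hl'
    rw [map_list_prod (FreeAlgebra.lift ℂ v), map_list_prod (FreeAlgebra.lift ℂ v'), List.map_map,
      List.map_map]
    simpa [Function.comp_def] using h w

/-- Freeness is preserved by trace-preserving homomorphisms. -/
theorem IsFree.map {κ : Type*} {U : κ → Subalgebra ℂ A} (hU : IsFree τ U) (f : A →ₐ[ℂ] A')
    (hf : ∀ a, τ' (f a) = τ a) : IsFree τ' (fun j => (U j).map f) := by
  have key : ∀ l : List (κ × A'), IsAlternating τ' (fun j => (U j).map f) l →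
      ∃ l' : List (κ × A), IsAlternating τ U l' ∧ l = l'.map (Prod.map id f) := by
    intro l
    induction l with
    | nil => exact fun _ => ⟨[], .nil, rfl⟩
    | cons q l ih =>
      intro h
      rw [isAlternating_cons] at h
      obtain ⟨⟨⟨a, ha, haq⟩, h0⟩, hh, hl⟩ := h
      obtain ⟨l', hl', rfl⟩ := ih hl
      obtain ⟨j, b⟩ := q
      obtain rfl : f a = b := haq
      refine ⟨(j, a) :: l', isAlternating_cons.mpr ⟨⟨ha, ?_⟩, fun r hr => ?_, hl'⟩, rfl⟩
      · rw [← hf]; exact h0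
      · have := hh (Prod.map id f r) (by
          rw [List.head?_map]; exact Option.map_eq_some_iff.mpr ⟨r, hr, rfl⟩)
        simpa using this
  rw [isFree_iff]
  intro l hl ha
  obtain ⟨l', hl', rfl⟩ := key l ha
  have e : ((l'.map (Prod.map id f)).map Prod.snd).prod = f (l'.map Prod.snd).prod := by
    rw [map_list_prod, List.map_map, List.map_map]; rfl
  rw [e, hf]
  exact isFree_iff.mp hU l' (by simpa using hl) hl'

theorem IsFreeFrom.map {S T : Set A} (h : IsFreeFrom τ S T) (f : A →ₐ[ℂ] A')
    (hf : ∀ a, τ' (f a) = τ a) : IsFreeFrom τ' (f '' S) (f '' T) := by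
  refine (IsFree.map h f hf).mono ?_
  rintro (_ | _) <;> simp [AlgHom.map_adjoin]

/-- A semicircular member of a free family satisfies the Schwinger–Dyson equation relative to the
other members. -/
theorem schwingerDyson_of_isFree {κ : Type*} {S : κ → Subalgebra ℂ A} (hS : IsFree τ S) {k : κ}
    {z : A} (hz : IsSemicircular τ z) (hzS : z ∈ S k) {G : Set A}
    (hG : ∀ g ∈ G, ∃ j ≠ k, g ∈ S j) : IsScoreOn τ z G (toL2 τ z) :=
  hz.isScoreOn.free_extend hS hzS (by simp)
    (Submodule.le_topologicalClosure _ ⟨z, hzS, rfl⟩) fun g hg => Or.inr (hG g hg)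

end Law

/-! ### Monotonicity of the free entropy -/

section Entropy

theorem integralIoi_mono {f g : ℝ → EReal} (h : ∀ t, f t ≤ g t) :
    integralIoi f ≤ integralIoi g := by
  refine EReal.sub_le_sub ?_ ?_
  · exact EReal.coe_ennreal_le_coe_ennreal_iff.mpr
      (MeasureTheory.lintegral_mono fun t => EReal.toENNReal_le_toENNReal (h t))
  · exact EReal.coe_ennreal_le_coe_ennreal_iff.mpr
      (MeasureTheory.lintegral_mono fun t =>
        EReal.toENNReal_le_toENNReal (EReal.neg_le_neg_iff.mpr (h t)))

theorem entropy_le_of_fisherStar_le {A A' : Type u} [Ring A] [StarRing A] [Algebra ℂ A]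
    [StarModule ℂ A] [Ring A'] [StarRing A'] [Algebra ℂ A'] [StarModule ℂ A']
    {τ : TracialState A} {τ' : TracialState A'} {n : ℕ} {X : Fin n → A} {X' : Fin n → A'}
    (E : SemicircularExtension τ X) (E' : SemicircularExtension τ' X')
    (h : ∀ t : ℝ, fisherStar E'.σ (fun i => E'.incl (X' i) + ((√t : ℝ) : ℂ) • E'.Z i) ≤
      fisherStar E.σ (fun i => E.incl (X i) + ((√t : ℝ) : ℂ) • E.Z i)) :
    E.entropy ≤ E'.entropy := by
  refine add_le_add_left (mul_le_mul_of_nonneg_left (integralIoi_mono fun t => ?_) ?_) _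
  · exact EReal.sub_le_sub le_rfl (EReal.coe_ennreal_le_coe_ennreal_iff.mpr (h t))
  · exact_mod_cast (by norm_num : (0 : ℝ) ≤ 1 / 2)

variable {A : Type u} [Ring A] [StarRing A] [Algebra ℂ A] [StarModule ℂ A]

/-- The extension of `(A, τ)` by semicircular elements that are free from all of `A`. -/
noncomputable def fockExtension (τ : TracialState A) {n : ℕ} (X : Fin n → A) :
    SemicircularExtension τ X where
  C := FockAlg τ n
  σ := FockAlg.vacuum τ n
  incl := FockAlg.incl τ n
  map_incl := FockAlg.vacuum_incl
  Z := FockAlg.Z τ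
  semicircular := FockAlg.Z_isSemicircular
  free := FockAlg.isFree.mono (by
    rintro (_ | i)
    · refine Algebra.adjoin_le ?_
      rintro _ ⟨j, rfl⟩
      exact ⟨X j, rfl⟩
    · exact le_rfl)

/-- In the corner of the Fock extension, the compressed and rescaled elements `√k π(Xᵢ)` and
`√k π(Zᵢ)` have the same joint law as `√k π(Xᵢ)` and free semicircular elements. -/
theorem law_corner_fockExtension {τ : TracialState A} {n : ℕ} {X : Fin n → A} {k : ℝ} {hk : 1 ≤ k}
    {p : A} {hp : IsStarProjection p} {hτ : τ p = ((1 / k : ℝ) : ℂ)}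
    (E : SemicircularExtension (τ.compress hp hk hτ)
      (fun i => ((√k : ℝ) : ℂ) • Corner.compress hp (X i)))
    {q : FockAlg τ n} (hpq : FockAlg.incl τ n p = q) (hq : IsStarProjection q)
    (hσ : FockAlg.vacuum τ n q = ((1 / k : ℝ) : ℂ)) (P : FreeAlgebra ℂ (Fin n ⊕ Fin n)) :
    (FockAlg.vacuum τ n).compress hq hk hσ (FreeAlgebra.lift ℂ (Sum.elim
      (fun i => ((√k : ℝ) : ℂ) • Corner.compress hq (FockAlg.incl τ n (X i)))
      (fun i => ((√k : ℝ) : ℂ) • Corner.compress hq (FockAlg.Z τ i))) P) =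
    E.σ (FreeAlgebra.lift ℂ (Sum.elim
      (fun i => E.incl (((√k : ℝ) : ℂ) • Corner.compress hp (X i))) E.Z) P) := by
  refine law_eq_of_moments (fun w => moments_eq_of_schwingerDyson ?_ ?_ ?_ (w.length + 1) w
    (Nat.lt_succ_self _)) P
  · intro u
    have e1 : (u.map ((Sum.elim
        (fun i => E.incl (((√k : ℝ) : ℂ) • Corner.compress hp (X i))) E.Z) ∘ Sum.inl)).prod =
        E.incl (u.map fun i => ((√k : ℝ) : ℂ) • Corner.compress hp (X i)).prod := by
      rw [map_list_prod, List.map_map]; rfl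
    have e2 : ((u.map ((Sum.elim
        (fun i => ((√k : ℝ) : ℂ) • Corner.compress hq (FockAlg.incl τ n (X i)))
        (fun i => ((√k : ℝ) : ℂ) • Corner.compress hq (FockAlg.Z τ i))) ∘ Sum.inl)).prod).val =
        FockAlg.incl τ n ((u.map fun i => ((√k : ℝ) : ℂ) • Corner.compress hp (X i)).prod).val := by
      clear e1
      induction u with
      | nil => simp [hpq]
      | cons i u ih =>
        simp only [List.map_cons, List.prod_cons, Corner.val_mul, map_mul, ih, Function.comp_apply,
          Sum.elim_inl, Corner.val_smul, Corner.val_compress, map_smul, hpq]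
    rw [e1, E.map_incl, compress_apply, compress_apply, e2, FockAlg.vacuum_incl]
  · intro i a t h
    set G' : Set (FockAlg τ n) := {g | ∃ j ≠ some i, g ∈ (j.elim (FockAlg.incl τ n).toAlgHom.range
      fun i => Algebra.adjoin ℂ {FockAlg.Z τ i} : Subalgebra ℂ (FockAlg τ n))} with hG'
    have hs := schwingerDyson_of_isFree FockAlg.isFree (FockAlg.Z_isSemicircular (τ := τ) i)
      (k := some i) (Algebra.self_mem_adjoin_singleton ℂ _) (G := G') fun g hg => hg
    have hqG : q ∈ G' := ⟨none, by simp, p, hpq⟩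
    have h1 := hs.tensorTrace_corner _ (hk := hk) (hτ := hσ) hqG (by
      rintro _ ⟨_ | j, hj, rfl⟩
      · simp only [Sum.elim_inl, Corner.val_smul, Corner.val_compress]
        exact (((DiffGraph.mem hqG).mul_zero (.mem ⟨none, by simp, X _, rfl⟩)).mul_zero
          (.mem hqG)).smul_zero _
      · simp only [Sum.elim_inr, Corner.val_smul, Corner.val_compress]
        refine (((DiffGraph.mem hqG).mul_zero (.mem ⟨some j, ?_,
          Algebra.self_mem_adjoin_singleton ℂ _⟩)).mul_zero (.mem hqG)).smul_zero _
        rintro hji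
        exact hj (by rw [Option.some.inj hji])) h
    rw [h1, traceMul_toL2, compress_apply, Sum.elim_inr, Corner.val_mul, Corner.val_smul,
      Corner.val_compress, smul_mul_assoc, map_smul, smul_eq_mul]
    have e : FockAlg.vacuum τ n (q * FockAlg.Z τ i * q * a.val) =
        FockAlg.vacuum τ n (FockAlg.Z τ i * a.val) := by
      rw [mul_assoc, Corner.mul_val, mul_assoc, TracialState.mul_comm, mul_assoc,
        Corner.val_mul_self]
    rw [e]; ring
  · intro i a t h
    have hs := schwingerDyson_of_isFree E.free (E.semicircular i) (k := some i)
      (Algebra.self_mem_adjoin_singleton ℂ _)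
      (G := (Sum.elim (fun i => E.incl (((√k : ℝ) : ℂ) • Corner.compress hp (X i))) E.Z) ''
        {j | j ≠ .inr i}) (by
        rintro _ ⟨j | j, hj, rfl⟩
        · exact ⟨none, by simp, Algebra.subset_adjoin ⟨j, rfl⟩⟩
        · refine ⟨some j, ?_, Algebra.self_mem_adjoin_singleton ℂ _⟩
          rintro hji
          exact hj (by rw [Option.some.inj hji]))
    rw [hs a t h, traceMul_toL2]; rfl

/-- At each time `t`, the free Fisher information of the compressed variables perturbed by free
semicircular elements is at most that of the original variables, similarly perturbed. -/
theorem fisherStar_perturbed_le {τ : TracialState A} {n : ℕ} {X : Fin n → A}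
    (hX : ∀ i, IsSelfAdjoint (X i)) {k : ℝ} {hk : 1 ≤ k} {p : A} {hp : IsStarProjection p}
    {hτ : τ p = ((1 / k : ℝ) : ℂ)} (hfree : IsFreeFrom τ {p} (Set.range X))
    (E : SemicircularExtension (τ.compress hp hk hτ)
      (fun i => ((√k : ℝ) : ℂ) • Corner.compress hp (X i))) (t : ℝ) :
    fisherStar E.σ (fun i => E.incl (((√k : ℝ) : ℂ) • Corner.compress hp (X i)) +
        ((√t : ℝ) : ℂ) • E.Z i) ≤
      fisherStar (fockExtension τ X).σ (fun i => (fockExtension τ X).incl (X i) +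
        ((√t : ℝ) : ℂ) • (fockExtension τ X).Z i) := by
  change _ ≤ fisherStar (FockAlg.vacuum τ n) (fun i => FockAlg.incl τ n (X i) +
    ((√t : ℝ) : ℂ) • FockAlg.Z τ i)
  set q := FockAlg.incl τ n p with hqdef
  have hq : IsStarProjection q := hp.map (FockAlg.incl τ n)
  have hσ : FockAlg.vacuum τ n q = ((1 / k : ℝ) : ℂ) := by rw [hqdef, FockAlg.vacuum_incl, hτ]
  have hYsa : ∀ i, IsSelfAdjoint (FockAlg.incl τ n (X i) + ((√t : ℝ) : ℂ) • FockAlg.Z τ i) :=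
    fun i => ((hX i).map (FockAlg.incl τ n)).add
      (IsSelfAdjoint.smul (Complex.conj_ofReal _) (FockAlg.Z_isSelfAdjoint i))
  have hfreeY : IsFreeFrom (FockAlg.vacuum τ n) {q}
      (Set.range fun i => FockAlg.incl τ n (X i) + ((√t : ℝ) : ℂ) • FockAlg.Z τ i) := by
    have h0 : IsFreeFrom (FockAlg.vacuum τ n) {q} (FockAlg.incl τ n '' Set.range X) := by
      have := hfree.map (τ' := FockAlg.vacuum τ n) (FockAlg.incl τ n).toAlgHom FockAlg.vacuum_incl
      rwa [Set.image_singleton] at this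
    refine FockAlg.isFree.isFreeFrom_of_none h0 ⟨p, rfl⟩ ?_ ?_
    · rintro _ ⟨x, -, rfl⟩; exact ⟨x, rfl⟩
    · rintro _ ⟨i, rfl⟩
      refine add_mem ?_ (Subalgebra.smul_mem _ ?_ _)
      · exact Algebra.subset_adjoin (Or.inl ⟨_, ⟨i, rfl⟩, rfl⟩)
      · exact Algebra.subset_adjoin (Or.inr ⟨i, Algebra.self_mem_adjoin_singleton ℂ _⟩)
  refine le_trans ?_ (fisherStar_compress_le (FockAlg.vacuum τ n) hYsa hk hq hσ hfreeY)
  refine fisherStar_le_of_law (fun i => compress_smul_isSelfAdjoint (hYsa i) _) (fun i => ?_)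
    fun P => ?_
  · exact ((compress_smul_isSelfAdjoint (hX i) _).map E.incl).add
      (IsSelfAdjoint.smul (Complex.conj_ofReal _) (E.semicircular i).1)
  · have e := law_corner_fockExtension E hqdef.symm hq hσ
      (FreeAlgebra.lift ℂ (fun i => FreeAlgebra.ι ℂ (Sum.inl i) +
        ((√t : ℝ) : ℂ) • FreeAlgebra.ι ℂ (Sum.inr i)) P)
    have subst : ∀ {B : Type u} [Ring B] [Algebra ℂ B] (v : Fin n ⊕ Fin n → B),
        FreeAlgebra.lift ℂ v (FreeAlgebra.lift ℂ (fun i => FreeAlgebra.ι ℂ (Sum.inl i) +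
          ((√t : ℝ) : ℂ) • FreeAlgebra.ι ℂ (Sum.inr i)) P) =
        FreeAlgebra.lift ℂ (fun i => v (.inl i) + ((√t : ℝ) : ℂ) • v (.inr i)) P := by
      intro B _ _ v
      rw [← AlgHom.comp_apply]
      congr 1
      ext i
      simp only [Function.comp_apply, AlgHom.coe_comp, FreeAlgebra.lift_ι_apply, map_add, map_smul]
    rw [subst, subst] at e
    simp only [Sum.elim_inl, Sum.elim_inr] at e
    rw [← e]
    congr 3
    ext i
    refine Corner.val_injective ?_
    simp only [Corner.val_smul, Corner.val_compress, Corner.val_add, mul_add, add_mul, smul_add,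
      mul_smul_comm, smul_mul_assoc]
    rw [smul_comm]

end Entropy

end FreeProb

theorem theorem2p4 {A : Type u} [Ring A] [StarRing A] [Algebra ℂ A] [StarModule ℂ A]
    (τ : FreeProb.TracialState A) {n : ℕ} (X : Fin n → A) (hX : ∀ i, IsSelfAdjoint (X i))
    (k : ℝ) (hk : 1 ≤ k) (p : A) (hp : IsStarProjection p) (hτ : τ p = ((1 / k : ℝ) : ℂ))
    (hfree : FreeProb.IsFreeFrom τ {p} (Set.range X)) :
    FreeProb.fisherStar (τ.compress hp hk hτ)
        (fun i => ((√k : ℝ) : ℂ) • FreeProb.Corner.compress hp (X i)) ≤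
      FreeProb.fisherStar τ X ∧
    FreeProb.chiStar τ X ≤
      FreeProb.chiStar (τ.compress hp hk hτ)
        (fun i => ((√k : ℝ) : ℂ) • FreeProb.Corner.compress hp (X i)) := by
  refine ⟨FreeProb.fisherStar_compress_le τ hX hk hp hτ hfree, le_iInf fun E => ?_⟩
  exact (iInf_le _ (FreeProb.fockExtension τ X)).trans
    (FreeProb.entropy_le_of_fisherStar_le _ _ (FreeProb.fisherStar_perturbed_le hX hfree E))
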